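/- Let $m\ge 0$, let $X$ be a topological space (for example a finite CW complex), and let $V\to X$ be an oriented Euclidean vector bundle of rank $n=4m$ with a spin structure, i.e. a principal $\mathrm{Spin}_n$-bundle $P$ with an $\mathrm{Ad}$-equivariant two-fold covering $P\to P_{SO}(V)$ over $X$. Let $\mathrm{Cl}(V)$ be the bundle of Clifford algebras $\mathrm{Cl}(V_x)$, with relations $vw+wv=-2\langle v,w\rangle$, let $S$ be the irreducible real $\mathrm{Cl}_n$-module, and let $\Sigma=P\times_{\mathrm{Spin}_n}S$ be the spinor bundle, with the $\mathrm{Cl}(V)$-action $[p,\alpha]\cdot[p,\sigma]=[p,\alpha\sigma]$. A $\mathrm{Cl}(V)$-module bundle is a real vector bundle $\Lambda\to X$ of finite, locally constant rank with a continuous fibrewise action of the algebras $\mathrm{Cl}(V_x)$ on the fibres $\Lambda_x$ and with a Euclidean structure for which the unit vectors of $V$ act orthogonally. For a vector bundle $E$, $\mathrm{Cl}(V)$ acts on $E\otimes\Sigma$ and $E\otimes_{\mathbb H}\Sigma$ by $\alpha\cdot(e\otimes\xi)=e\otimes\alpha\xi$. (a) Let $m$ be even. For every $\mathrm{Cl}(V)$-module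 bundle $\Lambda$, the family $E=\mathrm{Hom}_{\mathrm{Cl}(V)}(\Sigma,\Lambda)$ with fibres $\mathrm{Hom}_{\mathrm{Cl}(V_x)}(\Sigma_x,\Lambda_x)$ can be given the structure of a Euclidean real vector bundle such that the evaluation $\varphi\otimes\xi\mapsto\varphi(\xi)$ is a $\mathrm{Cl}(V)$-linear bundle isomorphism $E\otimes\Sigma\cong\Lambda$. If $E,\tilde E$ are real vector bundles over $X$ such that $E\otimes\Sigma$ and $\tilde E\otimes\Sigma$ are isomorphic by a $\mathrm{Cl}(V)$-linear bundle isomorphism, then $E\cong\tilde E$ as real vector bundles. (b) Let $m$ be odd. Then $S$ has a left $\mathbb H$-module structure which extends the real one and commutes with $\mathrm{Cl}_n$. For every such structure, and with the induced left $\mathbb H$-module structure on the fibres of $\Sigma$, the following holds. For every $\mathrm{Cl}(V)$-module bundle $\Lambda$, the family $E=\mathrm{Hom}_{\mathrm{Cl}(V)}(\Sigma,\Lambda)$, with the right $\mathbb H$-multiplication $(\varphi\lambda)(\xi)=\varphi(\lambda\xi)$, can be given the structure of a (right) quaternionic vector bundle with a Euclidean structure satisfying $\langle\varphi\lambda,\psi\lambda\rangle=|\lambda|^2\langle\varphi,\psi\rangle$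 for $\lambda\in\mathbb H$, such that evaluation induces a $\mathrm{Cl}(V)$-linear isomorphism of real vector bundles $E\otimes_{\mathbb H}\Sigma\cong\Lambda$. If $E,\tilde E$ are right quaternionic vector bundles over $X$ such that $E\otimes_{\mathbb H}\Sigma$ and $\tilde E\otimes_{\mathbb H}\Sigma$ are isomorphic by a $\mathrm{Cl}(V)$-linear isomorphism of real vector bundles, then $E\cong\tilde E$ as quaternionic vector bundles. -/

import Mathlib

open scoped TensorProduct Quaternion

noncomputable section

namespace TwistedSpinor

/-! ## Families of vector spaces with a topology on the total space -/

/-- The total space of a family of sets (later: vector spaces, torsors) indexed by `X`. -/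
structure Tot {X : Type*} (E : X → Type*) where
  base : X
  fib : E base

/-- The map of total spaces induced by a fibrewise map over the identity of `X`. -/
def Tot.map {X : Type*} {E F : X → Type*} (φ : ∀ x, E x → F x) (e : Tot E) : Tot F :=
  ⟨e.base, φ e.base e.fib⟩

/-- The fibre product `E ×_X F` of two families. -/
structure FibProd {X : Type*} (E F : X → Type*) where
  base : X
  fst : E base
  snd : F base

/-- `E ×_X F` carries the subspace topology of `Tot E × Tot F`. -/
instance {X : Type*} (E F : X → Type*) [TopologicalSpace (Tot E)] [TopologicalSpace (Tot F)] :
    TopologicalSpace (FibProd E F) :=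
  TopologicalSpace.induced
    (fun p => ((⟨p.base, p.fst⟩ : Tot E), (⟨p.base, p.snd⟩ : Tot F))) inferInstance

/-- A local trivialization `U × Kⁿ ≅ E|_U`: a homeomorphism onto the open set `E|_U`, which is
`K`-linear on the fibres. For `K = ℝ` this is the usual notion; for `K = ℍᵐᵒᵖ` the fibres are right
quaternionic vector spaces, modelled on the right vector space `ℍⁿ`. -/
structure LocalTriv (K : Type*) [Ring K] [TopologicalSpace K] {X : Type*} [TopologicalSpace X]
    (E : X → Type*) [∀ x, AddCommGroup (E x)] [∀ x, Module K (E x)] [TopologicalSpace (Tot E)]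
    (n : ℕ) where
  baseSet : Set X
  isOpen_baseSet : IsOpen baseSet
  equiv : ∀ x : baseSet, (Fin n → K) ≃ₗ[K] E x
  isOpenEmbedding : Topology.IsOpenEmbedding
    (fun p : baseSet × (Fin n → K) => (⟨p.1, equiv p.1 p.2⟩ : Tot E))

/-- A (topological, finite rank) `K`-vector bundle: a family of `K`-vector spaces with a topology on
the total space that is locally trivial. The rank is locally constant, but it may be different
over different components of `X`. -/
class IsVectorBundle (K : Type*) [Ring K] [TopologicalSpace K] {X : Type*} [TopologicalSpace X]
    (E : X → Type*) [∀ x, AddCommGroup (E x)] [∀ x, Module K (E x)] [TopologicalSpace (Tot E)] :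
    Prop where
  exists_localTriv : ∀ x₀ : X, ∃ (n : ℕ) (e : LocalTriv K E n), x₀ ∈ e.baseSet

/-- A fibrewise linear isomorphism is an isomorphism of bundles if it is a homeomorphism of the
total spaces. -/
def IsBundleIso {K : Type*} [Ring K] {X : Type*} {E F : X → Type*}
    [∀ x, AddCommGroup (E x)] [∀ x, Module K (E x)] [TopologicalSpace (Tot E)]
    [∀ x, AddCommGroup (F x)] [∀ x, Module K (F x)] [TopologicalSpace (Tot F)]
    (φ : ∀ x, E x ≃ₗ[K] F x) : Prop :=
  Continuous (Tot.map fun x => φ x) ∧ Continuous (Tot.map fun x => (φ x).symm)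

/-- A Euclidean structure: a continuous family of inner products on the fibres. -/
structure EuclideanStructure {X : Type*} (E : X → Type*)
    [∀ x, AddCommGroup (E x)] [∀ x, Module ℝ (E x)] [TopologicalSpace (Tot E)] where
  form : ∀ x, LinearMap.BilinForm ℝ (E x)
  symm : ∀ x v w, form x v w = form x w v
  pos : ∀ x v, v ≠ 0 → 0 < form x v v
  continuous_form : Continuous fun p : FibProd E E => form p.base p.fst p.snd

/-- An orientation of the rank `n` bundle `V`: orientations of the fibres that are, locally on `X`,
the standard orientation of `ℝⁿ` in a suitable local trivialization. -/
structure BundleOrientation {X : Type*} [TopologicalSpace X] (V : X → Type*)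
    [∀ x, AddCommGroup (V x)] [∀ x, Module ℝ (V x)] [TopologicalSpace (Tot V)] (n : ℕ) where
  orientation : ∀ x, Orientation ℝ (V x) (Fin n)
  exists_localTriv : ∀ x₀ : X, ∃ e : LocalTriv ℝ V n, x₀ ∈ e.baseSet ∧
    ∀ x : e.baseSet,
      Orientation.map (Fin n) (e.equiv x) (Pi.basisFun ℝ (Fin n)).orientation = orientation x

/-! ## Clifford algebras and the spin group -/

/-- The quadratic form `-(x₁² + ⋯ + xₙ²)` on `ℝⁿ`. -/
abbrev stdForm (n : ℕ) : QuadraticForm ℝ (Fin n → ℝ) :=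
  QuadraticMap.weightedSumSquares ℝ (fun _ : Fin n => (-1 : ℝ))

/-- The Clifford algebra `Clₙ`, with `e_i e_j + e_j e_i = -2 δ_ij`. -/
abbrev Cl (n : ℕ) : Type := CliffordAlgebra (stdForm n)

/-- The canonical topology of the finite dimensional real vector space `Clₙ`. -/
instance (n : ℕ) : TopologicalSpace (Cl n) := moduleTopology ℝ (Cl n)

instance (n : ℕ) : IsModuleTopology ℝ (Cl n) := ⟨rfl⟩

/-- The quadratic form `-⟨v, v⟩` on the fibre `V_x` of a Euclidean bundle. -/
abbrev negForm {X : Type*} {V : X → Type*}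
    [∀ x, AddCommGroup (V x)] [∀ x, Module ℝ (V x)] [TopologicalSpace (Tot V)]
    (g : EuclideanStructure V) (x : X) : QuadraticForm ℝ (V x) :=
  -(LinearMap.BilinMap.toQuadraticMap (g.form x))

/-- The fibre `Cl(V_x)` of the Clifford algebra bundle, with `v w + w v = -2 ⟨v, w⟩`. -/
abbrev ClFibre {X : Type*} {V : X → Type*}
    [∀ x, AddCommGroup (V x)] [∀ x, Module ℝ (V x)] [TopologicalSpace (Tot V)]
    (g : EuclideanStructure V) (x : X) : Type _ :=
  CliffordAlgebra (negForm g x)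

theorem star_mem_even {n : ℕ} {a : Cl n} (ha : a ∈ CliffordAlgebra.even (stdForm n)) :
    star a ∈ CliffordAlgebra.even (stdForm n) := by
  dsimp only [CliffordAlgebra.even] at ha ⊢
  simp only [Submodule.mem_toSubalgebra] at ha ⊢
  simp only [CliffordAlgebra.star_def, CliffordAlgebra.reverse_mem_evenOdd_iff,
    CliffordAlgebra.involute_mem_evenOdd_iff, ha]

/-- The group `Spinₙ`: the even elements `h` of `Clₙ` with `h* h = h h* = 1` (where `*` is the
antiautomorphism with `v* = -v` for vectors `v`) and `h ℝⁿ h⁻¹ = ℝⁿ`. It maps onto `SOₙ` with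
kernel `{1, -1}`, for every `n ≥ 0`; in particular `Spin₀ = {1, -1}`. -/
def Spin (n : ℕ) : Subgroup (Cl n)ˣ where
  carrier := {h | (h : Cl n) ∈ CliffordAlgebra.even (stdForm n) ∧
    star (h : Cl n) * h = 1 ∧
    (∀ v : Fin n → ℝ, ∃ w : Fin n → ℝ, (h : Cl n) * CliffordAlgebra.ι (stdForm n) v *
      ((h⁻¹ : (Cl n)ˣ) : Cl n) = CliffordAlgebra.ι (stdForm n) w) ∧
    ∀ v : Fin n → ℝ, ∃ w : Fin n → ℝ, ((h⁻¹ : (Cl n)ˣ) : Cl n) *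
      CliffordAlgebra.ι (stdForm n) v * (h : Cl n) = CliffordAlgebra.ι (stdForm n) w}
  one_mem' := by
    refine ⟨?_, ?_, fun v => ⟨v, by simp⟩, fun v => ⟨v, by simp⟩⟩
    · rw [Units.val_one]; exact one_mem _
    · simp
  mul_mem' := by
    rintro a b ⟨ha, ha', ha1, ha2⟩ ⟨hb, hb', hb1, hb2⟩
    refine ⟨?_, ?_, fun v => ?_, fun v => ?_⟩
    · rw [Units.val_mul]; exact mul_mem ha hb
    · rw [Units.val_mul, star_mul, mul_assoc, ← mul_assoc _ (a : Cl n), ha', one_mul, hb']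
    · obtain ⟨w, hw⟩ := hb1 v
      obtain ⟨w', hw'⟩ := ha1 w
      refine ⟨w', ?_⟩
      rw [← hw', ← hw, mul_inv_rev, Units.val_mul, Units.val_mul]
      simp only [mul_assoc]
    · obtain ⟨w, hw⟩ := ha2 v
      obtain ⟨w', hw'⟩ := hb2 w
      refine ⟨w', ?_⟩
      rw [← hw', ← hw, mul_inv_rev, Units.val_mul, Units.val_mul]
      simp only [mul_assoc]
  inv_mem' := by
    rintro a ⟨ha, ha', ha1, ha2⟩
    have hs : star (a : Cl n) = ((a⁻¹ : (Cl n)ˣ) : Cl n) := by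
      rw [← mul_one (star (a : Cl n)), ← Units.mul_inv a, ← mul_assoc, ha', one_mul]
    refine ⟨?_, ?_, ?_, ?_⟩
    · rw [← hs]; exact star_mem_even ha
    · rw [← hs, star_star, hs, Units.mul_inv]
    · simpa using ha2
    · simpa using ha1

/-- The underlying Clifford element of an element of the spin group. -/
abbrev spinVal {n : ℕ} (h : Spin n) : Cl n := ((h : (Cl n)ˣ) : Cl n)

theorem spinVal_inv_mul {n : ℕ} (h : Spin n) : spinVal h⁻¹ * spinVal h = 1 := by
  simp [spinVal]

theorem spinVal_mul_inv {n : ℕ} (h : Spin n) : spinVal h * spinVal h⁻¹ = 1 := by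
  simp [spinVal]

theorem spinVal_mul {n : ℕ} (h k : Spin n) : spinVal (h * k) = spinVal h * spinVal k := by
  simp [spinVal]

/-! ## Principal bundles and spin structures -/

/-- The oriented orthonormal frames of `V_x`, as orientation preserving isometries `ℝⁿ → V_x`. -/
def OrFrame {X : Type*} [TopologicalSpace X] {V : X → Type*}
    [∀ x, AddCommGroup (V x)] [∀ x, Module ℝ (V x)] [TopologicalSpace (Tot V)] {n : ℕ}
    (g : EuclideanStructure V) (o : BundleOrientation V n) (x : X) : Type _ :=
  {b : (stdForm n).IsometryEquiv (negForm g x) //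
    Orientation.map (Fin n) b.toLinearEquiv (Pi.basisFun ℝ (Fin n)).orientation = o.orientation x}

/-- The topology of the frame bundle `P_SO(V)`, as a subspace of the `n`-tuples of elements
of `V` with a common base point. -/
instance {X : Type*} [TopologicalSpace X] {V : X → Type*}
    [∀ x, AddCommGroup (V x)] [∀ x, Module ℝ (V x)] [TopologicalSpace (Tot V)] {n : ℕ}
    (g : EuclideanStructure V) (o : BundleOrientation V n) :
    TopologicalSpace (Tot (OrFrame g o)) :=
  TopologicalSpace.induced
    (fun b => (b.base, fun i : Fin n => (⟨b.base, b.fib.1 (Pi.single i 1)⟩ : Tot V))) inferInstance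

/-- A principal `G`-bundle with fibres `P x`, on which `G` acts from the right. -/
class IsPrincipalBundle (G : Type*) [Group G] [TopologicalSpace G] {X : Type*} [TopologicalSpace X]
    (P : X → Type*) [∀ x, MulAction Gᵐᵒᵖ (P x)] [TopologicalSpace (Tot P)] : Prop where
  locally_trivial : ∀ x₀ : X, ∃ U : Set X, IsOpen U ∧ x₀ ∈ U ∧ ∃ Φ : ∀ x : U, G ≃ P x,
    (∀ x a h, Φ x (a * h) = MulOpposite.op h • Φ x a) ∧
    Topology.IsOpenEmbedding (fun p : U × G => (⟨p.1, Φ p.1 p.2⟩ : Tot P))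

/-- A spin structure on the oriented Euclidean bundle `V` of rank `n`: a principal `Spinₙ`-bundle
`P` and a two-fold covering `P → P_SO(V)` over `X`, which is equivariant with respect
to `Ad : Spinₙ → SOₙ`, `Ad h v = h v h⁻¹`. -/
structure SpinStructure.{uP, uX, uV} {X : Type uX} [TopologicalSpace X] {V : X → Type uV}
    [∀ x, AddCommGroup (V x)] [∀ x, Module ℝ (V x)] [TopologicalSpace (Tot V)] {n : ℕ}
    (g : EuclideanStructure V) (o : BundleOrientation V n) where
  P : X → Type uP
  [act : ∀ x, MulAction (Spin n)ᵐᵒᵖ (P x)]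
  [top : TopologicalSpace (Tot P)]
  principal : IsPrincipalBundle (Spin n) P
  frame : ∀ x, P x → OrFrame g o x
  equivariant : ∀ x (p : P x) (h : Spin n) (v w : Fin n → ℝ),
    spinVal h * CliffordAlgebra.ι (stdForm n) v * spinVal h⁻¹ = CliffordAlgebra.ι (stdForm n) w →
    (frame x (MulOpposite.op h • p)).1 v = (frame x p).1 w
  isCoveringMap : IsCoveringMap (Tot.map frame)
  two_fold : ∀ b : Tot (OrFrame g o), (Tot.map frame ⁻¹' {b}).ncard = 2

attribute [instance] SpinStructure.act SpinStructure.top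

section

variable {X : Type*} [TopologicalSpace X] {V : X → Type*}
  [∀ x, AddCommGroup (V x)] [∀ x, Module ℝ (V x)] [TopologicalSpace (Tot V)] {n : ℕ}
  {g : EuclideanStructure V} {o : BundleOrientation V n} (𝔰 : SpinStructure g o)

theorem SpinStructure.existsUnique_smul_eq {x : X} (p q : 𝔰.P x) :
    ∃! h : Spin n, MulOpposite.op h • p = q := by
  obtain ⟨U, -, hxU, Φ, hΦ, -⟩ := 𝔰.principal.locally_trivial x
  refine ⟨((Φ ⟨x, hxU⟩).symm p)⁻¹ * (Φ ⟨x, hxU⟩).symm q, ?_, fun h hh => ?_⟩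
  · have := hΦ ⟨x, hxU⟩ ((Φ ⟨x, hxU⟩).symm p) (((Φ ⟨x, hxU⟩).symm p)⁻¹ * (Φ ⟨x, hxU⟩).symm q)
    simpa using this.symm
  · have := hΦ ⟨x, hxU⟩ ((Φ ⟨x, hxU⟩).symm p) h
    rw [Equiv.apply_symm_apply, hh] at this
    rw [← this, Equiv.symm_apply_apply, inv_mul_cancel_left]

/-- The element of the spin group that moves `p` to `q`. -/
def SpinStructure.diff {x : X} (p q : 𝔰.P x) : Spin n := (𝔰.existsUnique_smul_eq p q).choose

theorem SpinStructure.diff_spec {x : X} (p q : 𝔰.P x) : MulOpposite.op (𝔰.diff p q) • p = q :=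
  (𝔰.existsUnique_smul_eq p q).choose_spec.1

theorem SpinStructure.diff_eq {x : X} {p q : 𝔰.P x} {h : Spin n} (hh : MulOpposite.op h • p = q) :
    𝔰.diff p q = h :=
  ((𝔰.existsUnique_smul_eq p q).choose_spec.2 h hh).symm

/-! ## The spinor bundle -/

variable (S : Type*) [AddCommGroup S] [Module ℝ S] [Module (Cl n) S] [IsScalarTower ℝ (Cl n) S]

/-- The fibre over `x` of the associated bundle `P ×_{Spinₙ} S`. The class `[p, s]`
is represented by the map `f : P_x → S` with `f (p h) = h⁻¹ s`; see `Spinor.mk` below. -/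
def spinorSubmodule (x : X) : Submodule ℝ (𝔰.P x → S) where
  carrier := {f | ∀ (p : 𝔰.P x) (h : Spin n), f (MulOpposite.op h • p) = spinVal h⁻¹ • f p}
  add_mem' := by
    intro a b ha hb p h
    simp only [Pi.add_apply, ha p h, hb p h, smul_add]
  zero_mem' := by
    intro p h
    simp
  smul_mem' := by
    intro c a ha p h
    simp only [Pi.smul_apply, ha p h]
    rw [smul_comm]

/-- The spinor bundle `Σ = P ×_{Spinₙ} S`. -/
def Spinor (x : X) : Type _ := spinorSubmodule 𝔰 S x

instance (x : X) : AddCommGroup (Spinor 𝔰 S x) := inferInstanceAs (AddCommGroup (spinorSubmodule 𝔰 S x))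

instance (x : X) : Module ℝ (Spinor 𝔰 S x) := inferInstanceAs (Module ℝ (spinorSubmodule 𝔰 S x))

variable {S}

@[ext] theorem Spinor.ext {x : X} {f f' : Spinor 𝔰 S x} (h : ∀ p, f.1 p = f'.1 p) : f = f' :=
  Subtype.ext (funext h)

/-- The class `[p, s]` in `P ×_{Spinₙ} S`. -/
def Spinor.mk {x : X} (p : 𝔰.P x) (s : S) : Spinor 𝔰 S x :=
  ⟨fun q => spinVal (𝔰.diff p q)⁻¹ • s, by
    intro q h
    have : 𝔰.diff p (MulOpposite.op h • q) = 𝔰.diff p q * h := by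
      apply 𝔰.diff_eq
      rw [MulOpposite.op_mul, mul_smul, 𝔰.diff_spec]
    beta_reduce
    rw [this, mul_inv_rev, spinVal_mul, mul_smul]⟩

theorem Spinor.mk_apply_self {x : X} (p : 𝔰.P x) (s : S) : (Spinor.mk 𝔰 p s).1 p = s := by
  have : 𝔰.diff p p = 1 := 𝔰.diff_eq (by simp)
  change spinVal (𝔰.diff p p)⁻¹ • s = s
  rw [this]
  simp [spinVal]

theorem Spinor.mk_apply_eq {x : X} (p : 𝔰.P x) (f : Spinor 𝔰 S x) :
    Spinor.mk 𝔰 p (f.1 p) = f := by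
  ext q
  have := f.2 p (𝔰.diff p q)
  rw [𝔰.diff_spec] at this
  exact this.symm

/-- `(p, s) ↦ [p, s]` identifies exactly the orbits `(p h, s) ∼ (p, h s)` of the spin group. -/
theorem Spinor.mk_eq_mk_iff {x : X} (p q : 𝔰.P x) (s t : S) :
    Spinor.mk 𝔰 p s = Spinor.mk 𝔰 q t ↔ ∃ h : Spin n, q = MulOpposite.op h • p ∧ s = spinVal h • t := by
  constructor
  · intro e
    refine ⟨𝔰.diff p q, (𝔰.diff_spec p q).symm, ?_⟩
    have h1 : spinVal (𝔰.diff p q)⁻¹ • s = t := by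
      rw [← Spinor.mk_apply_self 𝔰 q t, ← e]; rfl
    rw [← h1, smul_smul, spinVal_mul_inv, one_smul]
  · rintro ⟨h, rfl, rfl⟩
    rw [← Spinor.mk_apply_eq 𝔰 (MulOpposite.op h • p) (Spinor.mk 𝔰 p (spinVal h • t))]
    congr 1
    rw [(Spinor.mk 𝔰 p (spinVal h • t)).2, Spinor.mk_apply_self, smul_smul, spinVal_inv_mul,
      one_smul]

/-- The total space of the spinor bundle carries the quotient topology of
`P ×_X (X × S) = P × S`. -/
instance [TopologicalSpace S] : TopologicalSpace (Tot (Spinor 𝔰 S)) :=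
  TopologicalSpace.coinduced
    (fun p : Tot 𝔰.P × S => (⟨p.1.base, Spinor.mk 𝔰 p.1.fib p.2⟩ : Tot (Spinor 𝔰 S))) inferInstance

/-! ## Clifford module bundles -/

/-- The isomorphism `Clₙ ≅ Cl(V_x)` induced by (the frame underlying) `p ∈ P_x`. It sends `α` to
the class `[p, α]` in `Cl(V) = P ×_{Spinₙ} Clₙ`. -/
def SpinStructure.clEquiv {x : X} (p : 𝔰.P x) : Cl n ≃ₐ[ℝ] ClFibre g x :=
  CliffordAlgebra.equivOfIsometry (𝔰.frame x p).1

theorem SpinStructure.clEquiv_smul {x : X} (p : 𝔰.P x) (h : Spin n) (a : Cl n) :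
    𝔰.clEquiv (MulOpposite.op h • p) a = 𝔰.clEquiv p (spinVal h * a * spinVal h⁻¹) := by
  have hι : ∀ (q : 𝔰.P x) (v : Fin n → ℝ), 𝔰.clEquiv q (CliffordAlgebra.ι (stdForm n) v) =
      CliffordAlgebra.ι (negForm g x) ((𝔰.frame x q).1 v) := by
    intro q v
    simp [SpinStructure.clEquiv, CliffordAlgebra.equivOfIsometry]
  induction a using CliffordAlgebra.induction with
  | algebraMap r =>
    rw [← Algebra.commutes r (spinVal h), mul_assoc, spinVal_mul_inv, mul_one, AlgEquiv.commutes,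
      AlgEquiv.commutes]
  | ι v =>
    obtain ⟨w, hw⟩ := h.2.2.2.1 v
    have hw' : spinVal h * CliffordAlgebra.ι (stdForm n) v * spinVal h⁻¹ =
      CliffordAlgebra.ι (stdForm n) w := hw
    rw [hw', hι, hι, 𝔰.equivariant x p h v w hw']
  | mul a b ha hb =>
    rw [map_mul, ha, hb, ← map_mul]
    congr 1
    simp only [mul_assoc]
    rw [← mul_assoc (spinVal h⁻¹) (spinVal h), spinVal_inv_mul, one_mul]
  | add a b ha hb => rw [map_add, ha, hb, ← map_add, mul_add, add_mul]

theorem SpinStructure.clEquiv_symm_smul {x : X} (p : 𝔰.P x) (h : Spin n) (a : ClFibre g x) :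
    (𝔰.clEquiv (MulOpposite.op h • p)).symm a =
      spinVal h⁻¹ * (𝔰.clEquiv p).symm a * spinVal h := by
  rw [AlgEquiv.symm_apply_eq, 𝔰.clEquiv_smul]
  simp only [← mul_assoc]
  rw [spinVal_mul_inv, one_mul, mul_assoc, spinVal_mul_inv, mul_one, AlgEquiv.apply_symm_apply]

end

/-- A fibrewise action of the Clifford algebras `Cl(V_x)`, by algebra homomorphisms. -/
abbrev ClAction {X : Type*} {V : X → Type*}
    [∀ x, AddCommGroup (V x)] [∀ x, Module ℝ (V x)] [TopologicalSpace (Tot V)]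
    (g : EuclideanStructure V) (L : X → Type*)
    [∀ x, AddCommGroup (L x)] [∀ x, Module ℝ (L x)] : Type _ :=
  ∀ x, ClFibre g x →ₐ[ℝ] Module.End ℝ (L x)

/-- A `Cl(V)`-module bundle structure on the vector bundle `L`: a continuous action of the Clifford
algebras of the fibres, together with a Euclidean structure for which unit vectors act
orthogonally. Since `Cl(V)` is generated by `V`, it is enough to ask for continuity on `V`. -/
structure ClModuleBundle {X : Type*} {V : X → Type*}
    [∀ x, AddCommGroup (V x)] [∀ x, Module ℝ (V x)] [TopologicalSpace (Tot V)]
    (g : EuclideanStructure V) (L : X → Type*)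
    [∀ x, AddCommGroup (L x)] [∀ x, Module ℝ (L x)] [TopologicalSpace (Tot L)] where
  μ : ClAction g L
  continuous_μ : Continuous fun p : FibProd V L =>
    (⟨p.base, μ p.base (CliffordAlgebra.ι (negForm g p.base) p.fst) p.snd⟩ : Tot L)
  metric : EuclideanStructure L
  orthogonal : ∀ x (v : V x), g.form x v v = 1 → ∀ ξ η : L x,
    metric.form x (μ x (CliffordAlgebra.ι (negForm g x) v) ξ)
      (μ x (CliffordAlgebra.ι (negForm g x) v) η) = metric.form x ξ η

/-- A fibrewise linear isomorphism is `Cl(V)`-linear. -/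
def IsClLinear {X : Type*} {V : X → Type*}
    [∀ x, AddCommGroup (V x)] [∀ x, Module ℝ (V x)] [TopologicalSpace (Tot V)]
    {g : EuclideanStructure V} {L L' : X → Type*}
    [∀ x, AddCommGroup (L x)] [∀ x, Module ℝ (L x)]
    [∀ x, AddCommGroup (L' x)] [∀ x, Module ℝ (L' x)]
    (μ : ClAction g L) (μ' : ClAction g L') (φ : ∀ x, L x ≃ₗ[ℝ] L' x) : Prop :=
  ∀ x (a : ClFibre g x) (ξ : L x), φ x (μ x a ξ) = μ' x a (φ x ξ)

section

variable {X : Type*} [TopologicalSpace X] {V : X → Type*}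
  [∀ x, AddCommGroup (V x)] [∀ x, Module ℝ (V x)] [TopologicalSpace (Tot V)] {n : ℕ}
  {g : EuclideanStructure V} {o : BundleOrientation V n} (𝔰 : SpinStructure g o)
  (S : Type*) [AddCommGroup S] [Module ℝ S] [Module (Cl n) S] [IsScalarTower ℝ (Cl n) S]

/-- Clifford multiplication on spinors, `[p, α] · [p, σ] = [p, α σ]`. -/
def spinorAction : ClAction g (Spinor 𝔰 S) := fun x =>
  AlgHom.ofLinearMap
    { toFun := fun a =>
        { toFun := fun f => ⟨fun p => (𝔰.clEquiv p).symm a • f.1 p, by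
            intro p h
            have hf := f.2 p h
            simp only [hf, 𝔰.clEquiv_symm_smul, smul_smul]
            rw [mul_assoc, spinVal_mul_inv, mul_one]⟩
          map_add' := fun f f' => Spinor.ext 𝔰 fun p => smul_add _ (f.1 p) (f'.1 p)
          map_smul' := fun c f => Spinor.ext 𝔰 fun p => smul_comm _ c (f.1 p) }
      map_add' := fun a b => LinearMap.ext fun f => Spinor.ext 𝔰 fun p => by
        change (𝔰.clEquiv p).symm (a + b) • f.1 p = _ • f.1 p + _ • f.1 p
        rw [map_add, add_smul]
      map_smul' := fun c a => LinearMap.ext fun f => Spinor.ext 𝔰 fun p => by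
        change (𝔰.clEquiv p).symm (c • a) • f.1 p = c • (_ • f.1 p)
        rw [map_smul, smul_assoc] }
    (LinearMap.ext fun f => Spinor.ext 𝔰 fun p => by
        change (𝔰.clEquiv p).symm 1 • f.1 p = f.1 p
        rw [map_one, one_smul])
    (fun a b => LinearMap.ext fun f => Spinor.ext 𝔰 fun p => by
        change (𝔰.clEquiv p).symm (a * b) • f.1 p = _ • (_ • f.1 p)
        rw [map_mul, mul_smul])

theorem spinorAction_mk {x : X} (p : 𝔰.P x) (a : Cl n) (s : S) :
    spinorAction 𝔰 S x (𝔰.clEquiv p a) (Spinor.mk 𝔰 p s) = Spinor.mk 𝔰 p (a • s) := by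
  rw [← Spinor.mk_apply_eq 𝔰 p (spinorAction 𝔰 S x (𝔰.clEquiv p a) (Spinor.mk 𝔰 p s))]
  congr 1
  change (𝔰.clEquiv p).symm (𝔰.clEquiv p a) • (Spinor.mk 𝔰 p s).1 p = _
  rw [AlgEquiv.symm_apply_apply, Spinor.mk_apply_self]

/-- A quaternionic structure on `S` that commutes with `Clₙ` makes the spinor bundle
quaternionic, `λ · [p, s] = [p, λ s]`. -/
instance [Module ℍ[ℝ] S] [SMulCommClass ℍ[ℝ] (Cl n) S] (x : X) :
    Module ℍ[ℝ] (Spinor 𝔰 S x) where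
  smul l f := ⟨fun p => l • f.1 p, fun p h => by
    have hf := f.2 p h
    simp only [hf]
    rw [smul_comm]⟩
  one_smul f := Spinor.ext 𝔰 fun p => one_smul _ (f.1 p)
  mul_smul l k f := Spinor.ext 𝔰 fun p => mul_smul l k (f.1 p)
  smul_zero l := Spinor.ext 𝔰 fun _ => smul_zero l
  smul_add l f f' := Spinor.ext 𝔰 fun p => smul_add l (f.1 p) (f'.1 p)
  add_smul l k f := Spinor.ext 𝔰 fun p => add_smul l k (f.1 p)
  zero_smul f := Spinor.ext 𝔰 fun p => zero_smul _ (f.1 p)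

theorem quaternion_smul_spinorAction [Module ℍ[ℝ] S] [SMulCommClass ℍ[ℝ] (Cl n) S] {x : X}
    (l : ℍ[ℝ]) (a : ClFibre g x) (f : Spinor 𝔰 S x) :
    spinorAction 𝔰 S x a (l • f) = l • spinorAction 𝔰 S x a f :=
  Spinor.ext 𝔰 fun p => (smul_comm l ((𝔰.clEquiv p).symm a) (f.1 p)).symm

instance [Module ℍ[ℝ] S] [SMulCommClass ℍ[ℝ] (Cl n) S] [IsScalarTower ℝ ℍ[ℝ] S] (x : X) :
    IsScalarTower ℝ ℍ[ℝ] (Spinor 𝔰 S x) :=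
  ⟨fun c l f => Spinor.ext 𝔰 fun p => smul_assoc c l (f.1 p)⟩

end

/-! ## Tensor products of bundles -/

section

variable {X : Type*} [TopologicalSpace X]

/-- The bundle `E ⊗ F`. -/
def TensorBundle (E F : X → Type*)
    [∀ x, AddCommGroup (E x)] [∀ x, Module ℝ (E x)]
    [∀ x, AddCommGroup (F x)] [∀ x, Module ℝ (F x)] (x : X) : Type _ := E x ⊗[ℝ] F x

variable (E F : X → Type*)
  [∀ x, AddCommGroup (E x)] [∀ x, Module ℝ (E x)]
  [∀ x, AddCommGroup (F x)] [∀ x, Module ℝ (F x)]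

instance (x : X) : AddCommGroup (TensorBundle E F x) :=
  inferInstanceAs (AddCommGroup (E x ⊗[ℝ] F x))

instance (x : X) : Module ℝ (TensorBundle E F x) :=
  inferInstanceAs (Module ℝ (E x ⊗[ℝ] F x))

/-- The pure tensor `e ⊗ f` as an element of the bundle `E ⊗ F`. -/
def TensorBundle.tmul {x : X} (e : E x) (f : F x) : TensorBundle E F x := e ⊗ₜ[ℝ] f

/-- The chart of `E ⊗ F` over `U ∩ U'` given by trivializations of `E` over `U` and of `F`
over `U'`. It maps `(x, c)` to `∑ c_ij e_i(x) ⊗ f_j(x)`, where the `e_i` and `f_j` are the local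
frames that belong to the two trivializations. -/
def tensorChart {E F : X → Type*}
    [∀ x, AddCommGroup (E x)] [∀ x, Module ℝ (E x)]
    [∀ x, AddCommGroup (F x)] [∀ x, Module ℝ (F x)]
    [TopologicalSpace (Tot E)] [TopologicalSpace (Tot F)] {k l : ℕ}
    (e : LocalTriv ℝ E k) (f : LocalTriv ℝ F l)
    (p : (e.baseSet ∩ f.baseSet : Set X) × (Fin k → Fin l → ℝ)) : Tot (TensorBundle E F) :=
  ⟨p.1, ∑ i, ∑ j, p.2 i j • TensorBundle.tmul E F
    (e.equiv ⟨p.1, p.1.2.1⟩ (Pi.single i 1)) (f.equiv ⟨p.1, p.1.2.2⟩ (Pi.single j 1))⟩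

/-- The topology of `E ⊗ F` determined by these charts: a set is open if and only if its preimage
under each chart is. -/
instance [TopologicalSpace (Tot E)] [TopologicalSpace (Tot F)] :
    TopologicalSpace (Tot (TensorBundle E F)) :=
  ⨆ (k : ℕ) (l : ℕ) (e : LocalTriv ℝ E k) (f : LocalTriv ℝ F l),
    TopologicalSpace.coinduced (tensorChart e f) inferInstance

/-- The submodule of `E_x ⊗ F_x` spanned by the `e λ ⊗ f - e ⊗ λ f` with `λ ∈ ℍ`. -/
def hRel [∀ x, Module ℍ[ℝ]ᵐᵒᵖ (E x)] [∀ x, Module ℍ[ℝ] (F x)] (x : X) :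
    Submodule ℝ (TensorBundle E F x) :=
  Submodule.span ℝ {t | ∃ (e : E x) (l : ℍ[ℝ]) (f : F x),
    t = TensorBundle.tmul E F (MulOpposite.op l • e) f - TensorBundle.tmul E F e (l • f)}

/-- The real bundle `E ⊗_ℍ F`, for a bundle `E` of right and a bundle `F` of
left quaternionic vector spaces. -/
def HTensorBundle [∀ x, Module ℍ[ℝ]ᵐᵒᵖ (E x)] [∀ x, Module ℍ[ℝ] (F x)] (x : X) : Type _ :=
  TensorBundle E F x ⧸ hRel E F x

variable [∀ x, Module ℍ[ℝ]ᵐᵒᵖ (E x)] [∀ x, Module ℍ[ℝ] (F x)]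

instance (x : X) : AddCommGroup (HTensorBundle E F x) :=
  inferInstanceAs (AddCommGroup (TensorBundle E F x ⧸ hRel E F x))

instance (x : X) : Module ℝ (HTensorBundle E F x) :=
  inferInstanceAs (Module ℝ (TensorBundle E F x ⧸ hRel E F x))

/-- The projection `E ⊗ F → E ⊗_ℍ F`. -/
def HTensorBundle.proj (x : X) : TensorBundle E F x →ₗ[ℝ] HTensorBundle E F x :=
  (hRel E F x).mkQ

/-- The element `e ⊗ f` of `E ⊗_ℍ F`. -/
def HTensorBundle.tmul {x : X} (e : E x) (f : F x) : HTensorBundle E F x :=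
  HTensorBundle.proj E F x (TensorBundle.tmul E F e f)

/-- The quotient topology on `E ⊗_ℍ F`. -/
instance [TopologicalSpace (Tot E)] [TopologicalSpace (Tot F)] :
    TopologicalSpace (Tot (HTensorBundle E F)) :=
  TopologicalSpace.coinduced (Tot.map fun x => HTensorBundle.proj E F x) inferInstance

end

section

variable {X : Type*} [TopologicalSpace X] {V : X → Type*}
  [∀ x, AddCommGroup (V x)] [∀ x, Module ℝ (V x)] [TopologicalSpace (Tot V)] {n : ℕ}
  {g : EuclideanStructure V} {o : BundleOrientation V n} (𝔰 : SpinStructure g o)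
  (S : Type*) [AddCommGroup S] [Module ℝ S] [Module (Cl n) S] [IsScalarTower ℝ (Cl n) S]
  (E : X → Type*) [∀ x, AddCommGroup (E x)] [∀ x, Module ℝ (E x)]

/-- The Clifford action on the twisted spinor bundle `E ⊗ Σ`, `α (e ⊗ ξ) = e ⊗ α ξ`. -/
def twistedAction : ClAction g (TensorBundle E (Spinor 𝔰 S)) := fun x =>
  (Module.End.lTensorAlgHom ℝ (Spinor 𝔰 S x) (E x)).comp (spinorAction 𝔰 S x)

theorem twistedAction_tmul {x : X} (a : ClFibre g x) (e : E x) (ξ : Spinor 𝔰 S x) :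
    twistedAction 𝔰 S E x a (TensorBundle.tmul _ _ e ξ) =
      TensorBundle.tmul _ _ e (spinorAction 𝔰 S x a ξ) := rfl

variable [∀ x, Module ℍ[ℝ]ᵐᵒᵖ (E x)] [Module ℍ[ℝ] S] [SMulCommClass ℍ[ℝ] (Cl n) S]

theorem hRel_le_comap (x : X) (a : ClFibre g x) :
    hRel E (Spinor 𝔰 S) x ≤ (hRel E (Spinor 𝔰 S) x).comap (twistedAction 𝔰 S E x a) := by
  refine Submodule.span_le.2 ?_
  rintro _ ⟨e, l, f, rfl⟩
  change twistedAction 𝔰 S E x a (TensorBundle.tmul _ _ _ _ - TensorBundle.tmul _ _ _ _) ∈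
    hRel E (Spinor 𝔰 S) x
  rw [map_sub, twistedAction_tmul, twistedAction_tmul, quaternion_smul_spinorAction]
  exact Submodule.subset_span ⟨e, l, _, rfl⟩

/-- The Clifford action on the twisted spinor bundle `E ⊗_ℍ Σ`, `α (e ⊗ ξ) = e ⊗ α ξ`. -/
def hTwistedAction : ClAction g (HTensorBundle E (Spinor 𝔰 S)) := fun x =>
  AlgHom.ofLinearMap
    { toFun := fun a => (hRel E (Spinor 𝔰 S) x).mapQ _ _ (hRel_le_comap 𝔰 S E x a)
      map_add' := fun a b => Submodule.linearMap_qext _ (LinearMap.ext fun t => by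
        change HTensorBundle.proj _ _ x (twistedAction 𝔰 S E x (a + b) t) =
          HTensorBundle.proj _ _ x (twistedAction 𝔰 S E x a t) +
            HTensorBundle.proj _ _ x (twistedAction 𝔰 S E x b t)
        rw [map_add, LinearMap.add_apply, map_add])
      map_smul' := fun c a => Submodule.linearMap_qext _ (LinearMap.ext fun t => by
        change HTensorBundle.proj _ _ x (twistedAction 𝔰 S E x (c • a) t) =
          c • HTensorBundle.proj _ _ x (twistedAction 𝔰 S E x a t)
        rw [map_smul, LinearMap.smul_apply, map_smul]) }
    (Submodule.linearMap_qext _ (LinearMap.ext fun t => by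
        change HTensorBundle.proj _ _ x (twistedAction 𝔰 S E x 1 t) = HTensorBundle.proj _ _ x t
        rw [map_one, Module.End.one_apply]))
    (fun a b => Submodule.linearMap_qext _ (LinearMap.ext fun t => by
        change HTensorBundle.proj _ _ x (twistedAction 𝔰 S E x (a * b) t) =
          HTensorBundle.proj _ _ x (twistedAction 𝔰 S E x a (twistedAction 𝔰 S E x b t))
        rw [map_mul, Module.End.mul_apply]))

theorem hTwistedAction_tmul {x : X} (a : ClFibre g x) (e : E x) (ξ : Spinor 𝔰 S x) :
    hTwistedAction 𝔰 S E x a (HTensorBundle.tmul _ _ e ξ) =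
      HTensorBundle.tmul _ _ e (spinorAction 𝔰 S x a ξ) := rfl

end

/-! ## The bundle `Hom_{Cl(V)}(Σ, L)` -/

section

variable {X : Type*} [TopologicalSpace X] {V : X → Type*}
  [∀ x, AddCommGroup (V x)] [∀ x, Module ℝ (V x)] [TopologicalSpace (Tot V)] {n : ℕ}
  {g : EuclideanStructure V} {o : BundleOrientation V n} (𝔰 : SpinStructure g o)
  (S : Type*) [AddCommGroup S] [Module ℝ S] [Module (Cl n) S] [IsScalarTower ℝ (Cl n) S]
  {L : X → Type*} [∀ x, AddCommGroup (L x)] [∀ x, Module ℝ (L x)] (μ : ClAction g L)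

/-- The space of `Cl(V_x)`-linear maps `Σ_x → L_x`. -/
def clHomSubmodule (x : X) : Submodule ℝ (Spinor 𝔰 S x →ₗ[ℝ] L x) where
  carrier := {φ | ∀ a ξ, φ (spinorAction 𝔰 S x a ξ) = μ x a (φ ξ)}
  add_mem' := by
    intro φ ψ hφ hψ a ξ
    simp only [LinearMap.add_apply, hφ a ξ, hψ a ξ, map_add]
  zero_mem' := by
    intro a ξ
    simp
  smul_mem' := by
    intro c φ hφ a ξ
    simp only [LinearMap.smul_apply, hφ a ξ, map_smul]

/-- The family `Hom_{Cl(V)}(Σ, L)`. -/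
def ClHom (x : X) : Type _ := clHomSubmodule 𝔰 S μ x

instance (x : X) : AddCommGroup (ClHom 𝔰 S μ x) :=
  inferInstanceAs (AddCommGroup (clHomSubmodule 𝔰 S μ x))

instance (x : X) : Module ℝ (ClHom 𝔰 S μ x) :=
  inferInstanceAs (Module ℝ (clHomSubmodule 𝔰 S μ x))

/-- Quaternions act on `Hom_{Cl(V)}(Σ, L)` from the right, `(φ λ) ξ = φ (λ ξ)`. -/
instance [Module ℍ[ℝ] S] [SMulCommClass ℍ[ℝ] (Cl n) S] [IsScalarTower ℝ ℍ[ℝ] S] (x : X) :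
    Module ℍ[ℝ]ᵐᵒᵖ (ClHom 𝔰 S μ x) where
  smul l φ := ⟨
    { toFun := fun ξ => φ.1 (l.unop • ξ)
      map_add' := fun ξ η => by rw [smul_add, map_add]
      map_smul' := fun c ξ => by
        rw [← algebraMap_smul ℍ[ℝ] c ξ, smul_smul, ← Algebra.commutes, ← smul_smul,
          algebraMap_smul, map_smul, RingHom.id_apply] }, fun a ξ => by
      change φ.1 (l.unop • spinorAction 𝔰 S x a ξ) = μ x a (φ.1 (l.unop • ξ))
      rw [← quaternion_smul_spinorAction]
      exact φ.2 a _⟩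
  one_smul φ := Subtype.ext (LinearMap.ext fun ξ => by
    change φ.1 ((1 : ℍ[ℝ]) • ξ) = φ.1 ξ
    rw [one_smul])
  mul_smul l k φ := Subtype.ext (LinearMap.ext fun ξ => by
    change φ.1 ((k.unop * l.unop) • ξ) = φ.1 (k.unop • (l.unop • ξ))
    rw [mul_smul])
  smul_zero l := Subtype.ext (LinearMap.ext fun _ => rfl)
  smul_add l φ ψ := Subtype.ext (LinearMap.ext fun _ => rfl)
  add_smul l k φ := Subtype.ext (LinearMap.ext fun ξ => by
    change φ.1 ((l.unop + k.unop) • ξ) = φ.1 (l.unop • ξ) + φ.1 (k.unop • ξ)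
    rw [add_smul, map_add])
  zero_smul φ := Subtype.ext (LinearMap.ext fun ξ => by
    change φ.1 ((0 : ℍ[ℝ]) • ξ) = 0
    rw [zero_smul, map_zero])

instance [Module ℍ[ℝ] S] [SMulCommClass ℍ[ℝ] (Cl n) S] [IsScalarTower ℝ ℍ[ℝ] S] (x : X) :
    IsScalarTower ℝ ℍ[ℝ]ᵐᵒᵖ (ClHom 𝔰 S μ x) :=
  ⟨fun c l φ => Subtype.ext (LinearMap.ext fun ξ => by
    change φ.1 ((c • l.unop) • ξ) = c • φ.1 (l.unop • ξ)
    rw [smul_assoc, map_smul])⟩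

end

end TwistedSpinor

end

open TwistedSpinor

universe uX uV uP uS uL uE uF

noncomputable section

namespace TwistedSpinor

/-! ## Real Clifford algebras as matrix algebras -/

/-! The algebra Cl_{4m} is a full matrix algebra, over ℝ for m even and over ℍ for m odd
(`isMatrixAlgebra_cl`). Hence it has only one simple module S, every finite dimensional module is
isomorphic to some Sᵏ, and the endomorphisms of S form ℝ or ℍ. Let K be ℝ or ℍᵐᵒᵖ, acting on S
through these endomorphisms. On a single fibre the theorem is Morita equivalence: M ↦ Hom_Cl(S, M)
and E ↦ E ⊗_K S are inverse to each other, because Hom_Cl(S, Sᵏ) = Kᵏ. The rest of the work is to do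
this continuously in the base point.

Matrix algebra. The periodicity Cl(c, n + 2) ≅ Cl(-c, n) ⊗ ℍ(c, c), applied for c = -1 and then c =
1, gives Cl_{n+4} ≅ Cl_n ⊗ M₂(ℝ) ⊗ ℍ. Since ℍ ⊗ ℍ ≅ M₄(ℝ), the fields of scalars ℝ and ℍ alternate,
starting from Cl₀ = ℝ.

Existence. A local section p of the principal bundle identifies Σ with U × S and every Cl(V_x) with
the fixed algebra Cl_n. In a trivialization of Λ the generators then act by a continuous family of
anticommuting complex structures. An isomorphism Sᵏ ≅ Λ_{x₀} of modules is extended as a constant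
family of linear maps and averaged over the generators (`exists_intertwining_family`); the result is
Clifford linear everywhere and still invertible near x₀ (`exists_continuous_inverse`). So Λ is
locally Sᵏ as a bundle of modules (`exists_moduleChart`). The induced isomorphisms Kᵏ ≅
Hom_{Cl(V)}(Σ, Λ)_x glue to a vector bundle (`homCoord_isChart`), and in these coordinates
evaluation is the identity of Sᵏ (`exists_evaluation_iso`).

Euclidean structure. Put ⟨φ, ψ⟩ = ∑ ⟨φ[p, t_j], ψ[p, t_j]⟩ for a finite spanning family t of S. If ∑
t_j ⊗ t_j is invariant under the Clifford generators, then it is invariant under the spin group, and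
the sum does not depend on p (`homForm_eq`). Invariance under i, j, k as well yields the factor
|λ|².

Uniqueness. Clifford linear maps Sᵏ → Sˡ are matrices with entries in K. Therefore a Clifford linear
map E ⊗_K Σ → E' ⊗_K Σ is f ⊗ 1 for a unique f, which inherits continuity (`exists_map_of_twisted`);
this is applied to an isomorphism and to its inverse.

The real and the quaternionic case are treated together: `Commutant` records how K acts on S, and
`IsTwistedProduct` records what is needed of E ⊗ Σ and E ⊗_ℍ Σ. -/

/-- The diagonal quadratic form `c (x₁² + ⋯ + xₙ²)`. -/
abbrev diagForm (c : ℝ) (n : ℕ) : QuadraticForm ℝ (Fin n → ℝ) :=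
  QuadraticMap.weightedSumSquares ℝ (fun _ : Fin n => c)

/-! ### Periodicity of Clifford algebras with period two and a change of sign. -/

section Periodicity

variable (c : ℝ) (n : ℕ)

/-- The inclusion of the last `n` coordinates. -/
def tailIncl : (Fin n → ℝ) →ₗ[ℝ] (Fin (n + 2) → ℝ) where
  toFun w := Fin.cons 0 (Fin.cons 0 w)
  map_add' v w := by
    ext i; refine Fin.cases ?_ (fun i => Fin.cases ?_ (fun i => ?_) i) i <;> simp
  map_smul' r w := by
    ext i; refine Fin.cases ?_ (fun i => Fin.cases ?_ (fun i => ?_) i) i <;> simp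

/-- The projection to the last `n` coordinates. -/
def tailProj : (Fin (n + 2) → ℝ) →ₗ[ℝ] (Fin n → ℝ) where
  toFun v i := v i.succ.succ
  map_add' _ _ := rfl
  map_smul' _ _ := rfl

variable {n}

theorem diagForm_apply (v : Fin n → ℝ) : diagForm c n v = ∑ i, c * (v i * v i) := by
  simp [QuadraticMap.weightedSumSquares_apply]

theorem diagForm_succ_succ (v : Fin (n + 2) → ℝ) :
    diagForm c (n + 2) v = c * (v 0 * v 0) + c * (v 1 * v 1) + diagForm c n (tailProj n v) := by
  rw [diagForm_apply, diagForm_apply, Fin.sum_univ_succ, Fin.sum_univ_succ]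
  simp [tailProj, add_assoc]

theorem diagForm_neg (v : Fin n → ℝ) : diagForm (-c) n v = -diagForm c n v := by
  rw [diagForm_apply, diagForm_apply, ← Finset.sum_neg_distrib]
  exact Finset.sum_congr rfl fun i _ => by ring

theorem eq_cons_cons (v : Fin (n + 2) → ℝ) :
    v = v 0 • Pi.single 0 1 + v 1 • Pi.single 1 1 + tailIncl n (tailProj n v) := by
  ext i
  refine Fin.cases ?_ (fun i => Fin.cases ?_ (fun i => ?_) i) i
  · simp [tailIncl]
  · simp [tailIncl]
  · have h1 : (i.succ.succ : Fin (n + 2)) ≠ 1 := by simp [Fin.ext_iff]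
    simp [tailIncl, tailProj, Pi.single_apply, h1]

variable {c} (hc : c * c = 1)

/-- The standard generators of the quaternion algebra `ℍ(c, c)`. -/
def genI (c : ℝ) : ℍ[ℝ,c,0,c] := (QuaternionAlgebra.Basis.self ℝ).i

/-- The standard generators of the quaternion algebra `ℍ(c, c)`. -/
def genJ (c : ℝ) : ℍ[ℝ,c,0,c] := (QuaternionAlgebra.Basis.self ℝ).j

/-- The standard generators of the quaternion algebra `ℍ(c, c)`. -/
def genK (c : ℝ) : ℍ[ℝ,c,0,c] := (QuaternionAlgebra.Basis.self ℝ).k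

@[simp] theorem genI_re (c : ℝ) : (genI c).re = 0 := rfl
@[simp] theorem genI_imI (c : ℝ) : (genI c).imI = 1 := rfl
@[simp] theorem genI_imJ (c : ℝ) : (genI c).imJ = 0 := rfl
@[simp] theorem genI_imK (c : ℝ) : (genI c).imK = 0 := rfl
@[simp] theorem genJ_re (c : ℝ) : (genJ c).re = 0 := rfl
@[simp] theorem genJ_imI (c : ℝ) : (genJ c).imI = 0 := rfl
@[simp] theorem genJ_imJ (c : ℝ) : (genJ c).imJ = 1 := rfl
@[simp] theorem genJ_imK (c : ℝ) : (genJ c).imK = 0 := rfl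
@[simp] theorem genK_re (c : ℝ) : (genK c).re = 0 := rfl
@[simp] theorem genK_imI (c : ℝ) : (genK c).imI = 0 := rfl
@[simp] theorem genK_imJ (c : ℝ) : (genK c).imJ = 0 := rfl
@[simp] theorem genK_imK (c : ℝ) : (genK c).imK = 1 := rfl

local notation "qi" => genI c
local notation "qj" => genJ c
local notation "qk" => genK c

/-- The vectors of the larger space in the tensor product. -/
def periodicityVec (c : ℝ) (n : ℕ) : (Fin (n + 2) → ℝ) →ₗ[ℝ]
    CliffordAlgebra (diagForm (-c) n) ⊗[ℝ] ℍ[ℝ,c,0,c] :=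
  (LinearMap.proj (R := ℝ) (φ := fun _ : Fin (n + 2) => ℝ) 0).smulRight (1 ⊗ₜ genI c) +
    (LinearMap.proj (R := ℝ) (φ := fun _ : Fin (n + 2) => ℝ) 1).smulRight (1 ⊗ₜ genJ c) +
    ((TensorProduct.mk ℝ _ _).flip (genK c)).comp
      ((CliffordAlgebra.ι (diagForm (-c) n)).comp (tailProj n))

theorem periodicityVec_apply (v : Fin (n + 2) → ℝ) : periodicityVec c n v =
    v 0 • (1 ⊗ₜ qi) + v 1 • (1 ⊗ₜ qj) + CliffordAlgebra.ι (diagForm (-c) n) (tailProj n v) ⊗ₜ qk :=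
  rfl

-- The three summands anticommute because i, j, k do, so only squares survive. As k² = -c² = -1, the
-- factor k turns the form of sign -c on the tail back into one of sign c.
include hc in
theorem periodicityVec_sq (v : Fin (n + 2) → ℝ) :
    periodicityVec c n v * periodicityVec c n v = algebraMap ℝ _ (diagForm c (n + 2) v) := by
  have hii : qi * qi = c • 1 := by ext <;> simp
  have hjj : qj * qj = c • 1 := by ext <;> simp
  have hkk : qk * qk = (-1 : ℝ) • 1 := by ext <;> simp [hc]
  have hij : qi * qj = qk := by ext <;> simp
  have hji : qj * qi = (-1 : ℝ) • qk := by ext <;> simp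
  have hik : qi * qk = c • qj := by ext <;> simp
  have hki : qk * qi = (-c) • qj := by ext <;> simp
  have hjk : qj * qk = (-c) • qi := by ext <;> simp
  have hkj : qk * qj = c • qi := by ext <;> simp
  rw [periodicityVec_apply, diagForm_succ_succ]
  simp only [mul_add, add_mul, smul_mul_smul_comm, smul_mul_assoc, mul_smul_comm,
    Algebra.TensorProduct.tmul_mul_tmul, one_mul, mul_one, hii, hjj, hkk, hij, hji, hik, hki, hjk,
    hkj, CliffordAlgebra.ι_sq_scalar, TensorProduct.tmul_smul, diagForm_neg,
    Algebra.algebraMap_eq_smul_one, ← TensorProduct.smul_tmul', ← Algebra.TensorProduct.one_def]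
  module

/-- The forward map of the periodicity isomorphism. -/
def periodicityHom : CliffordAlgebra (diagForm c (n + 2)) →ₐ[ℝ]
    CliffordAlgebra (diagForm (-c) n) ⊗[ℝ] ℍ[ℝ,c,0,c] :=
  CliffordAlgebra.lift _ ⟨periodicityVec c n, periodicityVec_sq hc⟩

local notation "ιv" => CliffordAlgebra.ι (diagForm c (n + 2))
local notation "e₀" => CliffordAlgebra.ι (diagForm c (n + 2)) (Pi.single 0 1)
local notation "e₁" => CliffordAlgebra.ι (diagForm c (n + 2)) (Pi.single 1 1)

/-- Disjoint supports make the polar form of a diagonal form vanish, and the polar form is the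
anticommutator. -/
theorem ι_mul_ι_of_diag (c : ℝ) (v w : Fin n → ℝ) (h : ∀ i, v i * w i = 0) :
    CliffordAlgebra.ι (diagForm c n) v * CliffordAlgebra.ι (diagForm c n) w =
      -(CliffordAlgebra.ι (diagForm c n) w * CliffordAlgebra.ι (diagForm c n) v) := by
  rw [← add_eq_zero_iff_eq_neg, CliffordAlgebra.ι_mul_ι_add_swap, QuadraticMap.polar,
    diagForm_apply, diagForm_apply, diagForm_apply, ← Finset.sum_sub_distrib,
    ← Finset.sum_sub_distrib]
  rw [Finset.sum_eq_zero, map_zero]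
  intro i _
  have := h i
  simp only [Pi.add_apply]
  linear_combination (2 * c) * this

theorem ι_single_sq (c : ℝ) (i : Fin n) :
    CliffordAlgebra.ι (diagForm c n) (Pi.single i 1) *
      CliffordAlgebra.ι (diagForm c n) (Pi.single i 1) = c • 1 := by
  rw [CliffordAlgebra.ι_sq_scalar, diagForm_apply, Algebra.algebraMap_eq_smul_one,
    Finset.sum_eq_single i] <;> simp +contextual

theorem ι_single_anticomm (c : ℝ) {i j : Fin n} (hij : i ≠ j) :
    CliffordAlgebra.ι (diagForm c n) (Pi.single i 1) *
      CliffordAlgebra.ι (diagForm c n) (Pi.single j 1) =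
      -(CliffordAlgebra.ι (diagForm c n) (Pi.single j 1) *
        CliffordAlgebra.ι (diagForm c n) (Pi.single i 1)) := by
  refine ι_mul_ι_of_diag c _ _ fun k => ?_
  rcases eq_or_ne k i with rfl | h
  · simp [hij]
  · simp [h]

theorem zero_tail (w : Fin n → ℝ) : e₀ * ιv (tailIncl n w) = -(ιv (tailIncl n w) * e₀) :=
  ι_mul_ι_of_diag c _ _ fun i => by
    refine Fin.cases ?_ (fun i => ?_) i <;> simp [tailIncl]

theorem one_tail (w : Fin n → ℝ) : e₁ * ιv (tailIncl n w) = -(ιv (tailIncl n w) * e₁) :=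
  ι_mul_ι_of_diag c _ _ fun i => by
    refine Fin.cases ?_ (fun i => Fin.cases ?_ (fun i => ?_) i) i <;>
    simp [tailIncl, Pi.single_apply, Fin.ext_iff]

theorem zero_one : e₁ * e₀ = -(e₀ * e₁) := ι_single_anticomm c (by simp)

include hc in
theorem vol_sq : (e₀ * e₁) * (e₀ * e₁) = -1 := by
  rw [mul_assoc, ← mul_assoc e₁, zero_one, neg_mul, mul_neg, mul_assoc e₀ e₁ e₁, ι_single_sq,
    mul_smul_comm, mul_one, mul_smul_comm, ι_single_sq, smul_smul, hc, one_smul]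

/-- Passing a tail vector through e₀ and through e₁ changes the sign twice. -/
theorem vol_tail (w : Fin n → ℝ) :
    (e₀ * e₁) * ιv (tailIncl n w) = ιv (tailIncl n w) * (e₀ * e₁) := by
  rw [mul_assoc, one_tail, mul_neg, ← mul_assoc e₀, zero_tail, neg_mul, neg_neg,
    mul_assoc (ιv (tailIncl n w))]

/-- The inverse of the periodicity isomorphism on the Clifford algebra. -/
def periodicityInvClifford : CliffordAlgebra (diagForm (-c) n) →ₐ[ℝ]
    CliffordAlgebra (diagForm c (n + 2)) :=
  -- The sign is forced: (w ⊗ k)(1 ⊗ k) = -(w ⊗ 1), because k² = -1.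
  CliffordAlgebra.lift _ ⟨-(LinearMap.mulRight ℝ (e₀ * e₁)).comp (ιv ∘ₗ tailIncl n), fun w => by
    simp only [LinearMap.neg_apply, LinearMap.comp_apply, LinearMap.mulRight_apply, neg_mul_neg]
    rw [mul_assoc, ← mul_assoc (e₀ * e₁), vol_tail, mul_assoc _ (e₀ * e₁), vol_sq hc, mul_neg,
      mul_one, mul_neg, CliffordAlgebra.ι_sq_scalar, ← map_neg, diagForm_neg, diagForm_succ_succ]
    simp [tailIncl, tailProj]⟩

/-- The inverse of the periodicity isomorphism on the quaternion algebra. -/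
def periodicityInvQuaternion : ℍ[ℝ,c,0,c] →ₐ[ℝ] CliffordAlgebra (diagForm c (n + 2)) :=
  QuaternionAlgebra.lift
    { i := e₀
      j := e₁
      k := e₀ * e₁
      i_mul_i := by rw [ι_single_sq, zero_smul, add_zero]
      j_mul_j := ι_single_sq _ _
      i_mul_j := rfl
      j_mul_i := by rw [zero_one, zero_smul, zero_sub] }

theorem periodicityInvQuaternion_i :
    periodicityInvQuaternion (n := n) qi = e₀ := by
  simp [periodicityInvQuaternion, QuaternionAlgebra.Basis.lift]

theorem periodicityInvQuaternion_j :
    periodicityInvQuaternion (n := n) qj = e₁ := by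
  simp [periodicityInvQuaternion, QuaternionAlgebra.Basis.lift]

theorem periodicityInvQuaternion_k :
    periodicityInvQuaternion (n := n) qk = e₀ * e₁ := by
  simp [periodicityInvQuaternion, QuaternionAlgebra.Basis.lift]

theorem periodicityInvClifford_ι (w : Fin n → ℝ) :
    periodicityInvClifford hc (CliffordAlgebra.ι (diagForm (-c) n) w) =
      -(ιv (tailIncl n w) * (e₀ * e₁)) := by
  simp [periodicityInvClifford, mul_assoc]

/-- The element w e₀ e₁ commutes with e₀ and with e₁: each of these anticommutes with w and with
exactly one of the other two factors. Commuting images are what a map out of the tensor product of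
algebras requires. -/
theorem commute_periodicityInv (x : CliffordAlgebra (diagForm (-c) n)) (y : ℍ[ℝ,c,0,c]) :
    Commute (periodicityInvClifford hc x) (periodicityInvQuaternion y) := by
  have key : ∀ (w : Fin n → ℝ) (y : ℍ[ℝ,c,0,c]),
      Commute (ιv (tailIncl n w) * (e₀ * e₁)) (periodicityInvQuaternion y) := by
    intro w y
    have h0 : Commute (ιv (tailIncl n w) * (e₀ * e₁)) e₀ := by
      rw [Commute, SemiconjBy, ← mul_assoc e₀, zero_tail, mul_assoc, mul_assoc, zero_one, mul_neg,
        neg_mul, mul_assoc, mul_neg]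
    have h1 : Commute (ιv (tailIncl n w) * (e₀ * e₁)) e₁ := by
      rw [Commute, SemiconjBy, ← mul_assoc e₁, one_tail, neg_mul, mul_assoc _ e₁,
        ← mul_assoc e₁ e₀, zero_one, neg_mul, mul_neg, neg_neg, mul_assoc]
    change Commute _ (algebraMap ℝ _ y.re + y.imI • e₀ + y.imJ • e₁ + y.imK • (e₀ * e₁))
    refine Commute.add_right (Commute.add_right (Commute.add_right ?_ ?_) ?_) ?_
    · exact (Algebra.commutes _ _).symm
    · exact h0.smul_right _
    · exact h1.smul_right _
    · exact (h0.mul_right h1).smul_right _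
  induction x using CliffordAlgebra.induction with
  | algebraMap r => rw [AlgHom.commutes]; exact Algebra.commutes _ _
  | ι w => rw [periodicityInvClifford_ι]; exact (key w y).neg_left
  | mul a b ha hb => rw [map_mul]; exact ha.mul_left hb
  | add a b ha hb => rw [map_add]; exact ha.add_left hb

/-- `Cl(c, n + 2) ≅ Cl(-c, n) ⊗ ℍ(c, c)` for `c = ±1`. -/
def periodicityEquiv : CliffordAlgebra (diagForm c (n + 2)) ≃ₐ[ℝ]
    CliffordAlgebra (diagForm (-c) n) ⊗[ℝ] ℍ[ℝ,c,0,c] :=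
  AlgEquiv.ofAlgHom (periodicityHom hc)
    (Algebra.TensorProduct.lift (periodicityInvClifford hc) periodicityInvQuaternion
      (commute_periodicityInv hc))
    (by
      have f0 : periodicityHom (n := n) hc e₀ = 1 ⊗ₜ qi := by
        have : tailProj n (Pi.single 0 1) = 0 := by ext i; simp [tailProj]
        rw [periodicityHom, CliffordAlgebra.lift_ι_apply, periodicityVec_apply, this]
        simp
      have f1 : periodicityHom (n := n) hc e₁ = 1 ⊗ₜ qj := by
        have : tailProj n (Pi.single 1 1) = 0 := by
          ext i; simp [tailProj, Pi.single_apply, Fin.ext_iff]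
        rw [periodicityHom, CliffordAlgebra.lift_ι_apply, periodicityVec_apply, this]
        simp
      have ft : ∀ w, periodicityHom (n := n) hc (ιv (tailIncl n w)) =
          CliffordAlgebra.ι (diagForm (-c) n) w ⊗ₜ qk := by
        intro w
        have : tailProj n (tailIncl n w) = w := by ext i; simp [tailProj, tailIncl]
        simp only [periodicityHom, CliffordAlgebra.lift_ι_apply, periodicityVec_apply, this]
        simp [tailIncl]
      have hij : qi * qj = qk := by ext <;> simp
      have hkk : qk * qk = -1 := by ext <;> simp [hc]
      apply Algebra.TensorProduct.ext
      · apply CliffordAlgebra.hom_ext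
        refine LinearMap.ext fun w => ?_
        simp [periodicityInvClifford_ι, ft, TensorProduct.tmul_neg, f0, f1, hij, hkk]
      · apply QuaternionAlgebra.hom_ext
        · change periodicityHom hc (Algebra.TensorProduct.lift _ _ (commute_periodicityInv hc) (1 ⊗ₜ qi)) = 1 ⊗ₜ qi
          rw [Algebra.TensorProduct.lift_tmul, map_one, one_mul, periodicityInvQuaternion_i, f0]
        · change periodicityHom hc (Algebra.TensorProduct.lift _ _ (commute_periodicityInv hc) (1 ⊗ₜ qj)) = 1 ⊗ₜ qj
          rw [Algebra.TensorProduct.lift_tmul, map_one, one_mul, periodicityInvQuaternion_j, f1])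
    (by
      apply CliffordAlgebra.hom_ext
      refine LinearMap.ext fun v => ?_
      have h3 : -(ιv (tailIncl n (tailProj n v)) * (e₀ * e₁)) * (e₀ * e₁) =
          ιv (tailIncl n (tailProj n v)) := by
        rw [neg_mul, mul_assoc, vol_sq hc, mul_neg, mul_one, neg_neg]
      simp only [LinearMap.comp_apply, AlgHom.toLinearMap_apply, AlgHom.comp_apply,
        AlgHom.id_apply, periodicityHom, CliffordAlgebra.lift_ι_apply, periodicityVec_apply,
        map_add, map_smul, Algebra.TensorProduct.lift_tmul, map_one, one_mul,
        periodicityInvQuaternion_i, periodicityInvQuaternion_j, periodicityInvQuaternion_k,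
        periodicityInvClifford_ι, h3]
      conv_rhs => rw [eq_cons_cons v]
      simp only [map_add, map_smul])

end Periodicity

/-! ### Tensor products of matrix algebras. -/

/-- `A` is a matrix algebra over `K`. -/
def IsMatrixAlgebra (K A : Type*) [Ring K] [Algebra ℝ K] [Ring A] [Algebra ℝ A] : Prop :=
  ∃ (ι : Type) (_ : Fintype ι) (_ : DecidableEq ι) (_ : Nonempty ι),
    Nonempty (A ≃ₐ[ℝ] Matrix ι ι K)

namespace IsMatrixAlgebra

variable {K A B : Type*} [Ring K] [Algebra ℝ K] [Ring A] [Algebra ℝ A] [Ring B] [Algebra ℝ B]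

theorem of_algEquiv (e : A ≃ₐ[ℝ] B) : IsMatrixAlgebra K B → IsMatrixAlgebra K A := by
  rintro ⟨ι, _, _, _, ⟨f⟩⟩
  exact ⟨ι, _, _, inferInstance, ⟨e.trans f⟩⟩

theorem tensor_real : IsMatrixAlgebra K A → IsMatrixAlgebra ℝ B → IsMatrixAlgebra K (A ⊗[ℝ] B) := by
  rintro ⟨ι, _, _, _, ⟨f⟩⟩ ⟨κ, _, _, _, ⟨h⟩⟩
  exact ⟨ι × κ, inferInstance, inferInstance, inferInstance,
    ⟨((Algebra.TensorProduct.congr f h).trans (Matrix.kroneckerTMulAlgEquiv ι κ ℝ ℝ K ℝ)).trans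
      (Algebra.TensorProduct.rid ℝ ℝ K).mapMatrix⟩⟩

theorem tensor_algebra : IsMatrixAlgebra ℝ A → IsMatrixAlgebra B (A ⊗[ℝ] B) := by
  rintro ⟨ι, _, _, _, ⟨f⟩⟩
  exact ⟨ι, inferInstance, inferInstance, inferInstance,
    ⟨((Algebra.TensorProduct.congr f AlgEquiv.refl).trans (Algebra.TensorProduct.comm ℝ _ _)).trans
      (matrixEquivTensor ι ℝ B).symm⟩⟩

/-- With A = M_ι(K) and K ⊗ B = M_κ(ℝ) one gets A ⊗ B = M_ι(K ⊗ B) = M_ι(M_κ(ℝ)). It is applied with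
K = B = ℍ, where the two quaternionic factors cancel. -/
theorem tensor_of_tensor :
    IsMatrixAlgebra K A → IsMatrixAlgebra ℝ (K ⊗[ℝ] B) → IsMatrixAlgebra ℝ (A ⊗[ℝ] B) := by
  rintro ⟨ι, _, _, _, ⟨f⟩⟩ ⟨κ, _, _, _, ⟨h⟩⟩
  -- B is written as 1 × 1 matrices over itself, so that the Kronecker isomorphism for two matrix
  -- algebras applies.
  let g : A ⊗[ℝ] B ≃ₐ[ℝ] Matrix (ι × Unit) (ι × Unit) (K ⊗[ℝ] B) :=
    (Algebra.TensorProduct.congr f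
      ((matrixEquivTensor Unit ℝ B).trans ((Algebra.TensorProduct.congr AlgEquiv.refl
        (Matrix.uniqueAlgEquiv (R := ℝ))).trans
        (Algebra.TensorProduct.rid ℝ ℝ B))).symm).trans (Matrix.kroneckerTMulAlgEquiv ι Unit ℝ ℝ K B)
  exact ⟨(ι × Unit) × κ, inferInstance, inferInstance, inferInstance,
    ⟨(g.trans h.mapMatrix).trans (Matrix.compAlgEquiv _ _ ℝ ℝ)⟩⟩

end IsMatrixAlgebra

/-! ### Quaternion algebras, and the matrix form of Cl_{4m}. -/

/-- The action of `ℍ ⊗ ℍ` on `ℍ` by left and right multiplication. -/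
def quaternionLeftRight : ℍ[ℝ] ⊗[ℝ] ℍ[ℝ] →ₐ[ℝ] Module.End ℝ ℍ[ℝ] :=
  (AlgHom.mulLeftRight ℝ ℍ[ℝ]).comp
    (Algebra.TensorProduct.congr AlgEquiv.refl Quaternion.starAe).toAlgHom

theorem quaternionLeftRight_tmul (a b x : ℍ[ℝ]) :
    quaternionLeftRight (a ⊗ₜ b) x = a * x * star b := by
  simp [quaternionLeftRight]

/-- The quaternion units. -/
def unitI : ℍ[ℝ] := ⟨0, 1, 0, 0⟩

/-- The quaternion units. -/
def unitJ : ℍ[ℝ] := ⟨0, 0, 1, 0⟩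

/-- The quaternion units. -/
def unitK : ℍ[ℝ] := ⟨0, 0, 0, 1⟩

@[simp] theorem unitI_re : unitI.re = 0 := rfl
@[simp] theorem unitI_imI : unitI.imI = 1 := rfl
@[simp] theorem unitI_imJ : unitI.imJ = 0 := rfl
@[simp] theorem unitI_imK : unitI.imK = 0 := rfl
@[simp] theorem unitJ_re : unitJ.re = 0 := rfl
@[simp] theorem unitJ_imI : unitJ.imI = 0 := rfl
@[simp] theorem unitJ_imJ : unitJ.imJ = 1 := rfl
@[simp] theorem unitJ_imK : unitJ.imK = 0 := rfl
@[simp] theorem unitK_re : unitK.re = 0 := rfl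
@[simp] theorem unitK_imI : unitK.imI = 0 := rfl
@[simp] theorem unitK_imJ : unitK.imJ = 0 := rfl
@[simp] theorem unitK_imK : unitK.imK = 1 := rfl

theorem eq_sum_units (x : ℍ[ℝ]) :
    x = x.re • 1 + x.imI • unitI + x.imJ • unitJ + x.imK • unitK := by
  ext <;> simp

/-- The real part is a combination of left and right multiplications, and every linear endomorphism
of ℍ can be assembled from it by left multiplications. -/
theorem quaternionLeftRight_surjective : Function.Surjective quaternionLeftRight := by
  intro T
  -- For every quaternion, x + i x ī + j x j̄ + k x k̄ = 4 Re x.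
  let π : ℍ[ℝ] ⊗[ℝ] ℍ[ℝ] :=
    (1 / 4 : ℝ) • (1 ⊗ₜ 1 + unitI ⊗ₜ unitI + unitJ ⊗ₜ unitJ + unitK ⊗ₜ unitK)
  have hπ : ∀ x, quaternionLeftRight π x = (x.re : ℍ[ℝ]) := by
    intro x
    simp only [π, map_smul, map_add, LinearMap.smul_apply, LinearMap.add_apply,
      quaternionLeftRight_tmul]
    ext <;> simp <;> ring
  -- The coefficient of a unit u in x is Re(ū x), so T x = ∑ T(u) Re(ū x), summed over u = 1, i, j,
  -- k.
  refine ⟨(T 1 ⊗ₜ 1) * π + (T unitI ⊗ₜ 1) * π * ((star unitI) ⊗ₜ 1) +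
    (T unitJ ⊗ₜ 1) * π * ((star unitJ) ⊗ₜ 1) + (T unitK ⊗ₜ 1) * π * ((star unitK) ⊗ₜ 1), ?_⟩
  refine LinearMap.ext fun x => ?_
  simp only [map_mul, map_add, LinearMap.add_apply, Module.End.mul_apply, hπ,
    quaternionLeftRight_tmul, star_one, mul_one]
  conv_rhs => rw [eq_sum_units x]
  simp only [map_add, map_smul, Quaternion.mul_coe_eq_smul]
  simp

theorem isMatrixAlgebra_quaternion_tensor : IsMatrixAlgebra ℝ (ℍ[ℝ] ⊗[ℝ] ℍ[ℝ]) := by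
  have hinj : Function.Injective quaternionLeftRight.toLinearMap := by
    refine (LinearMap.injective_iff_surjective_of_finrank_eq_finrank ?_).2
      quaternionLeftRight_surjective
    rw [Module.finrank_tensorProduct, Module.finrank_linearMap]
  exact ⟨Fin 4, inferInstance, inferInstance, inferInstance,
    ⟨(AlgEquiv.ofBijective quaternionLeftRight ⟨hinj, quaternionLeftRight_surjective⟩).trans
      (LinearMap.toMatrixAlgEquiv (QuaternionAlgebra.basisOneIJK (-1 : ℝ) 0 (-1)))⟩⟩

/-- Split quaternions as `2 × 2` matrices. -/
def splitQuaternionHom : ℍ[ℝ,1,0,1] →ₐ[ℝ] Matrix (Fin 2) (Fin 2) ℝ :=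
  QuaternionAlgebra.lift
    { i := !![1, 0; 0, -1]
      j := !![0, 1; 1, 0]
      k := !![0, 1; -1, 0]
      i_mul_i := by ext i j; fin_cases i <;> fin_cases j <;> simp
      j_mul_j := by ext i j; fin_cases i <;> fin_cases j <;> simp
      i_mul_j := by ext i j; fin_cases i <;> fin_cases j <;> simp
      j_mul_i := by ext i j; fin_cases i <;> fin_cases j <;> simp }

theorem isMatrixAlgebra_splitQuaternion : IsMatrixAlgebra ℝ ℍ[ℝ,1,0,1] := by
  have hinj : Function.Injective splitQuaternionHom.toLinearMap := by
    refine (injective_iff_map_eq_zero _).2 fun x hx => ?_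
    have h : ∀ i j, splitQuaternionHom x i j = 0 := fun i j => congr_fun (congr_fun hx i) j
    have h1 := h 0 0
    have h2 := h 0 1
    have h3 := h 1 0
    have h4 := h 1 1
    simp [splitQuaternionHom, QuaternionAlgebra.Basis.lift, Matrix.algebraMap_matrix_apply]
      at h1 h2 h3 h4
    ext <;> simp <;> linarith
  have hsurj : Function.Surjective splitQuaternionHom.toLinearMap :=
    (LinearMap.injective_iff_surjective_of_finrank_eq_finrank (by
      rw [QuaternionAlgebra.finrank_eq_four, Module.finrank_matrix]; simp)).1 hinj
  exact ⟨Fin 2, inferInstance, inferInstance, inferInstance,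
    ⟨AlgEquiv.ofBijective splitQuaternionHom ⟨hinj, hsurj⟩⟩⟩

/-- `Clₙ₊₄ ≅ (Clₙ ⊗ ℍ(1, 1)) ⊗ ℍ`. -/
def clAddFour (n : ℕ) : Cl (n + 4) ≃ₐ[ℝ] (Cl n ⊗[ℝ] ℍ[ℝ,1,0,1]) ⊗[ℝ] ℍ[ℝ] :=
  (periodicityEquiv (c := -1) (n := n + 2) (by norm_num)).trans
    (Algebra.TensorProduct.congr
      -- The identity of ℝⁿ⁺² is used as an isometry between the forms with coefficients -(-1) and
      -- 1.
      (((CliffordAlgebra.equivOfIsometry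
        { LinearEquiv.refl ℝ (Fin (n + 2) → ℝ) with
          map_app' := fun v => by simp [diagForm_apply] })).trans
        (periodicityEquiv (c := 1) (n := n) (by norm_num))) AlgEquiv.refl)

theorem isMatrixAlgebra_cl_zero : IsMatrixAlgebra ℝ (Cl 0) := by
  let f : Cl 0 →ₐ[ℝ] ℝ := CliffordAlgebra.lift _ ⟨0, fun v => by
    simp [QuadraticMap.weightedSumSquares_apply]⟩
  have e : Cl 0 ≃ₐ[ℝ] ℝ := AlgEquiv.ofAlgHom f (Algebra.ofId ℝ _) (by ext) (by
    apply CliffordAlgebra.hom_ext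
    exact LinearMap.pi_ext' fun i => i.elim0)
  exact ⟨Unit, inferInstance, inferInstance, inferInstance,
    ⟨e.trans (Matrix.uniqueAlgEquiv (R := ℝ)).symm⟩⟩

/-- Both parities go through one induction, since each step tensors with M₂(ℝ) and ℍ: this takes
M(ℝ) to M(ℍ), and M(ℍ) to M(ℍ ⊗ ℍ) = M(ℝ). -/
theorem isMatrixAlgebra_cl (m : ℕ) :
    (Even m → IsMatrixAlgebra ℝ (Cl (4 * m))) ∧ (Odd m → IsMatrixAlgebra ℍ[ℝ] (Cl (4 * m))) := by
  induction m with
  | zero => exact ⟨fun _ => isMatrixAlgebra_cl_zero, fun h => absurd h (by simp)⟩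
  | succ m ih =>
    refine ⟨fun h => ?_, fun h => ?_⟩
    · have hm : Odd m := by
        rcases Nat.even_or_odd m with h' | h'
        · exact absurd h (by simpa [Nat.even_add_one] using h')
        · exact h'
      exact ((ih.2 hm).tensor_real isMatrixAlgebra_splitQuaternion).tensor_of_tensor
        isMatrixAlgebra_quaternion_tensor |>.of_algEquiv (clAddFour (4 * m))
    · have hm : Even m := by
        rcases Nat.even_or_odd m with h' | h'
        · exact h'
        · exact absurd h (by simpa [Nat.odd_add_one] using h')
      exact ((ih.1 hm).tensor_real isMatrixAlgebra_splitQuaternion).tensor_algebra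
        |>.of_algEquiv (clAddFour (4 * m))

/-! ## Modules over matrix algebras -/

section ColumnModule

variable {K A : Type*} [DivisionRing K] [Algebra ℝ K] [Ring A] [Algebra ℝ A]
  {ι : Type} [Fintype ι] [DecidableEq ι]

/-- The space `K^ι` of column vectors, as a module over an algebra `A ≅ M_ι(K)`. -/
def Column (_ : A ≃ₐ[ℝ] Matrix ι ι K) : Type _ := ι → K

variable (f : A ≃ₐ[ℝ] Matrix ι ι K)

instance : AddCommGroup (Column f) := inferInstanceAs (AddCommGroup (ι → K))

instance : Module ℝ (Column f) := inferInstanceAs (Module ℝ (ι → K))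

instance : Module A (Column f) where
  smul a v := (f a).mulVec v
  one_smul v := (congrArg (fun M => Matrix.mulVec M (show ι → K from v)) (map_one f)).trans
    (Matrix.one_mulVec _)
  mul_smul a b v := (congrArg (fun M => Matrix.mulVec M (show ι → K from v)) (map_mul f a b)).trans
    (Matrix.mulVec_mulVec _ _ _).symm
  smul_zero a := Matrix.mulVec_zero _
  smul_add a v w := Matrix.mulVec_add _ v w
  add_smul a b v := (congrArg (fun M => Matrix.mulVec M (show ι → K from v)) (map_add f a b)).trans
    (Matrix.add_mulVec _ _ _)
  zero_smul v := (congrArg (fun M => Matrix.mulVec M (show ι → K from v)) (map_zero f)).trans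
    (Matrix.zero_mulVec _)

theorem Column.algebraMap_smul_apply (r : ℝ) (v : Column f) (i : ι) :
    (algebraMap ℝ A r • v) i = r • v i := by
  refine (congrArg (fun M => Matrix.mulVec M (show ι → K from v) i) (AlgEquiv.commutes f r)).trans ?_
  have h (w : ι → K) : (algebraMap ℝ (Matrix ι ι K) r).mulVec w i = r • w i := by
    simp only [Algebra.algebraMap_eq_smul_one, Matrix.smul_mulVec, Matrix.one_mulVec,
      Pi.smul_apply]
  exact h v

theorem Column.smul_def (a : A) (v : Column f) : a • v = (f a).mulVec v := rfl

/-- If v_i ≠ 0, the matrix whose only nonzero column is the i-th, equal to w v_i⁻¹, carries v to w.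
This transitivity is the simplicity of the column module. -/
theorem Column.exists_smul_eq {v : Column f} (hv : v ≠ 0) (w : Column f) : ∃ a : A, a • v = w := by
  obtain ⟨i, hi⟩ : ∃ i, v i ≠ 0 := Function.ne_iff.1 hv
  refine ⟨f.symm (Matrix.of fun k l => if l = i then w k * (v i)⁻¹ else 0), ?_⟩
  rw [Column.smul_def, AlgEquiv.apply_symm_apply]
  funext k
  simp [Matrix.mulVec, dotProduct, hi]

instance [Nonempty ι] : IsSimpleModule A (Column f) := by
  have : Nontrivial (Column f) := inferInstanceAs (Nontrivial (ι → K))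
  refine isSimpleModule_iff_toSpanSingleton_surjective.2 ⟨this, fun v hv w => ?_⟩
  exact Column.exists_smul_eq f hv w

/-- The endomorphisms of the column module are the right multiplications by scalars. -/
theorem Column.end_eq (φ : Column f →ₗ[A] Column f) :
    ∃ c : K, ∀ (v : Column f) i, φ v i = v i * c := by
  rcases isEmpty_or_nonempty ι with h | ⟨⟨i₀⟩⟩
  · exact ⟨0, fun v i => (h.false i).elim⟩
  let u : Column f := (Pi.single i₀ 1 : ι → K)
  refine ⟨φ u i₀, fun v i => ?_⟩
  -- The matrix with v as its column i₀ and zeros elsewhere takes the basis vector u to v. An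
  -- endomorphism is therefore determined by its value on u.
  have h1 : f.symm (Matrix.of fun k l => if l = i₀ then v k else 0) • u = v := by
    rw [Column.smul_def, AlgEquiv.apply_symm_apply]
    funext k
    simp [Matrix.mulVec, dotProduct, u, Pi.single_apply]
  rw [← h1, map_smul, h1, Column.smul_def, AlgEquiv.apply_symm_apply]
  simp [Matrix.mulVec, dotProduct]

end ColumnModule

/-! ### Uniqueness of the simple module, and its endomorphisms. -/

namespace IsMatrixAlgebra

variable {K A : Type*} [DivisionRing K] [Algebra ℝ K] [Ring A] [Algebra ℝ A]

theorem finite [Module.Finite ℝ K] (hA : IsMatrixAlgebra K A) : Module.Finite ℝ A := by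
  obtain ⟨ι, _, _, _, ⟨f⟩⟩ := hA
  exact Module.Finite.equiv f.symm.toLinearEquiv

theorem isSimpleRing (hA : IsMatrixAlgebra K A) : IsSimpleRing A := by
  obtain ⟨ι, _, _, _, ⟨f⟩⟩ := hA
  exact IsSimpleRing.of_ringEquiv f.symm.toRingEquiv inferInstance

/-- A finite dimensional simple algebra is Artinian, and over a simple Artinian ring all simple
modules are isomorphic. -/
theorem isIsotypicOfType [Module.Finite ℝ K] (hA : IsMatrixAlgebra K A) (L S : Type*)
    [AddCommGroup L] [Module A L] [AddCommGroup S] [Module A S] [IsSimpleModule A S] :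
    IsIsotypicOfType A L S := by
  have := hA.finite
  have := hA.isSimpleRing
  have : IsArtinianRing A := IsArtinianRing.of_finite ℝ A
  intro M hM
  obtain ⟨I, hI, ⟨e⟩⟩ := (isSimpleModule_iff_quot_maximal (R := A) (M := S)).1 inferInstance
  obtain ⟨J, hJ, ⟨e'⟩⟩ := (isSimpleModule_iff_quot_maximal (R := A) (M := M)).1 inferInstance
  have hI' : IsSimpleModule A (A ⧸ I) := IsSimpleModule.congr e.symm
  have hJ' : IsSimpleModule A (A ⧸ J) := IsSimpleModule.congr e'.symm
  -- Isotypicity compares simple submodules of one module, so the two simple quotients of A are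
  -- placed side by side in their product.
  let N₁ := LinearMap.range (LinearMap.inl A (A ⧸ I) (A ⧸ J))
  let N₂ := LinearMap.range (LinearMap.inr A (A ⧸ I) (A ⧸ J))
  let i₁ : (A ⧸ I) ≃ₗ[A] N₁ := LinearEquiv.ofInjective _ LinearMap.inl_injective
  let i₂ : (A ⧸ J) ≃ₗ[A] N₂ := LinearEquiv.ofInjective _ LinearMap.inr_injective
  have h₁ : IsSimpleModule A N₁ := IsSimpleModule.congr i₁.symm
  have h₂ : IsSimpleModule A N₂ := IsSimpleModule.congr i₂.symm
  obtain ⟨t⟩ := IsSimpleRing.isIsotypic A ((A ⧸ I) × (A ⧸ J)) N₁ N₂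
  exact ⟨((e'.trans i₂).trans t).trans (i₁.symm.trans e.symm)⟩

theorem finite_of_isSimpleModule [Module.Finite ℝ K] (hA : IsMatrixAlgebra K A) (S : Type*)
    [AddCommGroup S] [Module ℝ S] [Module A S] [IsScalarTower ℝ A S] [IsSimpleModule A S] :
    Module.Finite ℝ S := by
  have := hA.finite
  exact Module.Finite.trans A S

/-- All finite dimensional modules are sums of copies of the simple module. -/
theorem exists_linearEquiv_pi [Module.Finite ℝ K] (hA : IsMatrixAlgebra K A) (S : Type*)
    [AddCommGroup S] [Module ℝ S] [Module A S] [IsScalarTower ℝ A S] [IsSimpleModule A S]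
    (L : Type*) [AddCommGroup L] [Module ℝ L] [Module.Finite ℝ L] (μ : A →ₐ[ℝ] Module.End ℝ L) :
    ∃ (k : ℕ) (Ψ : (Fin k → S) ≃ₗ[ℝ] L), ∀ (a : A) (s : Fin k → S), Ψ (a • s) = μ a (Ψ s) := by
  letI : Module A L := Module.compHom L μ.toRingHom
  have : IsScalarTower ℝ A L := ⟨fun r a l => by
    change μ (r • a) l = r • μ a l
    rw [map_smul, LinearMap.smul_apply]⟩
  have := hA.finite
  have := hA.isSimpleRing
  have : IsArtinianRing A := IsArtinianRing.of_finite ℝ A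
  have : Module.Finite A L := Module.Finite.of_restrictScalars_finite ℝ A L
  obtain ⟨k, ⟨e⟩⟩ := (hA.isIsotypicOfType L S).linearEquiv_fun
  exact ⟨k, e.symm.restrictScalars ℝ, fun a s => map_smul e.symm a s⟩

/-- A simple module over an algebra `A ≅ M_ι(K)` is isomorphic to the column module. -/
theorem nonempty_linearEquiv_column [Module.Finite ℝ K] {ι : Type} [Fintype ι] [DecidableEq ι]
    [Nonempty ι] (f : A ≃ₐ[ℝ] Matrix ι ι K) (S : Type*) [AddCommGroup S] [Module A S]
    [IsSimpleModule A S] : Nonempty (S ≃ₗ[A] Column f) := by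
  have hA : IsMatrixAlgebra K A := ⟨ι, _, _, inferInstance, ⟨f⟩⟩
  have : IsSimpleModule A (⊤ : Submodule A S) := IsSimpleModule.congr Submodule.topEquiv
  obtain ⟨e⟩ := hA.isIsotypicOfType S (Column f) ⊤
  exact ⟨Submodule.topEquiv.symm.trans e⟩

/-- The `A`-linear endomorphisms of a simple module form a space of the same dimension as `K`. -/
theorem finrank_end_le [Module.Finite ℝ K] (hA : IsMatrixAlgebra K A) (S : Type*)
    [AddCommGroup S] [Module ℝ S] [Module A S] [IsScalarTower ℝ A S] [IsSimpleModule A S]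
    (W : Submodule ℝ (Module.End ℝ S)) (hW : ∀ φ ∈ W, ∀ (a : A) s, φ (a • s) = a • φ s) :
    Module.finrank ℝ W ≤ Module.finrank ℝ K := by
  obtain ⟨ι, _, _, _, ⟨f⟩⟩ := hA
  obtain ⟨e⟩ := nonempty_linearEquiv_column f S
  obtain ⟨i₀⟩ := ‹Nonempty ι›
  let u : Column f := (Pi.single i₀ 1 : ι → K)
  have hr : ∀ (r : ℝ) (s : S), e (r • s) = r • e s := fun r s => by
    rw [← algebraMap_smul A r s, map_smul]
    funext i
    exact Column.algebraMap_smul_apply f r (e s) i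
  -- T reads off the scalar by which the endomorphism multiplies columns from the right.
  let T : W →ₗ[ℝ] K :=
    { toFun := fun φ => e (φ.1 (e.symm u)) i₀
      map_add' := fun φ ψ => by
        change e (φ.1 _ + ψ.1 _) i₀ = _
        rw [map_add]; rfl
      map_smul' := fun r φ => by
        change e (r • φ.1 _) i₀ = _
        rw [hr]; rfl }
  refine LinearMap.finrank_le_finrank_of_injective (f := T) ?_
  refine (injective_iff_map_eq_zero T).2 fun φ hφ => Subtype.ext (LinearMap.ext fun s => ?_)
  let φ' : S →ₗ[A] S := { φ.1 with map_smul' := hW φ.1 φ.2 }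
  obtain ⟨c, hc⟩ := Column.end_eq f (e.toLinearMap.comp (φ'.comp e.symm.toLinearMap))
  have h1 : e (φ.1 (e.symm u)) i₀ = c := by
    refine (hc u i₀).trans ?_
    simp [u]
  have h2 : c = 0 := h1.symm.trans hφ
  have h3 : e (φ.1 s) = 0 := by
    have := hc (e s)
    simp only [LinearMap.comp_apply, LinearEquiv.coe_coe, LinearEquiv.symm_apply_apply, h2,
      mul_zero] at this
    exact funext this
  simpa using h3

/-- The simple module over `M_ι(ℍ)` has a quaternionic structure. -/
theorem exists_quaternion_module (hA : IsMatrixAlgebra ℍ[ℝ] A) (S : Type*)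
    [AddCommGroup S] [Module ℝ S] [Module A S] [IsScalarTower ℝ A S] [IsSimpleModule A S] :
    ∃ _ : Module ℍ[ℝ] S, IsScalarTower ℝ ℍ[ℝ] S ∧ SMulCommClass ℍ[ℝ] A S := by
  obtain ⟨ι, _, _, _, ⟨f⟩⟩ := hA
  obtain ⟨e⟩ := nonempty_linearEquiv_column f S
  -- Conjugation turns right multiplication, which commutes with matrices acting from the left, into
  -- a left action of ℍ.
  let R : ℍ[ℝ] → Column f → Column f := fun l v i => v i * star l
  have hr : ∀ (r : ℝ) (s : S) i, e (r • s) i = r • e s i := fun r s i => by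
    rw [← algebraMap_smul A r s, map_smul]
    exact Column.algebraMap_smul_apply f r (e s) i
  have hR : ∀ (l : ℍ[ℝ]) (v : Column f) i, R l v i = v i * star l := fun _ _ _ => rfl
  have hadd : ∀ (v w : Column f) i, (v + w) i = v i + w i := fun _ _ _ => rfl
  letI inst : Module ℍ[ℝ] S :=
    { smul := fun l s => e.symm (R l (e s))
      one_smul := fun s => by
        change e.symm (R 1 (e s)) = s
        rw [LinearEquiv.symm_apply_eq]
        funext i
        rw [hR, star_one, mul_one]
      mul_smul := fun l k s => by
        change e.symm (R (l * k) (e s)) = e.symm (R l (e (e.symm (R k (e s)))))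
        rw [LinearEquiv.apply_symm_apply]
        congr 1
        funext i
        rw [hR, hR, hR, star_mul, mul_assoc]
      smul_zero := fun l => by
        change e.symm (R l (e 0)) = 0
        rw [LinearEquiv.symm_apply_eq, map_zero]
        funext i
        exact zero_mul _
      smul_add := fun l s t => by
        change e.symm (R l (e (s + t))) = e.symm (R l (e s)) + e.symm (R l (e t))
        rw [← map_add, map_add]
        congr 1
        funext i
        rw [hadd, hR, hR, hR, hadd, add_mul]
      add_smul := fun l k s => by
        change e.symm (R (l + k) (e s)) = e.symm (R l (e s)) + e.symm (R k (e s))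
        rw [← map_add]
        congr 1
        funext i
        rw [hadd, hR, hR, hR, star_add, mul_add]
      zero_smul := fun s => by
        change e.symm (R 0 (e s)) = 0
        rw [LinearEquiv.symm_apply_eq, map_zero]
        funext i
        rw [hR, star_zero, mul_zero]
        rfl }
  have hsmul : ∀ (l : ℍ[ℝ]) (s : S), l • s = e.symm (R l (e s)) := fun _ _ => rfl
  refine ⟨inst, ⟨fun r l s => ?_⟩, ⟨fun l a s => ?_⟩⟩
  · apply e.injective
    funext i
    rw [hr, hsmul, hsmul, LinearEquiv.apply_symm_apply, LinearEquiv.apply_symm_apply, hR, hR,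
      Quaternion.star_smul, mul_smul_comm]
  · apply e.injective
    funext i
    rw [hsmul, hsmul, map_smul, map_smul, LinearEquiv.apply_symm_apply,
      LinearEquiv.apply_symm_apply, hR, Column.smul_def, Column.smul_def]
    simp only [Matrix.mulVec, dotProduct, Finset.sum_mul, hR, mul_assoc]

end IsMatrixAlgebra

/-! ## The commutant of a simple module -/

/-- A right action `ρ` of `K` on the `A`-module `S`, which identifies `K` with the opposite of
the algebra of `A`-linear endomorphisms of `S`. The scalars are written as operators, so that
the case `K = ℝ` and the case `K = ℍᵐᵒᵖ` can be treated simultaneously. -/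
structure Commutant (A K S : Type*) [Ring A] [Ring K] [Algebra ℝ K] [AddCommGroup S] [Module ℝ S]
    [Module A S] where
  ρ : K →ₗ[ℝ] Module.End ℝ S
  ρ_one : ρ 1 = 1
  ρ_mul : ∀ c d, ρ (c * d) = ρ d * ρ c
  commute : ∀ c (a : A) s, ρ c (a • s) = a • ρ c s
  eq_zero : ∀ c s, ρ c s = 0 → s ≠ 0 → c = 0
  exists_eq : ∀ φ : S →ₗ[ℝ] S, (∀ (a : A) s, φ (a • s) = a • φ s) → ∃ c, φ = ρ c

section

variable {A S : Type*} [Ring A] [Algebra ℝ A] [AddCommGroup S] [Module ℝ S] [Module A S]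
  [IsScalarTower ℝ A S] [IsSimpleModule A S]

/-- A dimension count: the image of ρ lies in the commutant, whose dimension is at most that of K.
In this form it applies to an arbitrary quaternionic structure on S, not only to a constructed one.
-/
theorem surjective_of_finrank_le {K : Type*} [AddCommGroup K] [Module ℝ K] [Module.Finite ℝ S]
    (hle : ∀ W : Submodule ℝ (Module.End ℝ S), (∀ φ ∈ W, ∀ (a : A) s, φ (a • s) = a • φ s) →
      Module.finrank ℝ W ≤ Module.finrank ℝ K)
    (ρ : K →ₗ[ℝ] Module.End ℝ S) (hcomm : ∀ c (a : A) s, ρ c (a • s) = a • ρ c s)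
    (hinj : Function.Injective ρ) (φ : S →ₗ[ℝ] S) (hφ : ∀ (a : A) s, φ (a • s) = a • φ s) :
    ∃ c, φ = ρ c := by
  let W : Submodule ℝ (Module.End ℝ S) :=
    { carrier := {φ | ∀ (a : A) s, φ (a • s) = a • φ s}
      add_mem' := fun {φ ψ} h h' a s => by
        rw [LinearMap.add_apply, LinearMap.add_apply, h, h', smul_add]
      zero_mem' := fun a s => by simp
      smul_mem' := fun r φ h a s => by
        rw [LinearMap.smul_apply, LinearMap.smul_apply, h, smul_comm] }
  have hW := hle W fun φ h => h
  have hR : LinearMap.range ρ ≤ W := by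
    rintro _ ⟨c, rfl⟩
    exact hcomm c
  have hfr := LinearMap.finrank_range_of_inj hinj
  have heq : LinearMap.range ρ = W := Submodule.eq_of_le_of_finrank_le hR (by rw [hfr]; exact hW)
  have : φ ∈ LinearMap.range ρ := by rw [heq]; exact hφ
  obtain ⟨c, hc⟩ := this
  exact ⟨c, hc.symm⟩

/-- The commutant in the real case. -/
def IsMatrixAlgebra.realCommutant (hA : IsMatrixAlgebra ℝ A) : Commutant A ℝ S where
  ρ := LinearMap.lsmul ℝ S
  ρ_one := LinearMap.ext fun s => one_smul ℝ s
  ρ_mul c d := LinearMap.ext fun s => by simp [mul_smul, smul_comm c d]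
  commute c a s := smul_comm c a s
  eq_zero c s h hs := (smul_eq_zero.1 h).resolve_right hs
  exists_eq := by
    have := hA.finite_of_isSimpleModule S
    have := IsSimpleModule.nontrivial A S
    refine surjective_of_finrank_le (fun W hW => hA.finrank_end_le S W hW) _
      (fun c a s => smul_comm c a s) ?_
    refine (injective_iff_map_eq_zero _).2 fun c hc => ?_
    obtain ⟨s, hs⟩ := exists_ne (0 : S)
    exact (smul_eq_zero.1 (LinearMap.congr_fun hc s)).resolve_right hs

/-- The commutant in the quaternionic case. -/
def IsMatrixAlgebra.quaternionCommutant [Module ℍ[ℝ] S] [IsScalarTower ℝ ℍ[ℝ] S]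
    [SMulCommClass ℍ[ℝ] A S] (hA : IsMatrixAlgebra ℍ[ℝ] A) : Commutant A ℍ[ℝ]ᵐᵒᵖ S where
  ρ := (Algebra.lsmul ℝ ℝ S : ℍ[ℝ] →ₐ[ℝ] Module.End ℝ S).toLinearMap.comp
    (MulOpposite.opLinearEquiv ℝ).symm.toLinearMap
  ρ_one := LinearMap.ext fun s => one_smul ℍ[ℝ] s
  ρ_mul c d := LinearMap.ext fun s => mul_smul d.unop c.unop s
  commute c a s := smul_comm c.unop a s
  eq_zero c s h hs := by
    have : c.unop • s = 0 := h
    exact MulOpposite.unop_injective ((smul_eq_zero.1 this).resolve_right hs)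
  exists_eq := by
    have := hA.finite_of_isSimpleModule S
    have := IsSimpleModule.nontrivial A S
    refine surjective_of_finrank_le (fun W hW => (hA.finrank_end_le S W hW).trans_eq
      (LinearEquiv.finrank_eq (MulOpposite.opLinearEquiv ℝ))) _
      (fun c a s => smul_comm c.unop a s) ?_
    refine (injective_iff_map_eq_zero _).2 fun c hc => ?_
    obtain ⟨s, hs⟩ := exists_ne (0 : S)
    have : c.unop • s = 0 := LinearMap.congr_fun hc s
    exact MulOpposite.unop_injective ((smul_eq_zero.1 this).resolve_right hs)

theorem IsMatrixAlgebra.realCommutant_apply (hA : IsMatrixAlgebra ℝ A) (c : ℝ) (s : S) :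
    (hA.realCommutant (S := S)).ρ c s = c • s := rfl

theorem IsMatrixAlgebra.quaternionCommutant_apply [Module ℍ[ℝ] S] [IsScalarTower ℝ ℍ[ℝ] S]
    [SMulCommClass ℍ[ℝ] A S] (hA : IsMatrixAlgebra ℍ[ℝ] A) (c : ℍ[ℝ]ᵐᵒᵖ) (s : S) :
    (hA.quaternionCommutant (S := S)).ρ c s = c.unop • s := rfl

end

/-! ## Charts of families of spaces -/

section Charts

variable {X : Type*} [TopologicalSpace X] {E E' : X → Type*} [TopologicalSpace (Tot E)]
  [TopologicalSpace (Tot E')] {F F' : Type*} [TopologicalSpace F] [TopologicalSpace F']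

/-- The maps `F → E x` for `x ∈ U` fit together to an open embedding of `U × F`. -/
def IsChart {U : Set X} (e : ∀ x : U, F → E x) : Prop :=
  Topology.IsOpenEmbedding (fun p : U × F => (⟨p.1, e p.1 p.2⟩ : Tot E))

theorem Tot.ext_iff {x : X} {v w : E x} : (⟨x, v⟩ : Tot E) = ⟨x, w⟩ ↔ v = w := by
  constructor
  · intro h
    cases h
    rfl
  · rintro rfl
    rfl

theorem isOpenEmbedding_inclusion {U W : Set X} (hW : IsOpen W) (h : W ⊆ U) :
    Topology.IsOpenEmbedding (Set.inclusion h) :=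
  ⟨Topology.IsEmbedding.inclusion h, by
    rw [Set.range_inclusion]
    exact hW.preimage continuous_subtype_val⟩

namespace IsChart

variable {U : Set X} {e : ∀ x : U, F → E x}

theorem injective (he : IsChart e) (x : U) : Function.Injective (e x) := fun v w h => by
  have : ((x, v) : U × F) = (x, w) :=
    (Topology.IsOpenEmbedding.toIsEmbedding he).injective (Tot.ext_iff.2 h)
  exact (Prod.ext_iff.1 this).2

/-- A chart is an embedding, so continuity of a map into the total space is continuity of its
coordinates. Nearly every continuity argument below passes through this equivalence. -/
theorem continuous_iff (he : IsChart e) {Y : Type*} [TopologicalSpace Y] {b : Y → U} {s : Y → F} :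
    Continuous (fun y => (⟨b y, e (b y) (s y)⟩ : Tot E)) ↔ Continuous b ∧ Continuous s := by
  have h := he.toIsEmbedding.continuous_iff (f := fun y => (b y, s y))
  exact h.symm.trans continuous_prodMk

theorem continuous (he : IsChart e) : Continuous (fun p : U × F => (⟨p.1, e p.1 p.2⟩ : Tot E)) :=
  Topology.IsOpenEmbedding.continuous he

theorem restrict (he : IsChart e) {W : Set X} (hW : IsOpen W) (h : W ⊆ U) :
    IsChart (fun x : W => e ⟨x, h x.2⟩) :=
  Topology.IsOpenEmbedding.comp he
    ((isOpenEmbedding_inclusion hW h).prodMap Topology.IsOpenEmbedding.id)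

theorem comp_homeomorph (he : IsChart e) (h : F' ≃ₜ F) : IsChart (fun x v => e x (h v)) :=
  Topology.IsOpenEmbedding.comp he (Topology.IsOpenEmbedding.id.prodMap h.isOpenEmbedding)

theorem mem_range (he : ∀ x, Function.Surjective (e x)) (t : Tot E) :
    t ∈ Set.range (fun p : U × F => (⟨p.1, e p.1 p.2⟩ : Tot E)) ↔ t.base ∈ U := by
  constructor
  · rintro ⟨p, rfl⟩
    exact p.1.2
  · intro h
    obtain ⟨v, hv⟩ := he ⟨t.base, h⟩ t.fib
    exact ⟨(⟨t.base, h⟩, v), by simp only [hv]⟩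

end IsChart

theorem LocalTriv.isChart {K : Type*} [Ring K] [TopologicalSpace K]
    [∀ x, AddCommGroup (E x)] [∀ x, Module K (E x)] {k : ℕ} (e : LocalTriv K E k) :
    IsChart (fun x v => e.equiv x v) := e.isOpenEmbedding

/-- The topology of the total space is arbitrary data, so continuity of the projection is not
automatic; it holds because it can be seen in charts. -/
theorem continuous_base_of_charts
    (h : ∀ x₀ : X, ∃ (F : Type) (_ : TopologicalSpace F) (U : Set X) (e : ∀ x : U, F → E x),
      x₀ ∈ U ∧ IsChart e ∧ (∀ x, Function.Surjective (e x))) :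
    Continuous (Tot.base : Tot E → X) := by
  rw [continuous_iff_continuousAt]
  rintro ⟨x₀, v⟩
  obtain ⟨F, _, U, e, hx, he, hs⟩ := h x₀
  obtain ⟨w, rfl⟩ := hs ⟨x₀, hx⟩ v
  have := Topology.IsOpenEmbedding.continuousAt_iff he (g := Tot.base) (x := (⟨x₀, hx⟩, w))
  exact this.1 (continuous_subtype_val.comp continuous_fst).continuousAt

/-- A map is continuous near the points over `U` if it is continuous in a chart over `U`. -/
theorem IsChart.continuousAt {U : Set X} {e : ∀ x : U, F → E x} (he : IsChart e)
    (hs : ∀ x, Function.Surjective (e x)) {Z : Type*} [TopologicalSpace Z] {f : Tot E → Z}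
    (hf : Continuous (fun p : U × F => f ⟨p.1, e p.1 p.2⟩)) (t : Tot E) (ht : t.base ∈ U) :
    ContinuousAt f t := by
  obtain ⟨p, rfl⟩ := (IsChart.mem_range hs t).2 ht
  exact (Topology.IsOpenEmbedding.continuousAt_iff he (g := f) (x := p)).1 hf.continuousAt

theorem continuous_fibProd_fst {X : Type*} {E E' : X → Type*} [TopologicalSpace (Tot E)]
    [TopologicalSpace (Tot E')] :
    Continuous (fun q : FibProd E E' => (⟨q.base, q.fst⟩ : Tot E)) :=
  continuous_fst.comp (continuous_induced_dom
    (f := fun p : FibProd E E' => ((⟨p.base, p.fst⟩ : Tot E), (⟨p.base, p.snd⟩ : Tot E'))))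

theorem continuous_fibProd_snd {X : Type*} {E E' : X → Type*} [TopologicalSpace (Tot E)]
    [TopologicalSpace (Tot E')] :
    Continuous (fun q : FibProd E E' => (⟨q.base, q.snd⟩ : Tot E')) :=
  continuous_snd.comp (continuous_induced_dom
    (f := fun p : FibProd E E' => ((⟨p.base, p.fst⟩ : Tot E), (⟨p.base, p.snd⟩ : Tot E'))))

theorem continuous_fibProd_iff {X : Type*} {E E' : X → Type*} [TopologicalSpace (Tot E)]
    [TopologicalSpace (Tot E')] {Y : Type*} [TopologicalSpace Y] {f : Y → FibProd E E'} :
    Continuous f ↔ Continuous (fun y => (⟨(f y).base, (f y).fst⟩ : Tot E)) ∧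
      Continuous (fun y => (⟨(f y).base, (f y).snd⟩ : Tot E')) := by
  rw [continuous_induced_rng]
  exact continuous_prodMk

/-- Continuity of functions on fibre products can be checked in charts. -/
theorem FibProd.continuous_of_charts {Z : Type*} [TopologicalSpace Z] (f : FibProd E E' → Z)
    (hb : Continuous (Tot.base : Tot E → X))
    (h : ∀ x₀ : X, ∃ (F F' : Type) (_ : TopologicalSpace F) (_ : TopologicalSpace F')
      (U : Set X) (e : ∀ x : U, F → E x) (e' : ∀ x : U, F' → E' x),
      IsOpen U ∧ x₀ ∈ U ∧ IsChart e ∧ (∀ x, Function.Surjective (e x)) ∧ IsChart e' ∧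
      (∀ x, Function.Surjective (e' x)) ∧
      Continuous (fun p : U × F × F' => f ⟨p.1, e p.1 p.2.1, e' p.1 p.2.2⟩)) : Continuous f := by
  rw [continuous_iff_continuousAt]
  intro q₀
  obtain ⟨F, F', _, _, U, e, e', hU, hx, he, hs, he', hs', hf⟩ := h q₀.base
  have hbase : Continuous (fun q : FibProd E E' => q.base) := hb.comp continuous_fibProd_fst
  let O : Set (FibProd E E') := {q | q.base ∈ U}
  have hO : IsOpen O := hU.preimage hbase
  suffices hfO : ContinuousOn f O from hfO.continuousAt (hO.mem_nhds hx)
  rw [continuousOn_iff_continuous_restrict]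
  let b : O → U := fun q => ⟨q.1.base, q.2⟩
  -- Coordinates are chosen pointwise; they are continuous because the charts are embeddings.
  choose s hs₁ using fun q : O => hs (b q) q.1.fst
  choose s' hs₂ using fun q : O => hs' (b q) q.1.snd
  have h1 : Continuous s := ((he.continuous_iff (b := b) (s := s)).1 (by
    simp only [hs₁]
    exact continuous_fibProd_fst.comp continuous_subtype_val)).2
  have h2 : Continuous s' := ((he'.continuous_iff (b := b) (s := s')).1 (by
    simp only [hs₂]
    exact continuous_fibProd_snd.comp continuous_subtype_val)).2
  have h3 : Continuous b := (hbase.comp continuous_subtype_val).subtype_mk _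
  have := hf.comp (h3.prodMk (h1.prodMk h2))
  refine this.congr fun q => ?_
  simp only [Function.comp, hs₁, hs₂]
  rfl

/-- A fibrewise map is continuous if it is continuous in local charts. -/
theorem continuousAt_totMap {φ : ∀ x, E x → E' x} {U : Set X} {e : ∀ x : U, F → E x}
    {e' : ∀ x : U, F' → E' x} (he : IsChart e) (hs : ∀ x, Function.Surjective (e x))
    (he' : IsChart e') (c : U × F → F') (hc : Continuous c)
    (h : ∀ (x : U) v, φ x (e x v) = e' x (c (x, v))) (t : Tot E) (ht : t.base ∈ U) :
    ContinuousAt (Tot.map φ) t := by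
  refine he.continuousAt hs ?_ t ht
  have : (fun p : U × F => Tot.map φ ⟨p.1, e p.1 p.2⟩) =
      fun p : U × F => (⟨p.1, e' p.1 (c p)⟩ : Tot E') := by
    funext p
    simp only [Tot.map, h]
  rw [this]
  exact he'.continuous_iff.2 ⟨continuous_fst, hc⟩

/-- The gluing lemma: if a space carries the finest topology for which the maps `c i` are
continuous, and the images of open sets under `c i` have open preimages under `c j`, then the
`c i` are open embeddings. -/
theorem isOpenEmbedding_of_glue {ι : Type*} {Z : ι → Type*} [∀ i, TopologicalSpace (Z i)]
    {T : Type*} [TopologicalSpace T] (c : ∀ i, Z i → T)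
    (hT : ∀ O : Set T, IsOpen O ↔ ∀ i, IsOpen (c i ⁻¹' O)) (hinj : ∀ i, Function.Injective (c i))
    (htrans : ∀ i j (W : Set (Z i)), IsOpen W → IsOpen (c j ⁻¹' (c i '' W))) (i : ι) :
    Topology.IsOpenEmbedding (c i) :=
  Topology.IsOpenEmbedding.of_continuous_injective_isOpenMap
    ⟨fun O hO => (hT O).1 hO i⟩ (hinj i) fun W hW => (hT _).2 fun j => htrans i j W hW

/-- The gluing lemma for charts, in terms of continuous changes of coordinates. -/
theorem isChart_of_glue {X : Type*} [TopologicalSpace X] {E : X → Type*} [TopologicalSpace (Tot E)]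
    {ι : Type*} {U : ι → Set X} {F : ι → Type*} [∀ i, TopologicalSpace (F i)]
    (hU : ∀ i, IsOpen (U i)) (e : ∀ i (x : U i), F i ≃ E x)
    (hT : ∀ O : Set (Tot E), IsOpen O ↔
      ∀ i, IsOpen ((fun p : U i × F i => (⟨p.1, e i p.1 p.2⟩ : Tot E)) ⁻¹' O))
    (htrans : ∀ i j, Continuous (fun p : (U i ∩ U j : Set X) × F j =>
      (e i ⟨p.1, p.1.2.1⟩).symm (e j ⟨p.1, p.1.2.2⟩ p.2))) (i : ι) : IsChart (fun x => e i x) := by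
  refine isOpenEmbedding_of_glue (fun i (p : U i × F i) => (⟨p.1, e i p.1 p.2⟩ : Tot E)) hT ?_ ?_ i
  · rintro i ⟨⟨x, hx⟩, v⟩ ⟨⟨y, hy⟩, w⟩ h
    obtain rfl : x = y := congrArg Tot.base h
    obtain rfl : v = w := (e i ⟨x, hx⟩).injective (Tot.ext_iff.1 h)
    rfl
  · intro i j W hW
    have h1 := (isOpenEmbedding_inclusion ((hU i).inter (hU j)) Set.inter_subset_right).prodMap
      (Topology.IsOpenEmbedding.id (X := F j))
    let g : (U i ∩ U j : Set X) × F j → U i × F i := fun p =>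
      (⟨p.1, p.1.2.1⟩, (e i ⟨p.1, p.1.2.1⟩).symm (e j ⟨p.1, p.1.2.2⟩ p.2))
    have hg : Continuous g :=
      ((continuous_inclusion Set.inter_subset_left).comp continuous_fst).prodMk (htrans i j)
    -- Seen in chart j, the image of W under chart i is the preimage of W under the change of
    -- coordinates g, which is open over U i ∩ U j and hence over U j.
    convert! h1.isOpenMap _ (hW.preimage hg) using 1
    ext ⟨⟨x, hx⟩, v⟩
    constructor
    · rintro ⟨⟨⟨y, hy⟩, w⟩, hw, h⟩
      obtain rfl : y = x := congrArg Tot.base h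
      refine ⟨(⟨y, hy, hx⟩, v), ?_, rfl⟩
      have h' : e i ⟨y, hy⟩ w = e j ⟨y, hx⟩ v := Tot.ext_iff.1 h
      change (_, (e i ⟨y, hy⟩).symm (e j ⟨y, hx⟩ v)) ∈ W
      rw [← h', Equiv.symm_apply_apply]
      exact hw
    · rintro ⟨⟨⟨y, hy⟩, w⟩, hw, h⟩
      obtain ⟨h1, rfl⟩ := Prod.ext_iff.1 h
      obtain rfl : y = x := congrArg Subtype.val h1
      refine ⟨_, hw, ?_⟩
      change (⟨y, e i ⟨y, hy.1⟩ ((e i ⟨y, hy.1⟩).symm (e j ⟨y, hy.2⟩ w))⟩ : Tot E) = _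
      rw [Equiv.apply_symm_apply]
      rfl

end Charts

/-! ## Averaging over anticommuting complex structures -/

section Averaging

variable {J Y W N : Type*} [TopologicalSpace Y] [AddCommGroup W] [Module ℝ W] [TopologicalSpace W]
  [AddCommGroup N] [Module ℝ N] [TopologicalSpace N] [IsTopologicalAddGroup N]
  [ContinuousSMul ℝ N]

/-- A linear map that intertwines actions at one point extends to a continuous family of
linear maps that intertwine the actions. -/
theorem exists_intertwining_family [Finite J] (β : J → Module.End ℝ W)
    (α : Y → J → Module.End ℝ N) (hβ : ∀ i, Continuous (β i))
    (hα : ∀ i, Continuous fun p : Y × N => α p.1 i p.2)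
    (hβ₁ : ∀ i w, β i (β i w) = -w) (hβ₂ : ∀ i j, i ≠ j → ∀ w, β i (β j w) = -β j (β i w))
    (hα₁ : ∀ y i v, α y i (α y i v) = -v)
    (hα₂ : ∀ y i j, i ≠ j → ∀ v, α y i (α y j v) = -α y j (α y i v))
    (y₀ : Y) (φ₀ : W →ₗ[ℝ] N) (hφ₀ : Continuous φ₀) (h₀ : ∀ i w, φ₀ (β i w) = α y₀ i (φ₀ w)) :
    ∃ φ : Y → W →ₗ[ℝ] N, (Continuous fun p : Y × W => φ p.1 p.2) ∧
      (∀ y i w, φ y (β i w) = α y i (φ y w)) ∧ φ y₀ = φ₀ := by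
  classical
  suffices h : ∀ T : Set J, T.Finite → ∃ φ : Y → W →ₗ[ℝ] N, (Continuous fun p : Y × W => φ p.1 p.2) ∧
      (∀ y, ∀ i ∈ T, ∀ w, φ y (β i w) = α y i (φ y w)) ∧ φ y₀ = φ₀ by
    obtain ⟨φ, h1, h2, h3⟩ := h Set.univ Set.finite_univ
    exact ⟨φ, h1, fun y i w => h2 y i trivial w, h3⟩
  intro T hT
  induction T, hT using Set.Finite.induction_on with
  | empty => exact ⟨fun _ => φ₀, hφ₀.comp continuous_snd, by simp, rfl⟩
  | @insert i T hi _ ih =>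
    obtain ⟨φ, h1, h2, h3⟩ := ih
    -- Since β_i⁻¹ = -β_i, this is the average of φ and α_i φ β_i⁻¹.
    refine ⟨fun y => (2⁻¹ : ℝ) • (φ y - (α y i).comp ((φ y).comp (β i))), ?_, ?_, ?_⟩
    · simp only [LinearMap.smul_apply, LinearMap.sub_apply, LinearMap.comp_apply]
      have h4 : Continuous fun p : Y × W => φ p.1 (β i p.2) :=
        h1.comp (continuous_fst.prodMk ((hβ i).comp continuous_snd))
      exact (h1.sub ((hα i).comp (continuous_fst.prodMk h4))).const_smul _
    · intro y j hj w
      simp only [LinearMap.smul_apply, LinearMap.sub_apply, LinearMap.comp_apply, map_smul, map_sub]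
      congr 1
      rcases eq_or_ne j i with rfl | hne
      · rw [hβ₁, hα₁, map_neg, map_neg]
        abel
      · have hjT : j ∈ T := (Set.mem_insert_iff.1 hj).resolve_left hne
        -- Exchanging i and j costs one sign on the side of α and one on the side of β. They cancel,
        -- so the relation with the earlier generator j survives.
        rw [h2 y j hjT, hβ₂ i j hne.symm, map_neg, map_neg, h2 y j hjT, hα₂ y i j hne.symm, neg_neg]
    -- At y₀ the map already intertwines, and averaging leaves it unchanged.
    · ext w
      simp only [h3, LinearMap.smul_apply, LinearMap.sub_apply, LinearMap.comp_apply]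
      rw [h₀, hα₁, sub_neg_eq_add, ← two_smul ℝ (φ₀ w), smul_smul]
      norm_num

end Averaging

/-! ### Continuous families of invertible linear maps. -/

section Invertible

variable {X W : Type*} [TopologicalSpace X] [AddCommGroup W] [Module ℝ W] [TopologicalSpace W]
  [IsModuleTopology ℝ W]

theorem continuous_toMatrix' {Y : Type*} [TopologicalSpace Y] {r : ℕ}
    {N : Y → (Fin r → ℝ) →ₗ[ℝ] (Fin r → ℝ)} (hN : Continuous fun p : Y × (Fin r → ℝ) => N p.1 p.2) :
    Continuous fun y => LinearMap.toMatrix' (N y) := by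
  refine continuous_matrix fun i j => ?_
  simp only [LinearMap.toMatrix'_apply]
  exact (continuous_apply i).comp (hN.comp (continuous_id.prodMk continuous_const))

/-- Invertibility of linear maps is an open condition, and the inverse depends continuously on
parameters. -/
theorem exists_continuous_inverse {U : Set X} (hU : IsOpen U) {r : ℕ} (M : U → W →ₗ[ℝ] (Fin r → ℝ))
    (hM : Continuous fun p : U × W => M p.1 p.2) (x₀ : U) (h₀ : Function.Bijective (M x₀)) :
    ∃ (U' : Set X) (_ : IsOpen U') (hU' : U' ⊆ U) (Ψ : U' → W ≃ₗ[ℝ] (Fin r → ℝ)),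
      (x₀ : X) ∈ U' ∧ (∀ x w, Ψ x w = M ⟨x, hU' x.2⟩ w) ∧
      Continuous fun p : U' × (Fin r → ℝ) => (Ψ p.1).symm p.2 := by
  have := IsModuleTopology.toContinuousAdd ℝ W
  let ψ := LinearEquiv.ofBijective (M x₀) h₀
  have hψ : Continuous ψ.symm := IsModuleTopology.continuous_of_linearMap ψ.symm.toLinearMap
  -- Composition with the inverse of M x₀ gives endomorphisms of ℝʳ, whose determinant tests
  -- invertibility and equals 1 at x₀.
  let N : U → (Fin r → ℝ) →ₗ[ℝ] (Fin r → ℝ) := fun x => (M x).comp ψ.symm.toLinearMap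
  have hN : Continuous fun p : U × (Fin r → ℝ) => N p.1 p.2 :=
    hM.comp (continuous_fst.prodMk (hψ.comp continuous_snd))
  let D : U → Matrix (Fin r) (Fin r) ℝ := fun x => LinearMap.toMatrix' (N x)
  have hD : Continuous D := continuous_toMatrix' hN
  have hdet : Continuous fun x => (D x).det := hD.matrix_det
  have hopen : IsOpen {x | (D x).det ≠ 0} := isOpen_ne.preimage hdet
  have hD₀ : (D x₀).det ≠ 0 := by
    have : N x₀ = LinearMap.id := by
      ext1 i
      ext1
      exact ψ.apply_symm_apply _
    simp only [D, this, LinearMap.toMatrix'_id, Matrix.det_one, ne_eq, one_ne_zero,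
      not_false_eq_true]
  refine ⟨Subtype.val '' {x | (D x).det ≠ 0}, hU.isOpenMap_subtype_val _ hopen, ?_, ?_⟩
  · rintro _ ⟨x, -, rfl⟩
    exact x.2
  have hsub : Subtype.val '' {x | (D x).det ≠ 0} ⊆ U := by
    rintro _ ⟨x, -, rfl⟩
    exact x.2
  have hne : ∀ x : (Subtype.val '' {x | (D x).det ≠ 0} : Set X), (D ⟨x, hsub x.2⟩).det ≠ 0 := by
    rintro ⟨_, x, hx, rfl⟩
    exact hx
  have hNM : ∀ (x : U) w, N x (ψ w) = M x w := fun x w => by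
    simp only [N, LinearMap.comp_apply, LinearEquiv.coe_coe, LinearEquiv.symm_apply_apply]
  have hND : ∀ (x : U) v, (D x).mulVec v = N x v := fun x v => by
    simp only [D, LinearMap.toMatrix'_mulVec]
  refine ⟨fun x : (Subtype.val '' {x | (D x).det ≠ 0} : Set X) => LinearEquiv.ofLinear (M ⟨x, hsub x.2⟩)
    (ψ.symm.toLinearMap.comp (D ⟨x, hsub x.2⟩)⁻¹.mulVecLin) ?_ ?_, ⟨x₀, hD₀, rfl⟩, fun x w => rfl, ?_⟩
  · refine LinearMap.ext fun v => ?_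
    have hu := isUnit_iff_ne_zero.2 (hne x)
    change N ⟨x, hsub x.2⟩ ((D ⟨x, hsub x.2⟩)⁻¹.mulVec v) = v
    rw [← hND, Matrix.mulVec_mulVec, Matrix.mul_nonsing_inv _ hu, Matrix.one_mulVec]
  · refine LinearMap.ext fun w => ?_
    have hu := isUnit_iff_ne_zero.2 (hne x)
    change ψ.symm ((D ⟨x, hsub x.2⟩)⁻¹.mulVec (M ⟨x, hsub x.2⟩ w)) = w
    rw [LinearEquiv.symm_apply_eq, ← hNM, ← hND, Matrix.mulVec_mulVec, Matrix.nonsing_inv_mul _ hu,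
      Matrix.one_mulVec]
  · have h1 : Continuous fun x : (Subtype.val '' {x | (D x).det ≠ 0} : Set X) => D ⟨x, hsub x.2⟩ :=
      hD.comp (continuous_inclusion hsub)
    have h2 : Continuous fun x : (Subtype.val '' {x | (D x).det ≠ 0} : Set X) =>
        (D ⟨x, hsub x.2⟩)⁻¹ := by
      have : (fun x : (Subtype.val '' {x | (D x).det ≠ 0} : Set X) => (D ⟨x, hsub x.2⟩)⁻¹) =
          fun x : (Subtype.val '' {x | (D x).det ≠ 0} : Set X) => ((D ⟨x, hsub x.2⟩).det)⁻¹ • (D ⟨x, hsub x.2⟩).adjugate := by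
        funext x
        rw [Matrix.inv_def, Ring.inverse_eq_inv']
      rw [this]
      exact (h1.matrix_det.inv₀ hne).smul h1.matrix_adjugate
    exact hψ.comp ((h2.comp continuous_fst).matrix_mulVec continuous_snd)

end Invertible

/-! ## Invariant families of vectors -/

section Invariant

variable {S : Type*} [AddCommGroup S] [Module ℝ S]

/-- There is a finite spanning family `t` for which `∑ t_j ⊗ t_j` is invariant under given
pairwise commuting or anticommuting complex structures. -/
theorem exists_invariant_family [Module.Finite ℝ S] {J : Type*} [Finite J] (u : J → Module.End ℝ S)
    (hu : ∀ i s, u i (u i s) = -s)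
    (hc : ∀ i j, i ≠ j → (∀ s, u i (u j s) = u j (u i s)) ∨ ∀ s, u i (u j s) = -u j (u i s)) :
    ∃ (κ : Type) (_ : Fintype κ) (t : κ → S), Submodule.span ℝ (Set.range t) = ⊤ ∧
      ∀ i (B : LinearMap.BilinForm ℝ S), ∑ j, B (u i (t j)) (u i (t j)) = ∑ j, B (t j) (t j) := by
  classical
  suffices h : ∀ T : Set J, T.Finite → ∃ (κ : Type) (_ : Fintype κ) (t : κ → S),
      Submodule.span ℝ (Set.range t) = ⊤ ∧ ∀ i ∈ T, ∀ (B : LinearMap.BilinForm ℝ S),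
        ∑ j, B (u i (t j)) (u i (t j)) = ∑ j, B (t j) (t j) by
    obtain ⟨κ, inst, t, h1, h2⟩ := h Set.univ Set.finite_univ
    exact ⟨κ, inst, t, h1, fun i B => h2 i trivial B⟩
  intro T hT
  induction T, hT using Set.Finite.induction_on with
  | empty =>
    refine ⟨Fin (Module.finrank ℝ S), inferInstance, Module.finBasis ℝ S,
      (Module.finBasis ℝ S).span_eq, by simp⟩
  | @insert i T hi _ ih =>
    obtain ⟨κ, inst, t, h1, h2⟩ := ih
    -- The family is doubled by adjoining u_i t. As u_i² = -1, u_i exchanges the two halves up to a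
    -- sign, which disappears in B(s, s).
    refine ⟨κ ⊕ κ, inferInstance, Sum.elim t fun j => u i (t j), ?_, ?_⟩
    · rw [eq_top_iff, ← h1]
      refine Submodule.span_mono ?_
      rintro _ ⟨j, rfl⟩
      exact ⟨Sum.inl j, rfl⟩
    · intro j hj B
      simp only [Fintype.sum_sum_type, Sum.elim_inl, Sum.elim_inr]
      rcases eq_or_ne j i with rfl | hne
      · simp only [hu, map_neg, LinearMap.neg_apply, neg_neg]
        exact add_comm _ _
      · have hjT : j ∈ T := (Set.mem_insert_iff.1 hj).resolve_left hne
        congr 1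
        · exact h2 j hjT B
        -- The invariance under u_j is applied to the form B(u_i ·, u_i ·). Moving u_j past u_i
        -- costs at most a sign, which occurs in both arguments.
        · have h3 := h2 j hjT (B.compl₁₂ (u i) (u i))
          simp only [LinearMap.compl₁₂_apply] at h3
          rw [← h3]
          rcases hc j i hne with h | h
          · simp only [h]
          · simp only [h, map_neg, LinearMap.neg_apply, neg_neg]

variable {κ : Type} [Fintype κ] {t : κ → S} {n : ℕ} [Module (Cl n) S] [IsScalarTower ℝ (Cl n) S]

/-- Insert the form B(·, u ·) into the invariance and use u² = -1: with respect to ∑ t_j ⊗ t_j, the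
operator u is skew. -/
theorem sum_smul_eq_sum_neg (u : Module.End ℝ S) (hu : ∀ s, u (u s) = -s)
    (h : ∀ B : LinearMap.BilinForm ℝ S, ∑ j, B (u (t j)) (u (t j)) = ∑ j, B (t j) (t j))
    (B : LinearMap.BilinForm ℝ S) : ∑ j, B (u (t j)) (t j) = ∑ j, B (t j) (-u (t j)) := by
  have := h (B.compl₂ u)
  simp only [LinearMap.compl₂_apply, hu, map_neg] at this
  simp only [map_neg, Finset.sum_neg_distrib] at this ⊢
  rw [← this, neg_neg]

/-- Multiplication by an element of the Clifford algebra, as a linear map. -/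
abbrev clEnd (S : Type*) [AddCommGroup S] [Module ℝ S] [Module (Cl n) S] [IsScalarTower ℝ (Cl n) S] :
    Cl n →ₐ[ℝ] Module.End ℝ S := Algebra.lsmul ℝ ℝ S

/-- Generators are skew, and `star` changes their sign. Since all forms B are allowed, the identity
passes to products: for ab one uses B(a ·, ·) to move b and then B(·, b* ·) to move a. -/
theorem sum_clSmul_left
    (h : ∀ (i : Fin n) (B : LinearMap.BilinForm ℝ S),
      ∑ j, B (CliffordAlgebra.ι (stdForm n) (Pi.single i 1) • t j)
        (CliffordAlgebra.ι (stdForm n) (Pi.single i 1) • t j) = ∑ j, B (t j) (t j))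
    (a : Cl n) (B : LinearMap.BilinForm ℝ S) :
    ∑ j, B (a • t j) (t j) = ∑ j, B (t j) (star a • t j) := by
  induction a using CliffordAlgebra.induction generalizing B with
  | algebraMap r =>
    rw [CliffordAlgebra.star_algebraMap]
    simp only [algebraMap_smul, map_smul, LinearMap.smul_apply]
  | ι v =>
    have hv : v = ∑ i, v i • Pi.single i (1 : ℝ) := by
      ext k
      simp [Finset.sum_apply, Pi.single_apply]
    have h1 : ∀ i : Fin n, ∑ j, B (CliffordAlgebra.ι (stdForm n) (Pi.single i 1) • t j) (t j) =
        ∑ j, B (t j) (-(CliffordAlgebra.ι (stdForm n) (Pi.single i 1) • t j)) := fun i =>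
      sum_smul_eq_sum_neg (clEnd S (CliffordAlgebra.ι (stdForm n) (Pi.single i 1)))
        (fun s => by
          change CliffordAlgebra.ι (stdForm n) (Pi.single i 1) •
            CliffordAlgebra.ι (stdForm n) (Pi.single i 1) • s = -s
          rw [smul_smul, ι_single_sq (-1) i, neg_smul, one_smul, neg_smul, one_smul]) (h i) B
    rw [CliffordAlgebra.star_ι]
    rw [hv]
    simp only [map_sum, map_smul, neg_smul, Finset.sum_smul, map_neg, LinearMap.sum_apply,
      smul_assoc, LinearMap.smul_apply]
    rw [Finset.sum_comm]
    simp only [← Finset.smul_sum, ← Finset.sum_neg_distrib, h1]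
    rw [Finset.sum_comm]
    simp only [map_neg, smul_neg, Finset.smul_sum, Finset.sum_neg_distrib, smul_eq_mul, mul_neg,
      Finset.mul_sum]
  | mul a b ha hb =>
    rw [star_mul]
    simp only [mul_smul]
    have h1 := hb (B.compl₁₂ (clEnd S a) LinearMap.id)
    have h2 := ha (B.compl₁₂ LinearMap.id (clEnd S (star b)))
    simp only [LinearMap.compl₁₂_apply, LinearMap.id_apply, Algebra.lsmul_coe] at h1 h2
    rw [h1, h2]
  | add a b ha hb =>
    rw [star_add]
    simp only [add_smul, map_add, LinearMap.add_apply, Finset.sum_add_distrib, ha, hb]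

/-- The units i, j, k are skew with respect to ∑ t_j ⊗ t_j, and conjugation is the linear extension
of their change of sign. -/
theorem sum_quaternionSmul_left [Module ℍ[ℝ] S] [IsScalarTower ℝ ℍ[ℝ] S]
    (h : ∀ l ∈ ({unitI, unitJ, unitK} : Set ℍ[ℝ]), ∀ B : LinearMap.BilinForm ℝ S,
      ∑ j, B (l • t j) (l • t j) = ∑ j, B (t j) (t j))
    (l : ℍ[ℝ]) (B : LinearMap.BilinForm ℝ S) :
    ∑ j, B (l • t j) (t j) = ∑ j, B (t j) (star l • t j) := by
  have key : ∀ l ∈ ({unitI, unitJ, unitK} : Set ℍ[ℝ]), l * l = -1 →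
      ∑ j, B (l • t j) (t j) = ∑ j, B (t j) (-(l • t j)) := fun l hl hll =>
    sum_smul_eq_sum_neg (Algebra.lsmul ℝ ℝ S l : Module.End ℝ S) (fun s => by
      simp only [Algebra.lsmul_coe, smul_smul, hll, neg_smul, one_smul]) (h l hl) B
  have hi := key unitI (by simp) (by ext <;> simp)
  have hj := key unitJ (by simp) (by ext <;> simp)
  have hk := key unitK (by simp) (by ext <;> simp)
  have hs : star l = l.re • 1 - l.imI • unitI - l.imJ • unitJ - l.imK • unitK := by
    ext <;> simp
  rw [hs]
  conv_lhs => rw [eq_sum_units l]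
  simp only [map_neg, Finset.sum_neg_distrib] at hi hj hk
  simp only [add_smul, sub_smul, map_add, map_sub, LinearMap.add_apply, smul_assoc, map_smul,
    LinearMap.smul_apply, Finset.sum_add_distrib, Finset.sum_sub_distrib, ← Finset.smul_sum,
    one_smul, hi, hj, hk, smul_neg]
  abel

end Invariant

/-! ## Charts of the spinor bundle -/

section SpinorCharts

variable {X : Type*} [TopologicalSpace X] {V : X → Type*}
  [∀ x, AddCommGroup (V x)] [∀ x, Module ℝ (V x)] [TopologicalSpace (Tot V)] {n : ℕ}
  {g : EuclideanStructure V} {o : BundleOrientation V n} (𝔰 : SpinStructure g o)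
  (S : Type*) [AddCommGroup S] [Module ℝ S] [Module (Cl n) S] [IsScalarTower ℝ (Cl n) S]

/-- The isomorphism `S ≅ Σ_x`, `s ↦ [p, s]`. -/
def spinorEquiv {x : X} (p : 𝔰.P x) : S ≃ₗ[ℝ] Spinor 𝔰 S x where
  toFun s := Spinor.mk 𝔰 p s
  map_add' s t := Spinor.ext 𝔰 fun q => smul_add _ s t
  map_smul' r s := Spinor.ext 𝔰 fun q => smul_comm _ r s
  invFun f := f.1 p
  left_inv s := Spinor.mk_apply_self 𝔰 p s
  right_inv f := Spinor.mk_apply_eq 𝔰 p f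

variable {S}

theorem spinorEquiv_smul {x : X} (p : 𝔰.P x) (h : Spin n) (s : S) :
    spinorEquiv 𝔰 S (MulOpposite.op h • p) s = spinorEquiv 𝔰 S p (spinVal h • s) :=
  ((Spinor.mk_eq_mk_iff 𝔰 p _ _ s).2 ⟨h, rfl, rfl⟩).symm

theorem spinorAction_spinorEquiv {x : X} (p : 𝔰.P x) (a : Cl n) (s : S) :
    spinorAction 𝔰 S x (𝔰.clEquiv p a) (spinorEquiv 𝔰 S p s) = spinorEquiv 𝔰 S p (a • s) :=
  spinorAction_mk 𝔰 S p a s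

variable [TopologicalSpace S]

/-- A continuous local section of the principal bundle, for which `(x, s) ↦ [p x, s]` is a chart
of the spinor bundle. -/
structure IsSpinSection (S : Type*) [AddCommGroup S] [Module ℝ S] [Module (Cl n) S]
    [IsScalarTower ℝ (Cl n) S] [TopologicalSpace S] {U : Set X} (p : ∀ x : U, 𝔰.P x) : Prop where
  continuous_section : Continuous fun x : U => (⟨x, p x⟩ : Tot 𝔰.P)
  isChart : IsChart fun (x : U) (s : S) => spinorEquiv 𝔰 S (p x) s

variable {𝔰}

theorem IsSpinSection.restrict {U : Set X} {p : ∀ x : U, 𝔰.P x} (hp : IsSpinSection 𝔰 S p)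
    {W : Set X} (hW : IsOpen W) (h : W ⊆ U) :
    IsSpinSection 𝔰 S (fun x : W => p ⟨x, h x.2⟩) where
  continuous_section := hp.continuous_section.comp (continuous_inclusion h)
  isChart := hp.isChart.restrict hW h

variable [IsModuleTopology ℝ S] [Module.Finite ℝ S]

variable (n S) in
theorem continuous_cl_smul : Continuous fun p : Cl n × S => p.1 • p.2 :=
  IsModuleTopology.continuous_bilinear_of_finite_right (clEnd (n := n) S).toLinearMap

theorem continuous_spinVal : Continuous (spinVal : Spin n → Cl n) :=
  Units.continuous_val.comp continuous_subtype_val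

-- The section is the image of 1 in a local trivialization of P. The map (x, s) ↦ [p x, s] is open
-- because [p a, s] = [p, a s] and the spin group acts continuously on S.
variable (𝔰 S) in
theorem exists_isSpinSection (x₀ : X) :
    ∃ (U : Set X) (p : ∀ x : U, 𝔰.P x), IsOpen U ∧ x₀ ∈ U ∧ IsSpinSection 𝔰 S p := by
  obtain ⟨U, hU, hx, Φ, hΦ, hemb⟩ := 𝔰.principal.locally_trivial x₀
  refine ⟨U, fun x => Φ x 1, hU, hx, ?_, ?_⟩
  · exact hemb.continuous.comp (continuous_id.prodMk continuous_const)
  · let π : Tot 𝔰.P × S → Tot (Spinor 𝔰 S) := fun p => ⟨p.1.base, Spinor.mk 𝔰 p.1.fib p.2⟩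
    have hπ : Continuous π := continuous_coinduced_rng
    have hmk : ∀ (x : U) (a : Spin n) (s : S),
        Spinor.mk 𝔰 (Φ x a) s = Spinor.mk 𝔰 (Φ x 1) (spinVal a • s) := fun x a s => by
      have : Φ x a = MulOpposite.op a • Φ x 1 := by rw [← hΦ, one_mul]
      rw [this]
      exact spinorEquiv_smul 𝔰 (Φ x 1) a s
    refine Topology.IsOpenEmbedding.of_continuous_injective_isOpenMap ?_ ?_ ?_
    · exact hπ.comp ((hemb.continuous.comp (continuous_fst.prodMk continuous_const)).prodMk
        continuous_snd)
    · rintro ⟨⟨x, hx⟩, s⟩ ⟨⟨y, hy⟩, t⟩ h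
      obtain rfl : x = y := congrArg Tot.base h
      obtain rfl : s = t := (spinorEquiv 𝔰 S (Φ ⟨x, hx⟩ 1)).injective (Tot.ext_iff.1 h)
      rfl
    · intro W hW
      have h1 := hemb.prodMap (Topology.IsOpenEmbedding.id (X := S))
      -- Upstairs in P × S, the preimage of the image of W is the image of m⁻¹(W).
      let m : (U × Spin n) × S → U × S := fun q => (q.1.1, spinVal q.1.2 • q.2)
      have hm : Continuous m := (continuous_fst.comp continuous_fst).prodMk
        ((continuous_cl_smul n S).comp
          ((continuous_spinVal.comp (continuous_snd.comp continuous_fst)).prodMk continuous_snd))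
      rw [isOpen_coinduced]
      convert! h1.isOpenMap _ (hW.preimage hm) using 1
      ext ⟨⟨x, q⟩, s⟩
      constructor
      · rintro ⟨⟨⟨y, hy⟩, t⟩, ht, h⟩
        obtain rfl : y = x := congrArg Tot.base h
        obtain ⟨a, rfl⟩ := (Φ ⟨y, hy⟩).surjective q
        refine ⟨((⟨y, hy⟩, a), s), ?_, rfl⟩
        have h2 : Spinor.mk 𝔰 (Φ ⟨y, hy⟩ 1) t = Spinor.mk 𝔰 (Φ ⟨y, hy⟩ a) s := Tot.ext_iff.1 h
        rw [hmk _ a s] at h2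
        obtain rfl := (spinorEquiv 𝔰 S (Φ ⟨y, hy⟩ 1)).injective h2
        exact ht
      · rintro ⟨⟨⟨⟨y, hy⟩, a⟩, t⟩, ht, h⟩
        obtain ⟨h2, rfl⟩ := Prod.ext_iff.1 h
        obtain rfl : y = x := congrArg Tot.base h2
        obtain rfl : Φ ⟨y, hy⟩ a = q := Tot.ext_iff.1 h2
        exact ⟨_, ht, Tot.ext_iff.2 (hmk _ a t).symm⟩

end SpinorCharts

/-! ## Charts of Clifford module bundles -/

section ModuleCharts

variable {X : Type*} [TopologicalSpace X] {V : X → Type*}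
  [∀ x, AddCommGroup (V x)] [∀ x, Module ℝ (V x)] [TopologicalSpace (Tot V)] {n : ℕ}
  {g : EuclideanStructure V} {o : BundleOrientation V n} (𝔰 : SpinStructure g o)

/-- The vectors of the frame that belongs to a point of the principal bundle. -/
def frameVec {x : X} (p : 𝔰.P x) (i : Fin n) : V x := (𝔰.frame x p).1 (Pi.single i 1)

theorem clEquiv_ι {x : X} (p : 𝔰.P x) (i : Fin n) :
    𝔰.clEquiv p (CliffordAlgebra.ι (stdForm n) (Pi.single i 1)) =
      CliffordAlgebra.ι (negForm g x) (frameVec 𝔰 p i) := by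
  simp [SpinStructure.clEquiv, CliffordAlgebra.equivOfIsometry, frameVec]

theorem continuous_frameVec {U : Set X} {p : ∀ x : U, 𝔰.P x}
    (hp : Continuous fun x : U => (⟨x, p x⟩ : Tot 𝔰.P)) (i : Fin n) :
    Continuous fun x : U => (⟨x, frameVec 𝔰 (p x) i⟩ : Tot V) := by
  have h1 : Continuous (Tot.map 𝔰.frame) := 𝔰.isCoveringMap.continuous
  have h2 : Continuous fun b : Tot (OrFrame g o) =>
      (b.base, fun i : Fin n => (⟨b.base, b.fib.1 (Pi.single i 1)⟩ : Tot V)) :=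
    continuous_induced_dom
  exact (continuous_apply i).comp (continuous_snd.comp (h2.comp (h1.comp hp)))

/-- A continuous family of bijections with continuous inverses is a homeomorphism of U × F' with U ×
F over U. -/
theorem IsChart.comp_family {X : Type*} [TopologicalSpace X] {E : X → Type*}
    [TopologicalSpace (Tot E)] {F F' : Type*} [TopologicalSpace F] [TopologicalSpace F'] {U : Set X}
    {e : ∀ x : U, F → E x} (he : IsChart e) (h : ∀ _ : U, F' ≃ F)
    (h₁ : Continuous fun p : U × F' => h p.1 p.2)
    (h₂ : Continuous fun p : U × F => (h p.1).symm p.2) :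
    IsChart fun (x : U) (v : F') => e x (h x v) := by
  let H : U × F' ≃ₜ U × F :=
    { toFun := fun p => (p.1, h p.1 p.2)
      invFun := fun p => (p.1, (h p.1).symm p.2)
      left_inv := fun p => by simp
      right_inv := fun p => by simp
      continuous_toFun := continuous_fst.prodMk h₁
      continuous_invFun := continuous_fst.prodMk h₂ }
  exact Topology.IsOpenEmbedding.comp he H.isOpenEmbedding

/-- Maps that commute with the generators are linear over the Clifford algebra. -/
theorem clLinear_of_generators {W N : Type*} [AddCommGroup W] [Module ℝ W] [AddCommGroup N]
    [Module ℝ N] (α : Cl n →ₐ[ℝ] Module.End ℝ W) (β : Cl n →ₐ[ℝ] Module.End ℝ N) (φ : W →ₗ[ℝ] N)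
    (h : ∀ i w, φ (α (CliffordAlgebra.ι (stdForm n) (Pi.single i 1)) w) =
      β (CliffordAlgebra.ι (stdForm n) (Pi.single i 1)) (φ w)) (a : Cl n) (w : W) :
    φ (α a w) = β a (φ w) := by
  induction a using CliffordAlgebra.induction generalizing w with
  | algebraMap r => simp
  | ι v =>
    have hv : v = ∑ i, v i • Pi.single i (1 : ℝ) := by
      ext k
      simp [Finset.sum_apply, Pi.single_apply]
    rw [hv]
    simp only [map_sum, map_smul, LinearMap.sum_apply, LinearMap.smul_apply, h]
  | mul a b ha hb => rw [map_mul, map_mul, Module.End.mul_apply, Module.End.mul_apply, ha, hb]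
  | add a b ha hb => rw [map_add, map_add, LinearMap.add_apply, LinearMap.add_apply, map_add, ha, hb]

variable (S : Type*) [AddCommGroup S] [Module ℝ S] [Module (Cl n) S] [IsScalarTower ℝ (Cl n) S]
  [TopologicalSpace S] {L : X → Type*} [∀ x, AddCommGroup (L x)] [∀ x, Module ℝ (L x)]
  [TopologicalSpace (Tot L)]

/-- A local `Cl(V)`-linear isomorphism of `Σ ⊕ ⋯ ⊕ Σ` with a module bundle `L`, written in terms
of a local section of the principal bundle. -/
structure ModuleChart (μ : ClAction g L) where
  U : Set X
  isOpen : IsOpen U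
  p : ∀ x : U, 𝔰.P x
  isSpinSection : IsSpinSection 𝔰 S p
  k : ℕ
  Ψ : ∀ x : U, (Fin k → S) ≃ₗ[ℝ] L x
  isChart : IsChart fun (x : U) (s : Fin k → S) => Ψ x s
  equivariant : ∀ x (a : Cl n) (s : Fin k → S), Ψ x (a • s) = μ x (𝔰.clEquiv (p x) a) (Ψ x s)

theorem continuous_generator {c : ClModuleBundle g L} {U : Set X} {p : ∀ x : U, 𝔰.P x}
    (hp : Continuous fun x : U => (⟨x, p x⟩ : Tot 𝔰.P)) {r : ℕ}
    (e : ∀ x : U, (Fin r → ℝ) ≃ₗ[ℝ] L x) (he : IsChart fun x v => e x v) (i : Fin n) :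
    Continuous fun q : U × (Fin r → ℝ) => (e q.1).symm
      (c.μ q.1 (CliffordAlgebra.ι (negForm g q.1) (frameVec 𝔰 (p q.1) i)) (e q.1 q.2)) := by
  refine (he.continuous_iff (b := Prod.fst) (s := fun q : U × (Fin r → ℝ) => (e q.1).symm
      (c.μ q.1 (CliffordAlgebra.ι (negForm g q.1) (frameVec 𝔰 (p q.1) i)) (e q.1 q.2)))).1 ?_ |>.2
  simp only [LinearEquiv.apply_symm_apply]
  have h1 : Continuous fun q : U × (Fin r → ℝ) =>
      (⟨q.1, frameVec 𝔰 (p q.1) i, e q.1 q.2⟩ : FibProd V L) :=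
    continuous_fibProd_iff.2
      ⟨(continuous_frameVec 𝔰 hp i).comp continuous_fst, he.continuous⟩
  exact c.continuous_μ.comp h1

variable {S} [IsModuleTopology ℝ S] [Module.Finite ℝ S] [IsSimpleModule (Cl n) S]

/-- Rigidity of modules over a matrix algebra: the module structure at x₀ propagates to nearby
fibres, because averaging makes any nearby linear identification Clifford linear. -/
theorem exists_moduleChart {K : Type*} [DivisionRing K] [Algebra ℝ K] [Module.Finite ℝ K]
    (hA : IsMatrixAlgebra K (Cl n)) [IsVectorBundle ℝ L] (c : ClModuleBundle g L) (x₀ : X) :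
    ∃ C : ModuleChart 𝔰 S c.μ, x₀ ∈ C.U := by
  obtain ⟨U₁, p₁, hU₁, hx₁, hp₁⟩ := exists_isSpinSection 𝔰 S x₀
  obtain ⟨r, e₁, hx₂⟩ := IsVectorBundle.exists_localTriv (K := ℝ) (E := L) x₀
  obtain ⟨U, hU, hx₀, p, hp, e, he⟩ : ∃ (U : Set X) (_ : IsOpen U) (_ : x₀ ∈ U)
      (p : ∀ x : U, 𝔰.P x) (_ : IsSpinSection 𝔰 S p) (e : ∀ x : U, (Fin r → ℝ) ≃ₗ[ℝ] L x),
      IsChart fun x v => e x v :=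
    ⟨U₁ ∩ e₁.baseSet, hU₁.inter e₁.isOpen_baseSet, ⟨hx₁, hx₂⟩, _,
      hp₁.restrict (hU₁.inter e₁.isOpen_baseSet) Set.inter_subset_left, _,
      e₁.isChart.restrict (hU₁.inter e₁.isOpen_baseSet) Set.inter_subset_right⟩
  have : Module.Finite ℝ (L x₀) := Module.Finite.equiv (e ⟨x₀, hx₀⟩)
  -- Only the fibre over x₀ is classified. Its isomorphism with Sᵏ, read in the trivialization e, is
  -- the constant family from which the averaging starts.
  obtain ⟨k, Ψ₀, hΨ₀⟩ := hA.exists_linearEquiv_pi S (L x₀)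
    ((c.μ x₀).comp (𝔰.clEquiv (p ⟨x₀, hx₀⟩)).toAlgHom)
  let gen : Fin n → Cl n := fun i => CliffordAlgebra.ι (stdForm n) (Pi.single i 1)
  let A : U → Cl n →ₐ[ℝ] Module.End ℝ (Fin r → ℝ) := fun x =>
    ((e x).symm.conjAlgEquiv ℝ).toAlgHom.comp ((c.μ x).comp (𝔰.clEquiv (p x)).toAlgHom)
  have hA_apply : ∀ x a v, A x a v = (e x).symm (c.μ x (𝔰.clEquiv (p x) a) (e x v)) :=
    fun x a v => rfl
  have hgen_sq : ∀ i, gen i * gen i = -1 := fun i => by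
    rw [ι_single_sq (-1) i, neg_smul, one_smul]
  have hgen_anti : ∀ i j, i ≠ j → gen i * gen j = -(gen j * gen i) := fun i j hij =>
    ι_single_anticomm (-1) hij
  have := IsModuleTopology.toContinuousAdd ℝ S
  obtain ⟨φ, hφ, hφ_comm, hφ₀⟩ := exists_intertwining_family
    (fun i => clEnd (Fin k → S) (gen i)) (fun x i => A x (gen i))
    (fun i => IsModuleTopology.continuous_of_linearMap (R := ℝ) (clEnd (Fin k → S) (gen i)))
    (fun i => by
      simp only [hA_apply, gen, clEquiv_ι]
      exact continuous_generator 𝔰 hp.continuous_section e he i)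
    (fun i w => by
      simp only [Algebra.lsmul_coe, smul_smul, hgen_sq, neg_smul, one_smul])
    (fun i j hij w => by
      simp only [Algebra.lsmul_coe, smul_smul]
      rw [hgen_anti i j hij, neg_smul])
    (fun x i v => by
      rw [← Module.End.mul_apply, ← map_mul, hgen_sq, map_neg, map_one]; rfl)
    (fun x i j hij v => by
      rw [← Module.End.mul_apply, ← map_mul, hgen_anti i j hij, map_neg, map_mul]; rfl)
    ⟨x₀, hx₀⟩ ((e ⟨x₀, hx₀⟩).symm.toLinearMap.comp Ψ₀.toLinearMap)
    (IsModuleTopology.continuous_of_linearMap (R := ℝ) _)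
    (fun i w => by
      rw [hA_apply]
      change (e ⟨x₀, hx₀⟩).symm (Ψ₀ (gen i • w)) = (e ⟨x₀, hx₀⟩).symm (c.μ x₀ _
        (e ⟨x₀, hx₀⟩ ((e ⟨x₀, hx₀⟩).symm (Ψ₀ w))))
      rw [LinearEquiv.apply_symm_apply, hΨ₀]
      rfl)
  obtain ⟨U', hU', hsub, Ψ, hx₀', hΨ, hΨ_symm⟩ := exists_continuous_inverse hU φ hφ ⟨x₀, hx₀⟩
    (by rw [hφ₀]; exact ((e ⟨x₀, hx₀⟩).symm.bijective).comp Ψ₀.bijective)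
  have hp' := hp.restrict hU' hsub
  have he' := he.restrict hU' hsub
  have hΨ_cont : Continuous fun q : U' × (Fin k → S) => Ψ q.1 q.2 := by
    simp only [hΨ]
    exact hφ.comp (((continuous_inclusion hsub).comp continuous_fst).prodMk continuous_snd)
  refine ⟨⟨U', hU', fun x => p ⟨x, hsub x.2⟩, hp', k, fun x => (Ψ x).trans (e ⟨x, hsub x.2⟩),
    he'.comp_family (fun x => (Ψ x).toEquiv) hΨ_cont hΨ_symm, fun x a s => ?_⟩, hx₀'⟩
  -- Averaging yields compatibility with the generators only; this extends it to the whole algebra.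
  have h1 := clLinear_of_generators (clEnd (Fin k → S)) (A ⟨x, hsub x.2⟩) (φ ⟨x, hsub x.2⟩)
    (fun i w => hφ_comm ⟨x, hsub x.2⟩ i w) a s
  change e ⟨x, hsub x.2⟩ (Ψ x (a • s)) = c.μ x (𝔰.clEquiv (p ⟨x, hsub x.2⟩) a)
    (e ⟨x, hsub x.2⟩ (Ψ x s))
  rw [hΨ, hΨ, ← LinearEquiv.eq_symm_apply]
  exact h1

end ModuleCharts

/-! ## Charts of tensor products -/

section TensorCharts

variable {X : Type*} [TopologicalSpace X] {E F : X → Type*}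
  [∀ x, AddCommGroup (E x)] [∀ x, Module ℝ (E x)] [∀ x, AddCommGroup (F x)] [∀ x, Module ℝ (F x)]

/-- Linear maps on `E_x ⊗ F_x` from bilinear maps. -/
def tensorLift {x : X} {W : Type*} [AddCommGroup W] [Module ℝ W] (B : E x →ₗ[ℝ] F x →ₗ[ℝ] W) :
    TensorBundle E F x →ₗ[ℝ] W :=
  TensorProduct.lift B

theorem tensorLift_tmul {x : X} {W : Type*} [AddCommGroup W] [Module ℝ W]
    (B : E x →ₗ[ℝ] F x →ₗ[ℝ] W) (v : E x) (w : F x) :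
    tensorLift B (TensorBundle.tmul E F v w) = B v w := rfl

variable (E F) in
/-- The tensor product as a bilinear map. -/
def tensorMk (x : X) : E x →ₗ[ℝ] F x →ₗ[ℝ] TensorBundle E F x := TensorProduct.mk ℝ (E x) (F x)

theorem tensorMk_apply {x : X} (v : E x) (w : F x) :
    tensorMk E F x v w = TensorBundle.tmul E F v w := rfl

theorem tensorBundle_hom_ext {x : X} {W : Type*} [AddCommGroup W] [Module ℝ W]
    {f h : TensorBundle E F x →ₗ[ℝ] W}
    (hfh : ∀ v w, f (TensorBundle.tmul E F v w) = h (TensorBundle.tmul E F v w)) : f = h :=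
  TensorProduct.ext' (R := ℝ) (M := E x) (N := F x) hfh

/-- The isomorphism `M_{k,l}(ℝ) ≅ E_x ⊗ F_x` that belongs to bases of `E_x` and `F_x`. -/
def tensorCoord {x : X} {k l : ℕ} (e : (Fin k → ℝ) ≃ₗ[ℝ] E x) (f : (Fin l → ℝ) ≃ₗ[ℝ] F x) :
    (Fin k → Fin l → ℝ) ≃ₗ[ℝ] TensorBundle E F x :=
  (LinearEquiv.curry ℝ ℝ (Fin k) (Fin l)).symm.trans
    ((Module.Basis.ofEquivFun e.symm).tensorProduct (Module.Basis.ofEquivFun f.symm)).equivFun.symm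

theorem tensorCoord_apply {x : X} {k l : ℕ} (e : (Fin k → ℝ) ≃ₗ[ℝ] E x)
    (f : (Fin l → ℝ) ≃ₗ[ℝ] F x) (c : Fin k → Fin l → ℝ) : tensorCoord e f c =
      ∑ i, ∑ j, c i j • TensorBundle.tmul E F (e (Pi.single i 1)) (f (Pi.single j 1)) := by
  change ((Module.Basis.ofEquivFun e.symm).tensorProduct
    (Module.Basis.ofEquivFun f.symm)).equivFun.symm (Function.uncurry c) = _
  rw [Module.Basis.equivFun_symm_apply, Fintype.sum_prod_type]
  refine Finset.sum_congr rfl fun i _ => Finset.sum_congr rfl fun j _ => ?_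
  rw [Module.Basis.tensorProduct_apply]
  simp only [Module.Basis.coe_ofEquivFun, LinearEquiv.symm_symm, Function.uncurry]
  rfl

theorem tensorCoord_symm_tmul {x : X} {k l : ℕ} (e : (Fin k → ℝ) ≃ₗ[ℝ] E x)
    (f : (Fin l → ℝ) ≃ₗ[ℝ] F x) (v : E x) (w : F x) :
    (tensorCoord e f).symm (TensorBundle.tmul E F v w) = fun i j => e.symm v i * f.symm w j := by
  rw [LinearEquiv.symm_apply_eq, tensorCoord_apply]
  have hv : v = ∑ i, e.symm v i • e (Pi.single i 1) := by
    conv_lhs => rw [← e.apply_symm_apply v, pi_eq_sum_univ' (e.symm v), map_sum]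
    simp [← Pi.single_apply]
  have hw : w = ∑ j, f.symm w j • f (Pi.single j 1) := by
    conv_lhs => rw [← f.apply_symm_apply w, pi_eq_sum_univ' (f.symm w), map_sum]
    simp [← Pi.single_apply]
  rw [← tensorMk_apply]
  conv_lhs => rw [hv, hw]
  simp only [map_sum, map_smul, LinearMap.sum_apply, LinearMap.smul_apply, Finset.smul_sum,
    mul_smul, tensorMk_apply]
  rw [Finset.sum_comm]
  refine Finset.sum_congr rfl fun i _ => Finset.sum_congr rfl fun j _ => ?_
  rw [smul_comm]

variable [TopologicalSpace (Tot E)] [TopologicalSpace (Tot F)]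

theorem continuous_coordChange {K : Type*} [Ring K] [TopologicalSpace K] {E : X → Type*}
    [∀ x, AddCommGroup (E x)] [∀ x, Module K (E x)] [TopologicalSpace (Tot E)] {k k' : ℕ}
    (e : LocalTriv K E k) (e' : LocalTriv K E k') {Y : Type*} [TopologicalSpace Y] (b : Y → X)
    (hb : Continuous b) (h : ∀ y, b y ∈ e.baseSet) (h' : ∀ y, b y ∈ e'.baseSet)
    (v : Fin k' → K) :
    Continuous fun y => (e.equiv ⟨b y, h y⟩).symm (e'.equiv ⟨b y, h' y⟩ v) := by
  refine (e.isChart.continuous_iff (b := fun y => ⟨b y, h y⟩)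
    (s := fun y => (e.equiv ⟨b y, h y⟩).symm (e'.equiv ⟨b y, h' y⟩ v))).1 ?_ |>.2
  simp only [LinearEquiv.apply_symm_apply]
  exact (e'.isChart.continuous_iff (b := fun y => ⟨b y, h' y⟩) (s := fun _ => v)).2
    ⟨hb.subtype_mk _, continuous_const⟩

/-- The topology of E ⊗ F is the finest one for which all these charts are continuous, so the gluing
lemma reduces the claim to continuous changes of coordinates. -/
theorem tensor_isChart {k l : ℕ} (e : LocalTriv ℝ E k) (f : LocalTriv ℝ F l) :
    IsChart fun (x : (e.baseSet ∩ f.baseSet : Set X)) c =>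
      tensorCoord (e.equiv ⟨x, x.2.1⟩) (f.equiv ⟨x, x.2.2⟩) c := by
  let ι := Σ (k : ℕ) (l : ℕ), LocalTriv ℝ E k × LocalTriv ℝ F l
  refine isChart_of_glue (ι := ι) (U := fun i => i.2.2.1.baseSet ∩ i.2.2.2.baseSet)
    (F := fun i => Fin i.1 → Fin i.2.1 → ℝ)
    (fun i => i.2.2.1.isOpen_baseSet.inter i.2.2.2.isOpen_baseSet)
    (fun i x => (tensorCoord (i.2.2.1.equiv ⟨x, x.2.1⟩) (i.2.2.2.equiv ⟨x, x.2.2⟩)).toEquiv)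
    (fun O => ?_) (fun i j => ?_) ⟨k, l, e, f⟩
  · have h : ∀ (k l : ℕ) (e : LocalTriv ℝ E k) (f : LocalTriv ℝ F l), tensorChart e f =
        fun p => ⟨p.1, tensorCoord (e.equiv ⟨p.1, p.1.2.1⟩) (f.equiv ⟨p.1, p.1.2.2⟩) p.2⟩ := by
      intro k l e f
      funext p
      rw [tensorCoord_apply]
      rfl
    constructor
    · rintro hO ⟨k, l, e, f⟩
      have h1 := isOpen_coinduced.1 (isOpen_iSup_iff.1 (isOpen_iSup_iff.1 (isOpen_iSup_iff.1
        (isOpen_iSup_iff.1 hO k) l) e) f)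
      rw [h] at h1
      exact h1
    · intro hO
      refine isOpen_iSup_iff.2 fun k => isOpen_iSup_iff.2 fun l => isOpen_iSup_iff.2 fun e =>
        isOpen_iSup_iff.2 fun f => isOpen_coinduced.2 ?_
      rw [h]
      exact hO ⟨k, l, e, f⟩
  · obtain ⟨k, l, e, f⟩ := i
    obtain ⟨k', l', e', f'⟩ := j
    let Y : Set X := (e.baseSet ∩ f.baseSet) ∩ (e'.baseSet ∩ f'.baseSet)
    -- The change of coordinates is the tensor product of those of E and F. Expanding c in matrix
    -- units leaves finitely many coefficients, each a product of continuous functions.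
    have h1 : ∀ (x : Y) (c : Fin k' → Fin l' → ℝ),
        (tensorCoord (e.equiv ⟨x, x.2.1.1⟩) (f.equiv ⟨x, x.2.1.2⟩)).symm
          (tensorCoord (e'.equiv ⟨x, x.2.2.1⟩) (f'.equiv ⟨x, x.2.2.2⟩) c) =
        ∑ i, ∑ j, c i j • fun a b =>
          (e.equiv ⟨x, x.2.1.1⟩).symm (e'.equiv ⟨x, x.2.2.1⟩ (Pi.single i 1)) a *
          (f.equiv ⟨x, x.2.1.2⟩).symm (f'.equiv ⟨x, x.2.2.2⟩ (Pi.single j 1)) b := by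
      intro x c
      rw [tensorCoord_apply (e'.equiv _)]
      simp only [map_sum, map_smul, tensorCoord_symm_tmul]
    change Continuous fun p : Y × (Fin k' → Fin l' → ℝ) =>
      (tensorCoord (e.equiv ⟨p.1, p.1.2.1.1⟩) (f.equiv ⟨p.1, p.1.2.1.2⟩)).symm
        (tensorCoord (e'.equiv ⟨p.1, p.1.2.2.1⟩) (f'.equiv ⟨p.1, p.1.2.2.2⟩) p.2)
    simp only [h1]
    refine continuous_finsetSum _ fun i _ => continuous_finsetSum _ fun j _ => ?_
    have h2 : Continuous fun p : Y × (Fin k' → Fin l' → ℝ) => p.2 i j := by fun_prop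
    refine h2.smul (continuous_pi fun a => continuous_pi fun b => ?_)
    have h3 := (continuous_coordChange e e' (fun y : Y => (y : X)) continuous_subtype_val
      (fun y => y.2.1.1) (fun y => y.2.2.1) (Pi.single i 1)).comp
      (continuous_fst (Y := Fin k' → Fin l' → ℝ))
    have h4 := (continuous_coordChange f f' (fun y : Y => (y : X)) continuous_subtype_val
      (fun y => y.2.1.2) (fun y => y.2.2.2) (Pi.single j 1)).comp
      (continuous_fst (Y := Fin k' → Fin l' → ℝ))
    exact ((continuous_apply a).comp h3).mul ((continuous_apply b).comp h4)

end TensorCharts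

/-! ## Twisted spinor bundles -/

section TwistedProduct

variable {X : Type*} [TopologicalSpace X] {V : X → Type*}
  [∀ x, AddCommGroup (V x)] [∀ x, Module ℝ (V x)] [TopologicalSpace (Tot V)] {n : ℕ}
  {g : EuclideanStructure V} {o : BundleOrientation V n} {𝔰 : SpinStructure g o}
  {S : Type*} [AddCommGroup S] [Module ℝ S] [Module (Cl n) S] [IsScalarTower ℝ (Cl n) S]
  [TopologicalSpace S]

/-- `T` is the bundle `E ⊗_K Σ`, with the bilinear map `tm` and the Clifford action `act`. A local
frame of `E` and a local section of the principal bundle give a chart of `T`. -/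
structure IsTwistedProduct {K : Type*} [Ring K] [TopologicalSpace K] [Algebra ℝ K]
    (C : Commutant (Cl n) K S) {E T : X → Type*} [∀ x, AddCommGroup (E x)] [∀ x, Module ℝ (E x)]
    [∀ x, Module K (E x)] [TopologicalSpace (Tot E)] [∀ x, AddCommGroup (T x)]
    [∀ x, Module ℝ (T x)] [TopologicalSpace (Tot T)]
    (tm : ∀ x, E x →ₗ[ℝ] Spinor 𝔰 S x →ₗ[ℝ] T x) (act : ClAction g T) : Prop where
  act_tm : ∀ x a v ξ, act x a (tm x v ξ) = tm x v (spinorAction 𝔰 S x a ξ)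
  balanced : ∀ x c v (p : 𝔰.P x) s,
    tm x (c • v) (spinorEquiv 𝔰 S p s) = tm x v (spinorEquiv 𝔰 S p (C.ρ c s))
  exists_chart : ∀ (U : Set X) (_ : IsOpen U) (k : ℕ) (e : ∀ x : U, (Fin k → K) ≃ₗ[K] E x)
    (_ : IsChart fun x v => e x v) (p : ∀ x : U, 𝔰.P x) (_ : IsSpinSection 𝔰 S p),
    ∃ θ : ∀ x : U, (Fin k → S) ≃ₗ[ℝ] T x,
      (∀ x s, θ x s = ∑ i, tm x (e x (Pi.single i 1)) (spinorEquiv 𝔰 S (p x) (s i))) ∧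
      IsChart fun x s => θ x s

variable [IsModuleTopology ℝ S] [Module.Finite ℝ S]

/-- Coordinates on a finite dimensional space with its canonical topology. -/
def moduleCoord (W : Type*) [AddCommGroup W] [Module ℝ W] [TopologicalSpace W]
    [IsModuleTopology ℝ W] [Module.Finite ℝ W] : (Fin (Module.finrank ℝ W) → ℝ) ≃L[ℝ] W where
  toLinearEquiv := (Module.finBasis ℝ W).equivFun.symm
  continuous_toFun := by
    have := IsModuleTopology.toContinuousAdd ℝ W
    exact IsModuleTopology.continuous_of_linearMap (R := ℝ)
      (Module.finBasis ℝ W).equivFun.symm.toLinearMap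
  continuous_invFun := IsModuleTopology.continuous_of_linearMap (R := ℝ)
      (Module.finBasis ℝ W).equivFun.toLinearMap

/-- After S is identified with ℝᴺ, a k × N matrix is a k-tuple of elements of S, and the matrix
chart of E ⊗ Σ takes the form s ↦ ∑ e_i ⊗ [p, s_i]. -/
theorem tensorBundle_exists_chart {E : X → Type*} [∀ x, AddCommGroup (E x)] [∀ x, Module ℝ (E x)]
    [TopologicalSpace (Tot E)] (U : Set X) (hU : IsOpen U) (k : ℕ)
    (e : ∀ x : U, (Fin k → ℝ) ≃ₗ[ℝ] E x) (he : IsChart fun x v => e x v) (p : ∀ x : U, 𝔰.P x)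
    (hp : IsSpinSection 𝔰 S p) :
    ∃ θ : ∀ x : U, (Fin k → S) ≃ₗ[ℝ] TensorBundle E (Spinor 𝔰 S) x,
      (∀ x s, θ x s = ∑ i, tensorMk E (Spinor 𝔰 S) x (e x (Pi.single i 1))
        (spinorEquiv 𝔰 S (p x) (s i))) ∧ IsChart fun x s => θ x s := by
  let h := moduleCoord S
  let e' : LocalTriv ℝ E k := ⟨U, hU, e, he⟩
  let f' : LocalTriv ℝ (Spinor 𝔰 S) (Module.finrank ℝ S) :=
    ⟨U, hU, fun x => h.toLinearEquiv.trans (spinorEquiv 𝔰 S (p x)),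
      hp.isChart.comp_homeomorph h.toHomeomorph⟩
  have h1 : IsChart fun (x : U) c => tensorCoord (e x) (f'.equiv x) c :=
    (tensor_isChart e' f').restrict hU fun x hx => ⟨hx, hx⟩
  let H : (Fin k → S) ≃ₗ[ℝ] (Fin k → Fin (Module.finrank ℝ S) → ℝ) :=
    LinearEquiv.piCongrRight fun _ => h.symm.toLinearEquiv
  let H' : (Fin k → S) ≃ₜ (Fin k → Fin (Module.finrank ℝ S) → ℝ) :=
    Homeomorph.piCongrRight fun _ => h.symm.toHomeomorph
  refine ⟨fun x => H.trans (tensorCoord (e x) (f'.equiv x)), fun x s => ?_,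
    h1.comp_homeomorph H'⟩
  change tensorCoord (e x) (f'.equiv x) (H s) = _
  rw [tensorCoord_apply]
  refine Finset.sum_congr rfl fun i _ => ?_
  have h2 : s i = ∑ j, H s i j • h (Pi.single j 1) := by
    have h3 : H s i = ∑ j, H s i j • (Pi.single j 1 : Fin (Module.finrank ℝ S) → ℝ) := by
      ext a
      simp [Finset.sum_apply, Pi.single_apply]
    have h4 : h (H s i) = s i := h.apply_symm_apply (s i)
    rw [← h4, h3, map_sum]
    simp only [map_smul]
    rw [← h3]
  conv_rhs => rw [h2]
  simp only [map_sum, map_smul]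
  rfl

theorem isTwistedProduct_tensorBundle (C : Commutant (Cl n) ℝ S) (hC : ∀ (c : ℝ) s, C.ρ c s = c • s)
    {E : X → Type*} [∀ x, AddCommGroup (E x)] [∀ x, Module ℝ (E x)] [TopologicalSpace (Tot E)] :
    IsTwistedProduct C (tensorMk E (Spinor 𝔰 S)) (twistedAction 𝔰 S E) where
  act_tm x a v ξ := twistedAction_tmul 𝔰 S E a v ξ
  balanced x c v p s := by
    rw [hC, map_smul, map_smul, map_smul, LinearMap.smul_apply]
  exists_chart U hU k e he p hp := tensorBundle_exists_chart U hU k e he p hp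

end TwistedProduct

/-! ## Charts of quaternionic tensor products -/

instance : Module.Finite ℝ ℍ[ℝ]ᵐᵒᵖ := Module.Finite.equiv (MulOpposite.opLinearEquiv ℝ)

instance : IsModuleTopology ℝ ℍ[ℝ]ᵐᵒᵖ := isModuleTopologyOfFiniteDimensional

section HTensorFibre

variable {X : Type*} [TopologicalSpace X] {E F : X → Type*}
  [∀ x, AddCommGroup (E x)] [∀ x, Module ℝ (E x)] [∀ x, AddCommGroup (F x)] [∀ x, Module ℝ (F x)]
  [∀ x, Module ℍ[ℝ]ᵐᵒᵖ (E x)] [∀ x, Module ℍ[ℝ] (F x)]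

variable (E F) in
/-- The tensor product over `ℍ` as an `ℝ`-bilinear map. -/
def hTensorMk (x : X) : E x →ₗ[ℝ] F x →ₗ[ℝ] HTensorBundle E F x :=
  (tensorMk E F x).compr₂ (HTensorBundle.proj E F x)

theorem hTensorMk_smul {x : X} (l : ℍ[ℝ]) (v : E x) (w : F x) :
    hTensorMk E F x (MulOpposite.op l • v) w = hTensorMk E F x v (l • w) :=
  (Submodule.Quotient.eq (hRel E F x)).2 (Submodule.subset_span ⟨v, l, w, rfl⟩)

/-- Linear maps on `E_x ⊗_ℍ F_x` from balanced bilinear maps. -/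
def hTensorLift {x : X} {W : Type*} [AddCommGroup W] [Module ℝ W] (B : E x →ₗ[ℝ] F x →ₗ[ℝ] W)
    (hB : ∀ (l : ℍ[ℝ]) v w, B (MulOpposite.op l • v) w = B v (l • w)) :
    HTensorBundle E F x →ₗ[ℝ] W :=
  (hRel E F x).liftQ (tensorLift B) (Submodule.span_le.2 (by
    rintro _ ⟨v, l, w, rfl⟩
    change tensorLift B (_ - _) = 0
    rw [map_sub, tensorLift_tmul, tensorLift_tmul, hB, sub_self]))

theorem hTensorLift_tmul {x : X} {W : Type*} [AddCommGroup W] [Module ℝ W]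
    (B : E x →ₗ[ℝ] F x →ₗ[ℝ] W)
    (hB : ∀ (l : ℍ[ℝ]) v w, B (MulOpposite.op l • v) w = B v (l • w)) (v : E x) (w : F x) :
    hTensorLift B hB (hTensorMk E F x v w) = B v w := rfl

theorem hTensorBundle_hom_ext {x : X} {W : Type*} [AddCommGroup W] [Module ℝ W]
    {f h : HTensorBundle E F x →ₗ[ℝ] W}
    (hfh : ∀ v w, f (hTensorMk E F x v w) = h (hTensorMk E F x v w)) : f = h := by
  have h1 : f.comp (HTensorBundle.proj E F x) = h.comp (HTensorBundle.proj E F x) :=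
    tensorBundle_hom_ext hfh
  refine LinearMap.ext fun t => ?_
  obtain ⟨t, rfl⟩ := (hRel E F x).mkQ_surjective t
  exact LinearMap.congr_fun h1 t

end HTensorFibre

section HTwistedProduct

variable {X : Type*} [TopologicalSpace X] {V : X → Type*}
  [∀ x, AddCommGroup (V x)] [∀ x, Module ℝ (V x)] [TopologicalSpace (Tot V)] {n : ℕ}
  {g : EuclideanStructure V} {o : BundleOrientation V n} {𝔰 : SpinStructure g o}
  {S : Type*} [AddCommGroup S] [Module ℝ S] [Module (Cl n) S] [IsScalarTower ℝ (Cl n) S]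
  [Module ℍ[ℝ] S] [SMulCommClass ℍ[ℝ] (Cl n) S] [IsScalarTower ℝ ℍ[ℝ] S]
  {E : X → Type*} [∀ x, AddCommGroup (E x)] [∀ x, Module ℝ (E x)] [∀ x, Module ℍ[ℝ]ᵐᵒᵖ (E x)]
  [∀ x, IsScalarTower ℝ ℍ[ℝ]ᵐᵒᵖ (E x)]

theorem quaternion_smul_spinorEquiv {x : X} (p : 𝔰.P x) (l : ℍ[ℝ]) (s : S) :
    l • spinorEquiv 𝔰 S p s = spinorEquiv 𝔰 S p (l • s) :=
  Spinor.ext 𝔰 fun _ => smul_comm l _ s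

/-- Expansion of a vector with respect to the basis that belongs to a linear isomorphism. -/
theorem eq_sum_smul_single {K W : Type*} [Ring K] [AddCommGroup W] [Module K W] {k : ℕ}
    (e : (Fin k → K) ≃ₗ[K] W) (v : Fin k → K) : e v = ∑ i, v i • e (Pi.single i 1) := by
  conv_lhs => rw [pi_eq_sum_univ' v, map_sum]
  simp [← Pi.single_apply]

/-- The isomorphism `S ⊕ ⋯ ⊕ S ≅ E_x ⊗_ℍ Σ_x` that belongs to a basis of `E_x` and a point of the
principal bundle. -/
def hTensorCoord {x : X} {k : ℕ} (e : (Fin k → ℍ[ℝ]ᵐᵒᵖ) ≃ₗ[ℍ[ℝ]ᵐᵒᵖ] E x) (p : 𝔰.P x) :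
    (Fin k → S) ≃ₗ[ℝ] HTensorBundle E (Spinor 𝔰 S) x :=
  LinearEquiv.ofLinear
    (∑ i, (hTensorMk E (Spinor 𝔰 S) x (e (Pi.single i 1))).comp
      ((spinorEquiv 𝔰 S p).toLinearMap.comp (LinearMap.proj i)))
    (hTensorLift (LinearMap.mk₂ ℝ
      (fun v ξ i => (e.symm v i).unop • (spinorEquiv 𝔰 S p).symm ξ)
      (fun v w ξ => by
        funext i
        simp only [map_add, Pi.add_apply, MulOpposite.unop_add, add_smul])
      (fun r v ξ => by
        funext i
        rw [← algebraMap_smul ℍ[ℝ]ᵐᵒᵖ r v, map_smul, algebraMap_smul]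
        simp only [Pi.smul_apply, MulOpposite.unop_smul, smul_assoc])
      (fun v ξ η => by
        funext i
        simp only [map_add, Pi.add_apply, smul_add])
      (fun r v ξ => by
        funext i
        simp only [map_smul, Pi.smul_apply]
        rw [smul_comm]))
      (fun l v ξ => by
        funext i
        obtain ⟨s, rfl⟩ := (spinorEquiv 𝔰 S p).surjective ξ
        simp only [LinearMap.mk₂_apply, quaternion_smul_spinorEquiv,
          LinearEquiv.symm_apply_apply, map_smul, Pi.smul_apply, smul_eq_mul,
          MulOpposite.unop_mul, MulOpposite.unop_op, mul_smul]))
    (hTensorBundle_hom_ext fun v ξ => by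
      obtain ⟨s, rfl⟩ := (spinorEquiv 𝔰 S p).surjective ξ
      obtain ⟨c, rfl⟩ := e.surjective v
      rw [LinearMap.comp_apply, hTensorLift_tmul, LinearMap.id_apply]
      conv_rhs => rw [eq_sum_smul_single e c]
      simp only [LinearMap.sum_apply, LinearMap.comp_apply, LinearMap.proj_apply,
        LinearMap.mk₂_apply, LinearEquiv.symm_apply_apply, LinearEquiv.coe_coe, map_sum]
      refine Finset.sum_congr rfl fun i _ => ?_
      rw [← quaternion_smul_spinorEquiv, ← hTensorMk_smul]
      rfl)
    (LinearMap.ext fun s => by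
      funext j
      simp only [LinearMap.comp_apply, LinearMap.sum_apply, LinearMap.proj_apply, map_sum,
        hTensorLift_tmul, LinearMap.mk₂_apply, LinearEquiv.symm_apply_apply, LinearEquiv.coe_coe,
        LinearMap.id_apply, Finset.sum_apply]
      rw [Finset.sum_eq_single j]
      · simp
      · intro i _ hij
        simp [Pi.single_apply, hij.symm]
      · simp)

theorem hTensorCoord_apply {x : X} {k : ℕ} (e : (Fin k → ℍ[ℝ]ᵐᵒᵖ) ≃ₗ[ℍ[ℝ]ᵐᵒᵖ] E x) (p : 𝔰.P x)
    (s : Fin k → S) : hTensorCoord e p s =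
      ∑ i, hTensorMk E (Spinor 𝔰 S) x (e (Pi.single i 1)) (spinorEquiv 𝔰 S p (s i)) := by
  change (∑ i, (hTensorMk E (Spinor 𝔰 S) x (e (Pi.single i 1))).comp
      ((spinorEquiv 𝔰 S p).toLinearMap.comp (LinearMap.proj i))) s = _
  simp only [LinearMap.sum_apply, LinearMap.comp_apply, LinearMap.proj_apply, LinearEquiv.coe_coe]

variable [TopologicalSpace (Tot E)] [TopologicalSpace S] [IsModuleTopology ℝ S] [Module.Finite ℝ S]

/-- The topology of E ⊗_ℍ Σ is a quotient of that of E ⊗ Σ. A quaternionic frame of E gives a real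
frame, and in the resulting chart of E ⊗ Σ the projection is a constant linear surjection of copies
of S, hence split. -/
theorem hTensor_isChart (U : Set X) (hU : IsOpen U) (k : ℕ)
    (e : ∀ x : U, (Fin k → ℍ[ℝ]ᵐᵒᵖ) ≃ₗ[ℍ[ℝ]ᵐᵒᵖ] E x) (he : IsChart fun x v => e x v)
    (p : ∀ x : U, 𝔰.P x) (hp : IsSpinSection 𝔰 S p) :
    IsChart fun (x : U) (s : Fin k → S) => hTensorCoord (e x) (p x) s := by
  let h := moduleCoord (Fin k → ℍ[ℝ]ᵐᵒᵖ)
  let N := Module.finrank ℝ (Fin k → ℍ[ℝ]ᵐᵒᵖ)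
  have := IsModuleTopology.toContinuousAdd ℝ S
  obtain ⟨θ, hθ, hchart⟩ := tensorBundle_exists_chart (E := E) U hU N
    (fun x => h.toLinearEquiv.trans ((e x).restrictScalars ℝ)) (he.comp_homeomorph h.toHomeomorph)
    p hp
  -- R is the projection E ⊗ Σ → E ⊗_ℍ Σ in coordinates; it does not depend on x.
  let R : (Fin N → S) →ₗ[ℝ] (Fin k → S) :=
    LinearMap.pi fun i => ∑ a, (Algebra.lsmul ℝ ℝ S (h (Pi.single a 1) i).unop).comp
      (LinearMap.proj a)
  have hR_apply : ∀ s i, R s i = ∑ a, (h (Pi.single a 1) i).unop • s a := fun s i => by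
    simp [R, LinearMap.sum_apply]
  have hproj : ∀ (x : U) s, HTensorBundle.proj E (Spinor 𝔰 S) x (θ x s) =
      hTensorCoord (e x) (p x) (R s) := by
    intro x s
    rw [hθ, hTensorCoord_apply, map_sum]
    have h1 : ∀ a, HTensorBundle.proj E (Spinor 𝔰 S) x (tensorMk E (Spinor 𝔰 S) x
        ((h.toLinearEquiv.trans ((e x).restrictScalars ℝ)) (Pi.single a 1))
          (spinorEquiv 𝔰 S (p x) (s a))) = ∑ i, hTensorMk E (Spinor 𝔰 S) x (e x (Pi.single i 1))
          (spinorEquiv 𝔰 S (p x) ((h (Pi.single a 1) i).unop • s a)) := by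
      intro a
      change hTensorMk E (Spinor 𝔰 S) x (e x (h (Pi.single a 1))) _ = _
      rw [eq_sum_smul_single (e x), map_sum, LinearMap.sum_apply]
      refine Finset.sum_congr rfl fun i _ => ?_
      rw [← quaternion_smul_spinorEquiv, ← hTensorMk_smul]
      rfl
    simp only [h1]
    rw [Finset.sum_comm]
    simp only [hR_apply, map_sum]
    rfl
  have hinj : ∀ x, Function.Injective (hTensorCoord (S := S) (e x) (p x)) :=
    fun x => (hTensorCoord (e x) (p x)).injective
  have hR : Continuous R := IsModuleTopology.continuous_of_linearMap (R := ℝ) R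
  rcases isEmpty_or_nonempty U with hemp | ⟨⟨x₁⟩⟩
  · refine Topology.IsOpenEmbedding.of_isEmpty _
  -- Surjectivity comes from the projection at one point, which is why the empty U was split off.
  have hRs : Function.Surjective R := by
    intro s
    obtain ⟨t, ht⟩ := (hRel E (Spinor 𝔰 S) x₁).mkQ_surjective (hTensorCoord (e x₁) (p x₁) s)
    obtain ⟨s', rfl⟩ := (θ x₁).surjective t
    exact ⟨s', hinj x₁ ((hproj x₁ s').symm.trans ht)⟩
  -- The linear section R' lifts coordinates continuously, so the chart is continuous; continuity of
  -- R itself gives openness.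
  obtain ⟨R', hR'⟩ := R.exists_rightInverse_of_surjective (LinearMap.range_eq_top.2 hRs)
  have hR'_cont : Continuous R' := IsModuleTopology.continuous_of_linearMap (R := ℝ) R'
  have hπ : Continuous (Tot.map fun x => HTensorBundle.proj E (Spinor 𝔰 S) x) :=
    continuous_coinduced_rng
  refine Topology.IsOpenEmbedding.of_continuous_injective_isOpenMap ?_ ?_ ?_
  · have h1 := hπ.comp (hchart.continuous.comp
      (continuous_fst.prodMk (hR'_cont.comp (continuous_snd (X := U)))))
    refine h1.congr fun q => ?_
    change (⟨q.1, HTensorBundle.proj E (Spinor 𝔰 S) q.1 (θ q.1 (R' q.2))⟩ :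
      Tot (HTensorBundle E (Spinor 𝔰 S))) = _
    rw [hproj]
    have h2 : R (R' q.2) = q.2 := LinearMap.congr_fun hR' q.2
    rw [h2]
  · rintro ⟨⟨x, hx⟩, s⟩ ⟨⟨y, hy⟩, t⟩ hst
    obtain rfl : x = y := congrArg Tot.base hst
    obtain rfl : s = t := hinj ⟨x, hx⟩ (Tot.ext_iff.1 hst)
    rfl
  · intro W hW
    rw [isOpen_coinduced]
    convert! Topology.IsOpenEmbedding.isOpenMap hchart _
      (hW.preimage (continuous_fst.prodMk (hR.comp (continuous_snd (X := U))))) using 1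
    ext ⟨x, t⟩
    constructor
    · rintro ⟨⟨⟨y, hy⟩, s⟩, hs, hst⟩
      obtain rfl : y = x := congrArg Tot.base hst
      obtain ⟨s', rfl⟩ := (θ ⟨y, hy⟩).surjective t
      refine ⟨(⟨y, hy⟩, s'), ?_, rfl⟩
      have h1 : hTensorCoord (e ⟨y, hy⟩) (p ⟨y, hy⟩) s =
        HTensorBundle.proj E (Spinor 𝔰 S) y (θ ⟨y, hy⟩ s') := Tot.ext_iff.1 hst
      rw [hproj ⟨y, hy⟩] at h1
      obtain rfl := hinj _ h1
      exact hs
    · rintro ⟨⟨⟨y, hy⟩, s⟩, hs, hst⟩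
      obtain rfl : y = x := congrArg Tot.base hst
      obtain rfl : θ ⟨y, hy⟩ s = t := Tot.ext_iff.1 hst
      exact ⟨_, hs, Tot.ext_iff.2 (hproj ⟨y, hy⟩ s).symm⟩

theorem isTwistedProduct_hTensorBundle (C : Commutant (Cl n) ℍ[ℝ]ᵐᵒᵖ S)
    (hC : ∀ c s, C.ρ c s = c.unop • s) :
    IsTwistedProduct C (hTensorMk E (Spinor 𝔰 S)) (hTwistedAction 𝔰 S E) where
  act_tm x a v ξ := hTwistedAction_tmul 𝔰 S E a v ξ
  balanced x c v p s := by
    rw [hC, ← quaternion_smul_spinorEquiv, ← hTensorMk_smul]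
    rfl
  exists_chart U hU k e he p hp :=
    ⟨fun x => hTensorCoord (e x) (p x), fun x s => hTensorCoord_apply (e x) (p x) s,
      hTensor_isChart U hU k e he p hp⟩

end HTwistedProduct

/-! ### Continuity and scalars in the commutant. -/

section CommutantTopology

variable {n : ℕ} {S : Type*} [AddCommGroup S] [Module ℝ S] [Module (Cl n) S]
  {K : Type*} [Ring K] [Algebra ℝ K] (C : Commutant (Cl n) K S)

theorem Commutant.apply_injective {c d : K} {s : S} (hs : s ≠ 0) (h : C.ρ c s = C.ρ d s) :
    c = d := by
  refine sub_eq_zero.1 (C.eq_zero _ s ?_ hs)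
  rw [map_sub, LinearMap.sub_apply, h, sub_self]

/-- This is Hom_Cl(S, Sᵏ) = Kᵏ, the algebraic source of both existence and uniqueness of E. -/
theorem Commutant.exists_pi_eq {k : ℕ} (φ : S →ₗ[ℝ] (Fin k → S))
    (hφ : ∀ (a : Cl n) s, φ (a • s) = a • φ s) : ∃ v : Fin k → K, ∀ s, φ s = fun i => C.ρ (v i) s := by
  choose v hv using fun i => C.exists_eq ((LinearMap.proj i).comp φ) fun a s => by
    simp only [LinearMap.comp_apply, hφ, LinearMap.proj_apply, Pi.smul_apply]
  exact ⟨v, fun s => funext fun i => LinearMap.congr_fun (hv i) s⟩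

variable [TopologicalSpace S] [IsModuleTopology ℝ S] [TopologicalSpace K] [IsModuleTopology ℝ K]

theorem Commutant.continuous_action [Module.Finite ℝ S] :
    Continuous fun p : K × S => C.ρ p.1 p.2 := by
  have := IsModuleTopology.toContinuousAdd ℝ S
  exact IsModuleTopology.continuous_bilinear_of_finite_right (R := ℝ) C.ρ

/-- Continuity of a family of scalars can be checked on the operators. -/
theorem Commutant.continuous_of_apply [Nontrivial S] {Y : Type*} [TopologicalSpace Y] {f : Y → K}
    (h : ∀ s, Continuous fun y => C.ρ (f y) s) : Continuous f := by
  have := IsModuleTopology.toContinuousAdd ℝ K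
  obtain ⟨s₀, hs₀⟩ := exists_ne (0 : S)
  -- For s₀ ≠ 0 the linear map c ↦ ρ(c) s₀ is injective, and a linear left inverse recovers c
  -- continuously.
  obtain ⟨l, hl⟩ := (C.ρ.flip s₀).exists_leftInverse_of_injective (LinearMap.ker_eq_bot'.2
    fun c hc => C.eq_zero c s₀ hc hs₀)
  have h1 := (IsModuleTopology.continuous_of_linearMap (R := ℝ) l).comp (h s₀)
  exact h1.congr fun y => LinearMap.congr_fun hl (f y)

end CommutantTopology

/-- Changes of coordinates are continuous. -/
theorem IsChart.continuous_coord {X : Type*} [TopologicalSpace X] {E : X → Type*}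
    [TopologicalSpace (Tot E)] {F F' : Type*} [TopologicalSpace F] [TopologicalSpace F']
    {U U' : Set X} {e : ∀ x : U, F → E x} {e' : ∀ x : U', F' → E x} (he : IsChart e)
    (he' : IsChart e') {Y : Type*} [TopologicalSpace Y] {b : Y → X} (hb : Continuous b)
    (hU : ∀ y, b y ∈ U) (hU' : ∀ y, b y ∈ U') {s : Y → F} {s' : Y → F'} (hs' : Continuous s')
    (h : ∀ y, e ⟨b y, hU y⟩ (s y) = e' ⟨b y, hU' y⟩ (s' y)) : Continuous s := by
  refine ((he.continuous_iff (b := fun y => ⟨b y, hU y⟩) (s := s)).1 ?_).2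
  simp only [h]
  exact he'.continuous_iff.2 ⟨hb.subtype_mk hU', hs'⟩

/-! ### The vector bundle Hom_{Cl(V)}(Σ, L) and its evaluation map. -/

section ClHomCharts

variable {X : Type*} [TopologicalSpace X] {V : X → Type*}
  [∀ x, AddCommGroup (V x)] [∀ x, Module ℝ (V x)] [TopologicalSpace (Tot V)] {n : ℕ}
  {g : EuclideanStructure V} {o : BundleOrientation V n} {𝔰 : SpinStructure g o}
  {S : Type*} [AddCommGroup S] [Module ℝ S] [Module (Cl n) S] [IsScalarTower ℝ (Cl n) S]
  {L : X → Type*} [∀ x, AddCommGroup (L x)] [∀ x, Module ℝ (L x)] {μ : ClAction g L}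

theorem ClHom.map_clEquiv {x : X} (φ : ClHom 𝔰 S μ x) (p : 𝔰.P x) (a : Cl n) (s : S) :
    φ.1 (spinorEquiv 𝔰 S p (a • s)) = μ x (𝔰.clEquiv p a) (φ.1 (spinorEquiv 𝔰 S p s)) := by
  rw [← spinorAction_spinorEquiv]
  exact φ.2 _ _

theorem ClHom.ext_spinorEquiv {x : X} {φ ψ : ClHom 𝔰 S μ x} (p : 𝔰.P x)
    (h : ∀ s, φ.1 (spinorEquiv 𝔰 S p s) = ψ.1 (spinorEquiv 𝔰 S p s)) : φ = ψ :=
  Subtype.ext (LinearMap.ext fun ξ => by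
    obtain ⟨s, rfl⟩ := (spinorEquiv 𝔰 S p).surjective ξ
    exact h s)

/-- A `Cl(V_x)`-linear map `Σ_x → L_x` in terms of a point of the principal bundle. -/
def ClHom.ofSpinorEquiv {x : X} (p : 𝔰.P x) (f : S →ₗ[ℝ] L x)
    (hf : ∀ (a : Cl n) s, f (a • s) = μ x (𝔰.clEquiv p a) (f s)) : ClHom 𝔰 S μ x :=
  ⟨f.comp (spinorEquiv 𝔰 S p).symm.toLinearMap, fun a ξ => by
    obtain ⟨s, rfl⟩ := (spinorEquiv 𝔰 S p).surjective ξ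
    obtain ⟨a, rfl⟩ := (𝔰.clEquiv p).surjective a
    rw [spinorAction_spinorEquiv]
    simp only [LinearMap.comp_apply, LinearEquiv.coe_coe, LinearEquiv.symm_apply_apply, hf]⟩

theorem ClHom.ofSpinorEquiv_apply {x : X} (p : 𝔰.P x) (f : S →ₗ[ℝ] L x)
    (hf : ∀ (a : Cl n) s, f (a • s) = μ x (𝔰.clEquiv p a) (f s)) (s : S) :
    (ClHom.ofSpinorEquiv p f hf).1 (spinorEquiv 𝔰 S p s) = f s := by
  change f ((spinorEquiv 𝔰 S p).symm (spinorEquiv 𝔰 S p s)) = f s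
  rw [LinearEquiv.symm_apply_apply]

variable [TopologicalSpace S] [TopologicalSpace (Tot L)]
  {K : Type*} [Ring K] [Algebra ℝ K] (C : Commutant (Cl n) K S)

/-- The `Cl(V_x)`-linear map `Σ_x → L_x ≅ Sᵏ` with components in the commutant. -/
def homCoordFun (mc : ModuleChart 𝔰 S μ) (x : mc.U) (v : Fin mc.k → K) : ClHom 𝔰 S μ x :=
  ClHom.ofSpinorEquiv (mc.p x) ((mc.Ψ x).toLinearMap.comp (LinearMap.pi fun i => C.ρ (v i)))
    fun a s => by
      rw [LinearMap.comp_apply, LinearMap.comp_apply, LinearEquiv.coe_coe, ← mc.equivariant]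
      congr 1
      funext i
      exact C.commute (v i) a s

theorem homCoordFun_apply (mc : ModuleChart 𝔰 S μ) (x : mc.U) (v : Fin mc.k → K) (s : S) :
    (homCoordFun C mc x v).1 (spinorEquiv 𝔰 S (mc.p x) s) = mc.Ψ x fun i => C.ρ (v i) s :=
  ClHom.ofSpinorEquiv_apply _ _ _ _

variable [Nontrivial S]

/-- The isomorphism `Kᵏ ≅ Hom_{Cl(V_x)}(Σ_x, L_x)` that belongs to `Sᵏ ≅ L_x`. -/
def homCoord (mc : ModuleChart 𝔰 S μ) (x : mc.U) : (Fin mc.k → K) ≃ₗ[ℝ] ClHom 𝔰 S μ x :=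
  LinearEquiv.ofBijective
    { toFun := homCoordFun C mc x
      map_add' := fun v w => ClHom.ext_spinorEquiv (mc.p x) fun s => by
        change _ = (homCoordFun C mc x v).1 _ + (homCoordFun C mc x w).1 _
        rw [homCoordFun_apply, homCoordFun_apply, homCoordFun_apply, ← map_add]
        congr 1
        funext i
        simp
      map_smul' := fun r v => ClHom.ext_spinorEquiv (mc.p x) fun s => by
        change _ = r • (homCoordFun C mc x v).1 _
        rw [homCoordFun_apply, homCoordFun_apply, ← map_smul]
        congr 1
        funext i
        simp }
    ⟨fun v w h => by
      obtain ⟨s, hs⟩ := exists_ne (0 : S)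
      have h1 := congrArg (fun φ : ClHom 𝔰 S μ x => φ.1 (spinorEquiv 𝔰 S (mc.p x) s)) h
      simp only [LinearMap.coe_mk, AddHom.coe_mk, homCoordFun_apply] at h1
      funext i
      exact C.apply_injective hs (congrFun ((mc.Ψ x).injective h1) i),
    fun φ => by
      obtain ⟨v, hv⟩ := C.exists_pi_eq ((mc.Ψ x).symm.toLinearMap.comp
        (φ.1.comp (spinorEquiv 𝔰 S (mc.p x)).toLinearMap)) fun a s => by
          simp only [LinearMap.comp_apply, LinearEquiv.coe_coe]
          rw [LinearEquiv.symm_apply_eq, mc.equivariant, LinearEquiv.apply_symm_apply,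
            ClHom.map_clEquiv]
      refine ⟨v, ClHom.ext_spinorEquiv (mc.p x) fun s => ?_⟩
      simp only [LinearMap.coe_mk, AddHom.coe_mk, homCoordFun_apply]
      exact ((LinearEquiv.symm_apply_eq _).1 (hv s)).symm⟩

theorem homCoord_apply (mc : ModuleChart 𝔰 S μ) (x : mc.U) (v : Fin mc.k → K) (s : S) :
    (homCoord C mc x v).1 (spinorEquiv 𝔰 S (mc.p x) s) = mc.Ψ x fun i => C.ρ (v i) s :=
  homCoordFun_apply C mc x v s

variable [TopologicalSpace K]

/-- The topology on the total space of `Hom_{Cl(V)}(Σ, L)`. -/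
abbrev homTopology (μ : ClAction g L) : TopologicalSpace (Tot (ClHom 𝔰 S μ)) :=
  ⨆ mc : ModuleChart 𝔰 S μ, TopologicalSpace.coinduced
    (fun q : mc.U × (Fin mc.k → K) => ⟨q.1, homCoord C mc q.1 q.2⟩) inferInstance

variable [IsModuleTopology ℝ S] [IsModuleTopology ℝ K] [Module.Finite ℝ S]

/-- The gluing lemma again: `homTopology` is the finest topology making the coordinate maps
continuous, and the changes of coordinates are tested by letting the scalars act on S. -/
theorem homCoord_isChart (mc : ModuleChart 𝔰 S μ) :
    letI := homTopology (𝔰 := 𝔰) C μ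
    IsChart fun (x : mc.U) v => homCoord C mc x v := by
  letI := homTopology (𝔰 := 𝔰) C μ
  refine isChart_of_glue (ι := ModuleChart 𝔰 S μ) (U := fun i => i.U) (F := fun i => Fin i.k → K)
    (fun i => i.isOpen) (fun i x => (homCoord C i x).toEquiv)
    (fun O => ?_) (fun i j => ?_) mc
  · simp only [isOpen_iSup_iff, isOpen_coinduced]
    rfl
  · refine continuous_pi fun a => C.continuous_of_apply fun s => ?_
    let Y : Set X := i.U ∩ j.U
    have hfst : Continuous fun q : Y × (Fin j.k → K) => (q.1 : X) :=
      continuous_subtype_val.comp continuous_fst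
    have h1 : Continuous fun q : Y × (Fin j.k → K) =>
        (spinorEquiv 𝔰 S (j.p ⟨q.1, q.1.2.2⟩)).symm (spinorEquiv 𝔰 S (i.p ⟨q.1, q.1.2.1⟩) s) :=
      j.isSpinSection.isChart.continuous_coord i.isSpinSection.isChart hfst (fun q => q.1.2.2)
        (fun q => q.1.2.1) (continuous_const (y := s)) fun q => LinearEquiv.apply_symm_apply _ _
    have h2 : Continuous fun q : Y × (Fin j.k → K) => fun b => C.ρ (q.2 b)
        ((spinorEquiv 𝔰 S (j.p ⟨q.1, q.1.2.2⟩)).symm (spinorEquiv 𝔰 S (i.p ⟨q.1, q.1.2.1⟩) s)) :=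
      continuous_pi fun b => C.continuous_action.comp
        (((continuous_apply b).comp continuous_snd).prodMk h1)
    -- If w are the new coordinates of v and [p_j, s'] = [p_i, s], then (ρ(w_a) s)_a = Ψ_i⁻¹ Ψ_j
    -- (ρ(v_b) s')_b.
    have h3 : Continuous fun q : Y × (Fin j.k → K) => fun a => C.ρ ((homCoord C i ⟨q.1, q.1.2.1⟩).symm
        (homCoord C j ⟨q.1, q.1.2.2⟩ q.2) a) s := by
      refine i.isChart.continuous_coord j.isChart hfst (fun q => q.1.2.1)
        (fun q => q.1.2.2) h2 fun q => ?_
      rw [← homCoord_apply, ← homCoord_apply, LinearEquiv.apply_symm_apply,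
        LinearEquiv.apply_symm_apply]
    exact (continuous_apply a).comp h3

variable [∀ x, Module K (ClHom 𝔰 S μ x)]

/-- `homCoord` is linear over `K`. -/
def homCoordK (hK : ∀ x (c : K) (φ : ClHom 𝔰 S μ x) (p : 𝔰.P x) s,
      (c • φ).1 (spinorEquiv 𝔰 S p s) = φ.1 (spinorEquiv 𝔰 S p (C.ρ c s)))
    (mc : ModuleChart 𝔰 S μ) (x : mc.U) : (Fin mc.k → K) ≃ₗ[K] ClHom 𝔰 S μ x where
  __ := (homCoord C mc x).toAddEquiv
  map_smul' c v := ClHom.ext_spinorEquiv (mc.p x) fun s => by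
    change (homCoord C mc x (c • v)).1 _ = (c • homCoord C mc x v).1 _
    rw [hK, homCoord_apply, homCoord_apply]
    simp only [Pi.smul_apply, smul_eq_mul, C.ρ_mul, Module.End.mul_apply]

theorem isVectorBundle_clHom (hK : ∀ x (c : K) (φ : ClHom 𝔰 S μ x) (p : 𝔰.P x) s,
      (c • φ).1 (spinorEquiv 𝔰 S p s) = φ.1 (spinorEquiv 𝔰 S p (C.ρ c s)))
    (hmc : ∀ x₀, ∃ mc : ModuleChart 𝔰 S μ, x₀ ∈ mc.U) :
    letI := homTopology (𝔰 := 𝔰) C μ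
    IsVectorBundle K (ClHom 𝔰 S μ) := by
  letI := homTopology (𝔰 := 𝔰) C μ
  refine ⟨fun x₀ => ?_⟩
  obtain ⟨mc, hx⟩ := hmc x₀
  exact ⟨mc.k, ⟨mc.U, mc.isOpen, homCoordK C hK mc, homCoord_isChart C mc⟩, hx⟩

/-- Evaluation is an isomorphism `Hom_{Cl(V)}(Σ, L) ⊗_K Σ ≅ L`. -/
theorem exists_evaluation_iso (hK : ∀ x (c : K) (φ : ClHom 𝔰 S μ x) (p : 𝔰.P x) s,
      (c • φ).1 (spinorEquiv 𝔰 S p s) = φ.1 (spinorEquiv 𝔰 S p (C.ρ c s)))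
    (hmc : ∀ x₀, ∃ mc : ModuleChart 𝔰 S μ, x₀ ∈ mc.U)
    {T : X → Type*} [∀ x, AddCommGroup (T x)] [∀ x, Module ℝ (T x)] [TopologicalSpace (Tot T)]
    (tm : ∀ x, ClHom 𝔰 S μ x →ₗ[ℝ] Spinor 𝔰 S x →ₗ[ℝ] T x) (act : ClAction g T)
    (hT : letI := homTopology (𝔰 := 𝔰) C μ; IsTwistedProduct C tm act)
    (j₀ : ∀ x, T x →ₗ[ℝ] L x) (hj₀ : ∀ x φ ξ, j₀ x (tm x φ ξ) = φ.1 ξ) :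
    ∃ j : ∀ x, T x ≃ₗ[ℝ] L x, (∀ x t, j x t = j₀ x t) ∧ IsBundleIso j ∧ IsClLinear act μ j := by
  letI := homTopology (𝔰 := 𝔰) C μ
  have key : ∀ mc : ModuleChart 𝔰 S μ, ∃ θ : ∀ x : mc.U, (Fin mc.k → S) ≃ₗ[ℝ] T x,
      (∀ (x : mc.U) s, ∃ v : Fin mc.k → ClHom 𝔰 S μ x, ∃ ξ : Fin mc.k → Spinor 𝔰 S x,
        θ x s = ∑ i, tm x (v i) (ξ i)) ∧
      (IsChart fun (x : mc.U) s => θ x s) ∧ ∀ (x : mc.U) s, j₀ x (θ x s) = mc.Ψ x s := by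
    intro mc
    obtain ⟨θ, hθ, hθ'⟩ := hT.exists_chart mc.U mc.isOpen mc.k (homCoordK C hK mc)
      (homCoord_isChart C mc) mc.p mc.isSpinSection
    refine ⟨θ, fun x s => ⟨_, _, hθ x s⟩, hθ', fun x s => ?_⟩
    rw [hθ, map_sum]
    -- As ρ(1) = 1 and ρ(0) = 0, the i-th frame element of Hom maps [p, s] to Ψ of the tuple with s
    -- in position i. Thus evaluation becomes the identity of Sᵏ.
    have h1 : ∀ i, j₀ x (tm x (homCoordK C hK mc x (Pi.single i 1))
        (spinorEquiv 𝔰 S (mc.p x) (s i))) = mc.Ψ x (Pi.single i (s i)) := by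
      intro i
      rw [hj₀]
      refine (homCoord_apply C mc x (Pi.single i 1) (s i)).trans ?_
      congr 1
      funext a
      rcases eq_or_ne a i with rfl | h
      · rw [Pi.single_eq_same, Pi.single_eq_same, C.ρ_one, Module.End.one_apply]
      · rw [Pi.single_eq_of_ne h, Pi.single_eq_of_ne h, map_zero, LinearMap.zero_apply]
    simp only [h1]
    rw [← map_sum, Finset.univ_sum_single]
  have hbij : ∀ x, Function.Bijective (j₀ x) := by
    intro x
    obtain ⟨mc, hx⟩ := hmc x
    obtain ⟨θ, -, -, hj⟩ := key mc
    have h1 : (j₀ x : T x → L x) = (mc.Ψ ⟨x, hx⟩) ∘ (θ ⟨x, hx⟩).symm := by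
      funext t
      obtain ⟨s, rfl⟩ := (θ ⟨x, hx⟩).surjective t
      rw [Function.comp_apply, LinearEquiv.symm_apply_apply]
      exact hj ⟨x, hx⟩ s
    rw [h1]
    exact (mc.Ψ ⟨x, hx⟩).bijective.comp (θ ⟨x, hx⟩).symm.bijective
  refine ⟨fun x => LinearEquiv.ofBijective (j₀ x) (hbij x), fun x t => rfl, ⟨?_, ?_⟩, ?_⟩
  · rw [continuous_iff_continuousAt]
    intro t
    obtain ⟨mc, hx⟩ := hmc t.base
    obtain ⟨θ, -, hθ, hj⟩ := key mc
    exact continuousAt_totMap hθ (fun x => (θ x).surjective) mc.isChart Prod.snd continuous_snd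
      (fun x s => hj x s) t hx
  · rw [continuous_iff_continuousAt]
    intro t
    obtain ⟨mc, hx⟩ := hmc t.base
    obtain ⟨θ, -, hθ, hj⟩ := key mc
    refine continuousAt_totMap mc.isChart (fun x => (mc.Ψ x).surjective) hθ Prod.snd continuous_snd
      (fun x s => ?_) t hx
    rw [LinearEquiv.symm_apply_eq]
    exact (hj x s).symm
  · intro x a t
    obtain ⟨mc, hx⟩ := hmc x
    obtain ⟨θ, hθ, -, -⟩ := key mc
    obtain ⟨s, rfl⟩ := (θ ⟨x, hx⟩).surjective t
    obtain ⟨v, ξ, h⟩ := hθ ⟨x, hx⟩ s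
    rw [h]
    simp only [map_sum, hT.act_tm, LinearEquiv.ofBijective_apply, hj₀]
    exact Finset.sum_congr rfl fun i _ => (v i).2 a (ξ i)

end ClHomCharts

/-! ## The twisting bundle is determined by the twisted spinor bundle -/

section Uniqueness

variable {X : Type*} [TopologicalSpace X] {V : X → Type*}
  [∀ x, AddCommGroup (V x)] [∀ x, Module ℝ (V x)] [TopologicalSpace (Tot V)] {n : ℕ}
  {g : EuclideanStructure V} {o : BundleOrientation V n} {𝔰 : SpinStructure g o}
  {S : Type*} [AddCommGroup S] [Module ℝ S] [Module (Cl n) S] [IsScalarTower ℝ (Cl n) S]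
  [TopologicalSpace S]
  {K : Type*} [Ring K] [TopologicalSpace K] [Algebra ℝ K] {C : Commutant (Cl n) K S}
  {E : X → Type*} [∀ x, AddCommGroup (E x)] [∀ x, Module ℝ (E x)] [∀ x, Module K (E x)]
  [TopologicalSpace (Tot E)]
  {E' : X → Type*} [∀ x, AddCommGroup (E' x)] [∀ x, Module ℝ (E' x)] [∀ x, Module K (E' x)]
  [TopologicalSpace (Tot E')]
  {T : X → Type*} [∀ x, AddCommGroup (T x)] [∀ x, Module ℝ (T x)] [TopologicalSpace (Tot T)]
  {T' : X → Type*} [∀ x, AddCommGroup (T' x)] [∀ x, Module ℝ (T' x)] [TopologicalSpace (Tot T')]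
  {tm : ∀ x, E x →ₗ[ℝ] Spinor 𝔰 S x →ₗ[ℝ] T x} {act : ClAction g T}
  {tm' : ∀ x, E' x →ₗ[ℝ] Spinor 𝔰 S x →ₗ[ℝ] T' x} {act' : ClAction g T'}

/-- Compatible local frames: a frame `e` of `E`, a section `p` of the principal bundle and the
resulting isomorphisms `θ : Sᵏ ≅ T_x`. -/
structure TwistedFrame (C : Commutant (Cl n) K S)
    (tm : ∀ x, E x →ₗ[ℝ] Spinor 𝔰 S x →ₗ[ℝ] T x) (act : ClAction g T) {U : Set X}
    (p : ∀ x : U, 𝔰.P x) where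
  k : ℕ
  e : ∀ x : U, (Fin k → K) ≃ₗ[K] E x
  isChart_e : IsChart fun (x : U) v => e x v
  θ : ∀ x : U, (Fin k → S) ≃ₗ[ℝ] T x
  isChart_θ : IsChart fun (x : U) s => θ x s
  θ_apply : ∀ (x : U) (v : Fin k → K) s,
    θ x (fun i => C.ρ (v i) s) = tm x (e x v) (spinorEquiv 𝔰 S (p x) s)
  θ_smul : ∀ (x : U) (a : Cl n) s, θ x (a • s) = act x (𝔰.clEquiv (p x) a) (θ x s)

/-- Balancedness moves the coordinates of e(v) onto the spinor: ∑ v_i e_i ⊗ [p, s] = ∑ e_i ⊗ [p,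
ρ(v_i) s]. -/
theorem IsTwistedProduct.nonempty_twistedFrame (hT : IsTwistedProduct C tm act) {U : Set X}
    (hU : IsOpen U) {k : ℕ} (e : ∀ x : U, (Fin k → K) ≃ₗ[K] E x)
    (he : IsChart fun (x : U) v => e x v) (p : ∀ x : U, 𝔰.P x) (hp : IsSpinSection 𝔰 S p) :
    Nonempty (TwistedFrame C tm act p) := by
  obtain ⟨θ, hθ, hθ'⟩ := hT.exists_chart U hU k e he p hp
  refine ⟨⟨k, e, he, θ, hθ', fun x v s => ?_, fun x a s => ?_⟩⟩
  · rw [hθ, eq_sum_smul_single (e x) v, map_sum, LinearMap.sum_apply]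
    simp only [hT.balanced]
  · rw [hθ, hθ, map_sum]
    refine Finset.sum_congr rfl fun i _ => ?_
    rw [hT.act_tm, spinorAction_spinorEquiv]
    rfl

/-- Both frames use the same open set and the same section p, so a map between the two bundles can
be read in one set of spinor coordinates. -/
theorem exists_twistedFrames [IsModuleTopology ℝ S] [Module.Finite ℝ S]
    [IsVectorBundle K E] [IsVectorBundle K E']
    (hT : IsTwistedProduct C tm act) (hT' : IsTwistedProduct C tm' act') (x₀ : X) :
    ∃ (U : Set X) (_ : x₀ ∈ U) (p : ∀ x : U, 𝔰.P x) (_ : IsSpinSection 𝔰 S p)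
      (_ : TwistedFrame C tm act p) (_ : TwistedFrame C tm' act' p), True := by
  obtain ⟨U₀, p, hU₀, hx₀, hp⟩ := exists_isSpinSection 𝔰 S x₀
  obtain ⟨k, e, hx₁⟩ := IsVectorBundle.exists_localTriv (K := K) (E := E) x₀
  obtain ⟨k', e', hx₂⟩ := IsVectorBundle.exists_localTriv (K := K) (E := E') x₀
  have hU : IsOpen (U₀ ∩ e.baseSet ∩ e'.baseSet) :=
    (hU₀.inter e.isOpen_baseSet).inter e'.isOpen_baseSet
  have hp' := hp.restrict hU fun x hx => hx.1.1
  obtain ⟨t⟩ := hT.nonempty_twistedFrame hU (fun x => e.equiv ⟨x, x.2.1.2⟩)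
    (e.isChart.restrict hU fun x hx => hx.1.2) _ hp'
  obtain ⟨t'⟩ := hT'.nonempty_twistedFrame hU (fun x => e'.equiv ⟨x, x.2.2⟩)
    (e'.isChart.restrict hU fun x hx => hx.2) _ hp'
  exact ⟨U₀ ∩ e.baseSet ∩ e'.baseSet, ⟨⟨hx₀, hx₁⟩, hx₂⟩, _, hp', t, t', trivial⟩

variable [Nontrivial S]

theorem TwistedFrame.eq_of_forall {U : Set X} {p : ∀ x : U, 𝔰.P x} (t : TwistedFrame C tm act p)
    {x : X} (hx : x ∈ U) {v w : E x} (h : ∀ ξ, tm x v ξ = tm x w ξ) : v = w := by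
  obtain ⟨v, rfl⟩ := (t.e ⟨x, hx⟩).surjective v
  obtain ⟨w, rfl⟩ := (t.e ⟨x, hx⟩).surjective w
  obtain ⟨s, hs⟩ := exists_ne (0 : S)
  have h1 := h (spinorEquiv 𝔰 S (p ⟨x, hx⟩) s)
  rw [← t.θ_apply ⟨x, hx⟩, ← t.θ_apply ⟨x, hx⟩] at h1
  congr 1
  funext i
  exact C.apply_injective hs (congrFun ((t.θ ⟨x, hx⟩).injective h1) i)

theorem TwistedFrame.exists_eq {U : Set X} {p : ∀ x : U, 𝔰.P x} (t : TwistedFrame C tm act p)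
    (t' : TwistedFrame C tm' act' p) {x : X} (hx : x ∈ U) (φ : T x →ₗ[ℝ] T' x)
    (hφ : ∀ a ξ, φ (act x a ξ) = act' x a (φ ξ)) (v : E x) :
    ∃ w : E' x, ∀ ξ, φ (tm x v ξ) = tm' x w ξ := by
  obtain ⟨v, rfl⟩ := (t.e ⟨x, hx⟩).surjective v
  -- In the frames, s ↦ φ(e(v) ⊗ [p, s]) is a Clifford linear map from S to a power of S, so its
  -- components are scalars of the commutant.
  obtain ⟨w, hw⟩ := C.exists_pi_eq ((t'.θ ⟨x, hx⟩).symm.toLinearMap.comp (φ.comp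
    ((t.θ ⟨x, hx⟩).toLinearMap.comp (LinearMap.pi fun i => C.ρ (v i))))) fun a s => by
      have h1 : LinearMap.pi (fun i => C.ρ (v i)) (a • s) =
          a • LinearMap.pi (fun i => C.ρ (v i)) s := funext fun i => C.commute (v i) a s
      simp only [LinearMap.comp_apply, LinearEquiv.coe_coe, h1]
      rw [LinearEquiv.symm_apply_eq, t'.θ_smul, LinearEquiv.apply_symm_apply, t.θ_smul, hφ]
  refine ⟨t'.e ⟨x, hx⟩ w, fun ξ => ?_⟩
  obtain ⟨s, rfl⟩ := (spinorEquiv 𝔰 S (p ⟨x, hx⟩)).surjective ξ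
  rw [← t.θ_apply ⟨x, hx⟩, ← t'.θ_apply ⟨x, hx⟩]
  exact (LinearEquiv.symm_apply_eq _).1 (hw s)

variable [IsModuleTopology ℝ S] [Module.Finite ℝ S] [IsModuleTopology ℝ K]
  [IsVectorBundle K E] [IsVectorBundle K E']

/-- Continuous `Cl(V)`-linear maps `E ⊗_K Σ → E' ⊗_K Σ` come from continuous maps `E → E'`. -/
theorem exists_map_of_twisted (hT : IsTwistedProduct C tm act) (hT' : IsTwistedProduct C tm' act')
    (φ : ∀ x, T x →ₗ[ℝ] T' x) (hφ : ∀ x a ξ, φ x (act x a ξ) = act' x a (φ x ξ))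
    (hφ_cont : Continuous (Tot.map fun x => φ x)) :
    ∃ f : ∀ x, E x →ₗ[K] E' x, (∀ x v ξ, φ x (tm x v ξ) = tm' x (f x v) ξ) ∧
      Continuous (Tot.map fun x => f x) := by
  have huniq : ∀ x (v w : E' x), (∀ ξ, tm' x v ξ = tm' x w ξ) → v = w := by
    intro x v w h
    obtain ⟨U, hx, p, -, t, t', -⟩ := exists_twistedFrames hT hT' x
    exact t'.eq_of_forall hx h
  choose f hf using fun x (v : E x) => show ∃ w : E' x, ∀ ξ, φ x (tm x v ξ) = tm' x w ξ by
    obtain ⟨U, hx, p, -, t, t', -⟩ := exists_twistedFrames hT hT' x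
    exact t.exists_eq t' hx (φ x) (hφ x) v
  refine ⟨fun x =>
    { toFun := f x
      map_add' := fun v w => huniq x _ _ fun ξ => by
        rw [← hf, map_add, map_add, LinearMap.add_apply, LinearMap.add_apply, map_add, hf, hf]
      map_smul' := fun c v => huniq x _ _ fun ξ => by
        obtain ⟨U, hx, p, -, -, -, -⟩ := exists_twistedFrames hT hT' x
        obtain ⟨s, rfl⟩ := (spinorEquiv 𝔰 S (p ⟨x, hx⟩)).surjective ξ
        rw [← hf, hT.balanced, RingHom.id_apply, hT'.balanced, hf] }, fun x v ξ => hf x v ξ, ?_⟩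
  rw [continuous_iff_continuousAt]
  intro v
  obtain ⟨U, hx, p, hp, t, t', -⟩ := exists_twistedFrames hT hT' v.base
  refine continuousAt_totMap t.isChart_e (fun x => (t.e x).surjective) t'.isChart_e
    (fun q => (t'.e q.1).symm (f q.1 (t.e q.1 q.2))) ?_
    (fun x v => ((t'.e x).apply_symm_apply _).symm) v hx
  -- The coordinates of f are tested on vectors s of S, where they appear as coordinates of φ(v ⊗
  -- [p, s]).
  refine continuous_pi fun a => C.continuous_of_apply fun s => ?_
  have h1 : Continuous fun q : U × (Fin t.k → K) => fun i => C.ρ (q.2 i) s :=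
    continuous_pi fun i => by
      have h0 : Continuous fun q : U × (Fin t.k → K) => (q.2 i, s) := by fun_prop
      exact C.continuous_action.comp h0
  have h2 : Continuous fun q : U × (Fin t.k → K) => fun i =>
      C.ρ ((t'.e q.1).symm (f q.1 (t.e q.1 q.2)) i) s := by
    refine (t'.isChart_θ.continuous_iff (b := Prod.fst)).1 ?_ |>.2
    have h3 := hφ_cont.comp (t.isChart_θ.continuous_iff.2 ⟨continuous_fst, h1⟩)
    refine h3.congr fun q => ?_
    change (⟨q.1, φ q.1 (t.θ q.1 fun i => C.ρ (q.2 i) s)⟩ : Tot T') = _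
    rw [t.θ_apply, t'.θ_apply, LinearEquiv.apply_symm_apply, hf]
  exact (continuous_apply a).comp h2

/-- `E` is determined up to isomorphism by the Clifford module bundle `E ⊗_K Σ`. -/
theorem exists_iso_of_twisted (hT : IsTwistedProduct C tm act) (hT' : IsTwistedProduct C tm' act')
    (φ : ∀ x, T x ≃ₗ[ℝ] T' x) (hφ : IsBundleIso φ) (hlin : IsClLinear act act' φ) :
    ∃ f : ∀ x, E x ≃ₗ[K] E' x, IsBundleIso f := by
  have huniq : ∀ x (v w : E x), (∀ ξ, tm x v ξ = tm x w ξ) → v = w := by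
    intro x v w h
    obtain ⟨U, hx, p, -, t, t', -⟩ := exists_twistedFrames hT hT' x
    exact t.eq_of_forall hx h
  have huniq' : ∀ x (v w : E' x), (∀ ξ, tm' x v ξ = tm' x w ξ) → v = w := by
    intro x v w h
    obtain ⟨U, hx, p, -, t, t', -⟩ := exists_twistedFrames hT hT' x
    exact t'.eq_of_forall hx h
  obtain ⟨f, hf, hf_cont⟩ := exists_map_of_twisted hT hT' (fun x => (φ x).toLinearMap) hlin hφ.1
  obtain ⟨f', hf', hf'_cont⟩ := exists_map_of_twisted hT' hT (fun x => (φ x).symm.toLinearMap)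
    (fun x a ξ => by
      rw [LinearEquiv.coe_coe, LinearEquiv.symm_apply_eq, hlin, LinearEquiv.apply_symm_apply]) hφ.2
  refine ⟨fun x => LinearEquiv.ofLinear (f x) (f' x)
    (LinearMap.ext fun w => huniq' x _ _ fun ξ => ?_)
    (LinearMap.ext fun v => huniq x _ _ fun ξ => ?_), hf_cont, hf'_cont⟩
  · rw [LinearMap.comp_apply, ← hf, ← hf', LinearEquiv.coe_coe, LinearEquiv.coe_coe,
      LinearEquiv.apply_symm_apply, LinearMap.id_apply]
  · rw [LinearMap.comp_apply, ← hf', ← hf, LinearEquiv.coe_coe, LinearEquiv.coe_coe,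
      LinearEquiv.symm_apply_apply, LinearMap.id_apply]

end Uniqueness

/-! ## The Euclidean structure of `Hom_{Cl(V)}(Σ, L)` -/

section HomEuclidean

variable {X : Type*} [TopologicalSpace X] {V : X → Type*}
  [∀ x, AddCommGroup (V x)] [∀ x, Module ℝ (V x)] [TopologicalSpace (Tot V)] {n : ℕ}
  {g : EuclideanStructure V} {o : BundleOrientation V n} {𝔰 : SpinStructure g o}
  {S : Type*} [AddCommGroup S] [Module ℝ S] [Module (Cl n) S] [IsScalarTower ℝ (Cl n) S]
  {L : X → Type*} [∀ x, AddCommGroup (L x)] [∀ x, Module ℝ (L x)]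

/-- Evaluation at the spinor `[p, s]`. -/
def evalSpinor {μ : ClAction g L} {x : X} (p : 𝔰.P x) (s : S) : ClHom 𝔰 S μ x →ₗ[ℝ] L x where
  toFun φ := φ.1 (spinorEquiv 𝔰 S p s)
  map_add' _ _ := rfl
  map_smul' _ _ := rfl

theorem evalSpinor_apply {μ : ClAction g L} {x : X} (p : 𝔰.P x) (s : S) (φ : ClHom 𝔰 S μ x) :
    evalSpinor p s φ = φ.1 (spinorEquiv 𝔰 S p s) := rfl

/-- The bilinear form `∑ B(φ[p, t_j], ψ[p, t_j])`. -/
def homForm {μ : ClAction g L} {x : X} (B : LinearMap.BilinForm ℝ (L x)) {κ : Type} [Fintype κ]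
    (t : κ → S) (p : 𝔰.P x) : LinearMap.BilinForm ℝ (ClHom 𝔰 S μ x) :=
  ∑ j, B.compl₁₂ (evalSpinor p (t j)) (evalSpinor p (t j))

theorem homForm_apply {μ : ClAction g L} {x : X} (B : LinearMap.BilinForm ℝ (L x)) {κ : Type}
    [Fintype κ] (t : κ → S) (p : 𝔰.P x) (φ ψ : ClHom 𝔰 S μ x) :
    homForm B t p φ ψ =
      ∑ j, B (φ.1 (spinorEquiv 𝔰 S p (t j))) (ψ.1 (spinorEquiv 𝔰 S p (t j))) := by
  simp only [homForm, LinearMap.sum_apply, LinearMap.compl₁₂_apply, evalSpinor_apply]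

theorem spinVal_mul_star (h : Spin n) : spinVal h * star (spinVal h) = 1 := by
  have h1 : star (spinVal h) * spinVal h = 1 := h.2.2.1
  rw [show star (spinVal h) = spinVal h⁻¹ by
    rw [← mul_one (star (spinVal h)), ← spinVal_mul_inv h, ← mul_assoc, h1, one_mul]]
  exact spinVal_mul_inv h

variable {κ : Type} [Fintype κ] {t : κ → S}

/-- Two points of P_x differ by an element h of the spin group. Moving h from one argument to the
other turns it into h*, and h h* = 1. -/
theorem homForm_eq {μ : ClAction g L} {x : X} (B : LinearMap.BilinForm ℝ (L x))
    (ht : ∀ (i : Fin n) (B : LinearMap.BilinForm ℝ S),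
      ∑ j, B (CliffordAlgebra.ι (stdForm n) (Pi.single i 1) • t j)
        (CliffordAlgebra.ι (stdForm n) (Pi.single i 1) • t j) = ∑ j, B (t j) (t j))
    (p q : 𝔰.P x) : homForm (μ := μ) B t p = homForm B t q := by
  refine LinearMap.ext₂ fun φ ψ => ?_
  rw [homForm_apply, homForm_apply, ← 𝔰.diff_spec p q]
  simp only [spinorEquiv_smul]
  let B' : LinearMap.BilinForm ℝ S := B.compl₁₂ (φ.1.comp (spinorEquiv 𝔰 S p).toLinearMap)
    (ψ.1.comp ((spinorEquiv 𝔰 S p).toLinearMap.comp (clEnd S (spinVal (𝔰.diff p q)))))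
  refine Eq.trans ?_ (sum_clSmul_left ht (spinVal (𝔰.diff p q)) B').symm
  refine Finset.sum_congr rfl fun j _ => ?_
  change _ = B _ (ψ.1 (spinorEquiv 𝔰 S p
    (spinVal (𝔰.diff p q) • star (spinVal (𝔰.diff p q)) • t j)))
  rw [smul_smul, spinVal_mul_star, one_smul]
  rfl

variable [TopologicalSpace S] [TopologicalSpace (Tot L)]
  {K : Type} [Ring K] [TopologicalSpace K] [Algebra ℝ K] (C : Commutant (Cl n) K S) [Nontrivial S]
  [IsModuleTopology ℝ S] [IsModuleTopology ℝ K] [Module.Finite ℝ S]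

theorem exists_homEuclidean {c : ClModuleBundle g L}
    (hmc : ∀ x₀, ∃ mc : ModuleChart 𝔰 S c.μ, x₀ ∈ mc.U)
    (hspan : Submodule.span ℝ (Set.range t) = ⊤)
    (ht : ∀ (i : Fin n) (B : LinearMap.BilinForm ℝ S),
      ∑ j, B (CliffordAlgebra.ι (stdForm n) (Pi.single i 1) • t j)
        (CliffordAlgebra.ι (stdForm n) (Pi.single i 1) • t j) = ∑ j, B (t j) (t j)) :
    letI := homTopology (𝔰 := 𝔰) C c.μ
    ∃ h : EuclideanStructure (ClHom 𝔰 S c.μ),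
      ∀ x (p : 𝔰.P x), h.form x = homForm (c.metric.form x) t p := by
  letI := homTopology (𝔰 := 𝔰) C c.μ
  choose mc hx using hmc
  let p₀ : ∀ x, 𝔰.P x := fun x => (mc x).p ⟨x, hx x⟩
  have hsurj : ∀ (m : ModuleChart 𝔰 S c.μ) (x : m.U), Function.Surjective (homCoord C m x) :=
    fun m x => (homCoord C m x).surjective
  refine ⟨⟨fun x => homForm (c.metric.form x) t (p₀ x), fun x φ ψ => ?_, fun x φ hφ => ?_, ?_⟩,
    fun x p => homForm_eq _ ht _ _⟩
  · simp only [homForm_apply, c.metric.symm x (φ.1 _)]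
  · rw [homForm_apply]
    have hnn : ∀ ξ : L x, 0 ≤ c.metric.form x ξ ξ := fun ξ => by
      rcases eq_or_ne ξ 0 with rfl | h
      · simp
      · exact (c.metric.pos x ξ h).le
    -- If ⟨φ, φ⟩ = 0, then φ vanishes on all [p, t_j], and the t_j span S.
    refine (Finset.sum_nonneg fun j _ => hnn _).lt_of_ne fun h0 => hφ ?_
    have h1 := (Finset.sum_eq_zero_iff_of_nonneg fun j _ => hnn _).1 h0.symm
    have h2 : φ.1.comp (spinorEquiv 𝔰 S (p₀ x)).toLinearMap = 0 := by
      refine LinearMap.ext_on hspan ?_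
      rintro _ ⟨j, rfl⟩
      by_contra hne
      exact (c.metric.pos x _ hne).ne' (h1 j (Finset.mem_univ j))
    exact ClHom.ext_spinorEquiv (p₀ x) fun s => LinearMap.congr_fun h2 s
  · refine FibProd.continuous_of_charts _ (continuous_base_of_charts fun x₀ =>
      ⟨_, inferInstance, _, fun x v => homCoord C (mc x₀) x v, hx x₀, homCoord_isChart C (mc x₀),
        hsurj _⟩) fun x₀ =>
      ⟨_, _, inferInstance, inferInstance, _, fun x v => homCoord C (mc x₀) x v,
        fun x v => homCoord C (mc x₀) x v, (mc x₀).isOpen, hx x₀, homCoord_isChart C (mc x₀),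
        hsurj _, homCoord_isChart C (mc x₀), hsurj _, ?_⟩
    have h1 : ∀ q : (mc x₀).U × (Fin (mc x₀).k → K) × (Fin (mc x₀).k → K),
        homForm (c.metric.form q.1) t (p₀ q.1) (homCoord C (mc x₀) q.1 q.2.1)
          (homCoord C (mc x₀) q.1 q.2.2) = ∑ j, c.metric.form q.1
            ((mc x₀).Ψ q.1 fun i => C.ρ (q.2.1 i) (t j))
            ((mc x₀).Ψ q.1 fun i => C.ρ (q.2.2 i) (t j)) := fun q => by
      -- The chosen points p₀ need not vary continuously; invariance allows the continuous section
      -- of the chart in their place.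
      rw [homForm_eq _ ht (p₀ q.1) ((mc x₀).p q.1), homForm_apply]
      simp only [homCoord_apply]
    simp only [h1]
    refine continuous_finsetSum _ fun j _ => ?_
    have h2 : ∀ f : (mc x₀).U × (Fin (mc x₀).k → K) × (Fin (mc x₀).k → K) → Fin (mc x₀).k → K,
        Continuous f → Continuous fun q => (⟨q.1, (mc x₀).Ψ q.1 fun i => C.ρ (f q i) (t j)⟩ :
          Tot L) := fun f hf => by
      refine (mc x₀).isChart.continuous_iff.2 ⟨continuous_fst, continuous_pi fun i => ?_⟩
      have h0 : Continuous fun q => (f q i, t j) := by fun_prop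
      exact C.continuous_action.comp h0
    have h3 : Continuous fun q : (mc x₀).U × (Fin (mc x₀).k → K) × (Fin (mc x₀).k → K) =>
        (⟨q.1, (mc x₀).Ψ q.1 fun i => C.ρ (q.2.1 i) (t j),
          (mc x₀).Ψ q.1 fun i => C.ρ (q.2.2 i) (t j)⟩ : FibProd L L) :=
      continuous_fibProd_iff.2 ⟨h2 _ (continuous_fst.comp continuous_snd),
        h2 _ (continuous_snd.comp continuous_snd)⟩
    exact c.metric.continuous_form.comp h3

end HomEuclidean

/-! ### Spanning families of S invariant under the generators and the quaternion units. -/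

section Families

variable {n : ℕ} (S : Type*) [AddCommGroup S] [Module ℝ S] [Module (Cl n) S]
  [IsScalarTower ℝ (Cl n) S]

theorem clEnd_generator_sq (i : Fin n) (s : S) :
    clEnd S (CliffordAlgebra.ι (stdForm n) (Pi.single i 1))
      (clEnd S (CliffordAlgebra.ι (stdForm n) (Pi.single i 1)) s) = -s := by
  rw [← Module.End.mul_apply, ← map_mul, ι_single_sq (-1) i, map_smul, map_one,
    LinearMap.smul_apply, Module.End.one_apply, neg_smul, one_smul]

theorem clEnd_generator_anticomm {i j : Fin n} (hij : i ≠ j) (s : S) :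
    clEnd S (CliffordAlgebra.ι (stdForm n) (Pi.single i 1))
      (clEnd S (CliffordAlgebra.ι (stdForm n) (Pi.single j 1)) s) =
    -clEnd S (CliffordAlgebra.ι (stdForm n) (Pi.single j 1))
      (clEnd S (CliffordAlgebra.ι (stdForm n) (Pi.single i 1)) s) := by
  rw [← Module.End.mul_apply, ← map_mul, ι_single_anticomm (-1) hij, map_neg, map_mul]
  rfl

variable [Module.Finite ℝ S]

theorem exists_clInvariant_family :
    ∃ (κ : Type) (_ : Fintype κ) (t : κ → S), Submodule.span ℝ (Set.range t) = ⊤ ∧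
      ∀ (i : Fin n) (B : LinearMap.BilinForm ℝ S),
        ∑ j, B (CliffordAlgebra.ι (stdForm n) (Pi.single i 1) • t j)
          (CliffordAlgebra.ι (stdForm n) (Pi.single i 1) • t j) = ∑ j, B (t j) (t j) :=
  exists_invariant_family (fun i => clEnd S (CliffordAlgebra.ι (stdForm n) (Pi.single i 1)))
    (clEnd_generator_sq S) fun _ _ hij => Or.inr (clEnd_generator_anticomm S hij)

variable [Module ℍ[ℝ] S] [IsScalarTower ℝ ℍ[ℝ] S] [SMulCommClass ℍ[ℝ] (Cl n) S]

/-- Clifford generators anticommute among themselves, as do i, j, k, and the two kinds commute with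
each other. All of them square to -1, so one doubling argument handles them together. -/
theorem exists_clQuaternionInvariant_family :
    ∃ (κ : Type) (_ : Fintype κ) (t : κ → S), Submodule.span ℝ (Set.range t) = ⊤ ∧
      (∀ (i : Fin n) (B : LinearMap.BilinForm ℝ S),
        ∑ j, B (CliffordAlgebra.ι (stdForm n) (Pi.single i 1) • t j)
          (CliffordAlgebra.ι (stdForm n) (Pi.single i 1) • t j) = ∑ j, B (t j) (t j)) ∧
      ∀ l ∈ ({unitI, unitJ, unitK} : Set ℍ[ℝ]), ∀ B : LinearMap.BilinForm ℝ S,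
        ∑ j, B (l • t j) (l • t j) = ∑ j, B (t j) (t j) := by
  have hsq : ∀ l ∈ ({unitI, unitJ, unitK} : Set ℍ[ℝ]), l * l = -1 := by
    rintro l (rfl | rfl | rfl) <;> ext <;> simp
  have hanti : ∀ l ∈ ({unitI, unitJ, unitK} : Set ℍ[ℝ]),
      ∀ k ∈ ({unitI, unitJ, unitK} : Set ℍ[ℝ]), l ≠ k → l * k = -(k * l) := by
    rintro l (rfl | rfl | rfl) k (rfl | rfl | rfl) h <;>
      first | exact absurd rfl h | (ext <;> simp)
  let u : Fin n ⊕ ({unitI, unitJ, unitK} : Set ℍ[ℝ]) → Module.End ℝ S :=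
    Sum.elim (fun i => clEnd S (CliffordAlgebra.ι (stdForm n) (Pi.single i 1)))
      fun l => Algebra.lsmul ℝ ℝ S (l : ℍ[ℝ])
  obtain ⟨κ, inst, t, h1, h2⟩ := exists_invariant_family u (by
      rintro (i | l) s
      · exact clEnd_generator_sq S i s
      · change (l : ℍ[ℝ]) • (l : ℍ[ℝ]) • s = -s
        rw [smul_smul, hsq l l.2, neg_smul, one_smul]) (by
      rintro (i | l) (j | k) hij
      · exact Or.inr (clEnd_generator_anticomm S fun h => hij (congrArg Sum.inl h))
      · exact Or.inl fun s => (smul_comm (k : ℍ[ℝ]) (CliffordAlgebra.ι (stdForm n) (Pi.single i 1)) s).symm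
      · exact Or.inl fun s => smul_comm (l : ℍ[ℝ]) (CliffordAlgebra.ι (stdForm n) (Pi.single j 1)) s
      · refine Or.inr fun s => ?_
        change (l : ℍ[ℝ]) • (k : ℍ[ℝ]) • s = -((k : ℍ[ℝ]) • (l : ℍ[ℝ]) • s)
        rw [smul_smul, smul_smul, ← neg_smul,
          hanti l l.2 k k.2 fun h => hij (congrArg Sum.inr (Subtype.ext h))])
  exact ⟨κ, inst, t, h1, fun i => h2 (Sum.inl i), fun l hl => h2 (Sum.inr ⟨l, hl⟩)⟩

end Families

/-! ### The evaluation pairing, and quaternionic homogeneity of the form. -/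

section

variable {X : Type*} [TopologicalSpace X] {V : X → Type*}
  [∀ x, AddCommGroup (V x)] [∀ x, Module ℝ (V x)] [TopologicalSpace (Tot V)] {n : ℕ}
  {g : EuclideanStructure V} {o : BundleOrientation V n} {𝔰 : SpinStructure g o}
  {S : Type*} [AddCommGroup S] [Module ℝ S] [Module (Cl n) S] [IsScalarTower ℝ (Cl n) S]
  {L : X → Type*} [∀ x, AddCommGroup (L x)] [∀ x, Module ℝ (L x)] {μ : ClAction g L}

variable (𝔰 S μ) in
/-- The evaluation `(φ, ξ) ↦ φ ξ` as a bilinear map. -/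
def clHomEval (x : X) : ClHom 𝔰 S μ x →ₗ[ℝ] Spinor 𝔰 S x →ₗ[ℝ] L x where
  toFun φ := φ.1
  map_add' _ _ := rfl
  map_smul' _ _ := rfl

/-- Moving λ from the first argument to the second turns it into its conjugate, and there λ λ̄ =
|λ|² is a real scalar. -/
theorem homForm_quaternion_smul [Module ℍ[ℝ] S] [IsScalarTower ℝ ℍ[ℝ] S]
    [SMulCommClass ℍ[ℝ] (Cl n) S] {x : X} (B : LinearMap.BilinForm ℝ (L x)) {κ : Type}
    [Fintype κ] {t : κ → S}
    (ht : ∀ l ∈ ({unitI, unitJ, unitK} : Set ℍ[ℝ]), ∀ B : LinearMap.BilinForm ℝ S,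
      ∑ j, B (l • t j) (l • t j) = ∑ j, B (t j) (t j))
    (p : 𝔰.P x) (φ ψ : ClHom 𝔰 S μ x) (l : ℍ[ℝ]) :
    homForm B t p (MulOpposite.op l • φ) (MulOpposite.op l • ψ) =
      Quaternion.normSq l * homForm B t p φ ψ := by
  have hl : ∀ (φ : ClHom 𝔰 S μ x) s, (MulOpposite.op l • φ).1 (spinorEquiv 𝔰 S p s) =
      φ.1 (spinorEquiv 𝔰 S p (l • s)) := fun φ s => by
    rw [← quaternion_smul_spinorEquiv]
    rfl
  rw [homForm_apply, homForm_apply]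
  simp only [hl]
  let B' : LinearMap.BilinForm ℝ S := B.compl₁₂ (φ.1.comp (spinorEquiv 𝔰 S p).toLinearMap)
    (ψ.1.comp ((spinorEquiv 𝔰 S p).toLinearMap.comp (Algebra.lsmul ℝ ℝ S l)))
  refine (sum_quaternionSmul_left ht l B').trans ?_
  rw [Finset.mul_sum]
  refine Finset.sum_congr rfl fun j _ => ?_
  change B _ (ψ.1 (spinorEquiv 𝔰 S p (l • star l • t j))) = _
  rw [smul_smul, Quaternion.self_mul_star, show ((Quaternion.normSq l : ℝ) : ℍ[ℝ]) = algebraMap ℝ ℍ[ℝ] (Quaternion.normSq l) from rfl,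
    algebraMap_smul, map_smul,
    map_smul, map_smul, smul_eq_mul]
  rfl

end

end TwistedSpinor

end

/-! ### The theorem, with commutant ℝ for even m and ℍᵐᵒᵖ for odd m. -/

theorem proposition9p4 {X : Type uX} [TopologicalSpace X] (m : ℕ)
    {V : X → Type uV} [∀ x, AddCommGroup (V x)] [∀ x, Module ℝ (V x)] [TopologicalSpace (Tot V)]
    [IsVectorBundle ℝ V]
    (g : EuclideanStructure V) (o : BundleOrientation V (4 * m)) (𝔰 : SpinStructure.{uP} g o)
    (S : Type uS) [AddCommGroup S] [Module ℝ S] [Module (Cl (4 * m)) S]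
    [IsScalarTower ℝ (Cl (4 * m)) S] [IsSimpleModule (Cl (4 * m)) S]
    [TopologicalSpace S] [IsModuleTopology ℝ S] :
    (Even m →
      -- `Λ ≅ E ⊗ Σ` with `E = Hom_{Cl(V)}(Σ, Λ)`
      (∀ (Λ : X → Type uL) [∀ x, AddCommGroup (Λ x)] [∀ x, Module ℝ (Λ x)]
        [TopologicalSpace (Tot Λ)] [IsVectorBundle ℝ Λ] (c : ClModuleBundle g Λ),
        ∃ (_ : TopologicalSpace (Tot (ClHom 𝔰 S c.μ))) (_ : IsVectorBundle ℝ (ClHom 𝔰 S c.μ))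
          (_ : EuclideanStructure (ClHom 𝔰 S c.μ))
          (j : ∀ x, TensorBundle (ClHom 𝔰 S c.μ) (Spinor 𝔰 S) x ≃ₗ[ℝ] Λ x),
          (∀ x (φ : ClHom 𝔰 S c.μ x) (ξ : Spinor 𝔰 S x),
            j x (TensorBundle.tmul _ _ φ ξ) = φ.1 ξ) ∧
          IsBundleIso j ∧ IsClLinear (twistedAction 𝔰 S _) c.μ j) ∧
      -- `E` is determined up to isomorphism by `E ⊗ Σ`
      (∀ (E : X → Type uE) [∀ x, AddCommGroup (E x)] [∀ x, Module ℝ (E x)]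
        [TopologicalSpace (Tot E)] [IsVectorBundle ℝ E]
        (E' : X → Type uF) [∀ x, AddCommGroup (E' x)] [∀ x, Module ℝ (E' x)]
        [TopologicalSpace (Tot E')] [IsVectorBundle ℝ E']
        (φ : ∀ x, TensorBundle E (Spinor 𝔰 S) x ≃ₗ[ℝ] TensorBundle E' (Spinor 𝔰 S) x),
        IsBundleIso φ → IsClLinear (twistedAction 𝔰 S E) (twistedAction 𝔰 S E') φ →
        ∃ f : ∀ x, E x ≃ₗ[ℝ] E' x, IsBundleIso f)) ∧
    (Odd m →
      -- `S` carries a quaternionic structure that commutes with the Clifford algebra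
      (∃ _ : Module ℍ[ℝ] S, IsScalarTower ℝ ℍ[ℝ] S ∧ SMulCommClass ℍ[ℝ] (Cl (4 * m)) S) ∧
      -- and for each such structure the following holds
      ∀ [Module ℍ[ℝ] S] [IsScalarTower ℝ ℍ[ℝ] S] [SMulCommClass ℍ[ℝ] (Cl (4 * m)) S],
      (∀ (Λ : X → Type uL) [∀ x, AddCommGroup (Λ x)] [∀ x, Module ℝ (Λ x)]
        [TopologicalSpace (Tot Λ)] [IsVectorBundle ℝ Λ] (c : ClModuleBundle g Λ),
        ∃ (_ : TopologicalSpace (Tot (ClHom 𝔰 S c.μ)))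
          (_ : IsVectorBundle ℍ[ℝ]ᵐᵒᵖ (ClHom 𝔰 S c.μ))
          (h : EuclideanStructure (ClHom 𝔰 S c.μ))
          (j : ∀ x, HTensorBundle (ClHom 𝔰 S c.μ) (Spinor 𝔰 S) x ≃ₗ[ℝ] Λ x),
          (∀ x (φ ψ : ClHom 𝔰 S c.μ x) (l : ℍ[ℝ]),
            h.form x (MulOpposite.op l • φ) (MulOpposite.op l • ψ) =
              Quaternion.normSq l * h.form x φ ψ) ∧
          (∀ x (φ : ClHom 𝔰 S c.μ x) (ξ : Spinor 𝔰 S x),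
            j x (HTensorBundle.tmul _ _ φ ξ) = φ.1 ξ) ∧
          IsBundleIso j ∧ IsClLinear (hTwistedAction 𝔰 S _) c.μ j) ∧
      (∀ (E : X → Type uE) [∀ x, AddCommGroup (E x)] [∀ x, Module ℝ (E x)]
        [∀ x, Module ℍ[ℝ]ᵐᵒᵖ (E x)] [∀ x, IsScalarTower ℝ ℍ[ℝ]ᵐᵒᵖ (E x)]
        [TopologicalSpace (Tot E)] [IsVectorBundle ℍ[ℝ]ᵐᵒᵖ E]
        (E' : X → Type uF) [∀ x, AddCommGroup (E' x)] [∀ x, Module ℝ (E' x)]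
        [∀ x, Module ℍ[ℝ]ᵐᵒᵖ (E' x)] [∀ x, IsScalarTower ℝ ℍ[ℝ]ᵐᵒᵖ (E' x)]
        [TopologicalSpace (Tot E')] [IsVectorBundle ℍ[ℝ]ᵐᵒᵖ E']
        (φ : ∀ x, HTensorBundle E (Spinor 𝔰 S) x ≃ₗ[ℝ] HTensorBundle E' (Spinor 𝔰 S) x),
        IsBundleIso φ → IsClLinear (hTwistedAction 𝔰 S E) (hTwistedAction 𝔰 S E') φ →
        ∃ f : ∀ x, E x ≃ₗ[ℍ[ℝ]ᵐᵒᵖ] E' x, IsBundleIso f)) := by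
  refine ⟨fun hm => ?_, fun hm => ?_⟩
  · have hA := (isMatrixAlgebra_cl m).1 hm
    have := hA.finite_of_isSimpleModule S
    have := IsSimpleModule.nontrivial (Cl (4 * m)) S
    let C : Commutant (Cl (4 * m)) ℝ S := hA.realCommutant
    refine ⟨?_, ?_⟩
    · intro Λ _ _ _ _ c
      have hmc := exists_moduleChart 𝔰 (S := S) hA c
      have hK : ∀ x (r : ℝ) (φ : ClHom 𝔰 S c.μ x) (p : 𝔰.P x) s,
          (r • φ).1 (spinorEquiv 𝔰 S p s) = φ.1 (spinorEquiv 𝔰 S p (C.ρ r s)) := by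
        intro x r φ p s
        rw [hA.realCommutant_apply, map_smul, map_smul]
        rfl
      obtain ⟨κ, _, t, hspan, ht⟩ := exists_clInvariant_family (n := 4 * m) S
      letI := homTopology (𝔰 := 𝔰) C c.μ
      obtain ⟨h, -⟩ := exists_homEuclidean C hmc hspan ht
      obtain ⟨j, hj, hj_iso, hj_lin⟩ := exists_evaluation_iso C hK hmc
        (tensorMk (ClHom 𝔰 S c.μ) (Spinor 𝔰 S)) (twistedAction 𝔰 S _)
        (isTwistedProduct_tensorBundle C hA.realCommutant_apply)
        (fun x => tensorLift (clHomEval 𝔰 S c.μ x)) fun x φ ξ => rfl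
      exact ⟨homTopology C c.μ, isVectorBundle_clHom C hK hmc, h, j,
        fun x φ ξ => hj x _, hj_iso, hj_lin⟩
    · intro E _ _ _ _ E' _ _ _ _ φ hφ hlin
      exact exists_iso_of_twisted (isTwistedProduct_tensorBundle C hA.realCommutant_apply)
        (isTwistedProduct_tensorBundle C hA.realCommutant_apply) φ hφ hlin
  · have hA := (isMatrixAlgebra_cl m).2 hm
    have := hA.finite_of_isSimpleModule S
    have := IsSimpleModule.nontrivial (Cl (4 * m)) S
    refine ⟨hA.exists_quaternion_module S, ?_⟩
    intro _ _ _
    -- The commutant is formed with the given quaternionic structure, which exhausts the Clifford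
    -- linear endomorphisms of S by dimension.
    let C : Commutant (Cl (4 * m)) ℍ[ℝ]ᵐᵒᵖ S := hA.quaternionCommutant
    refine ⟨?_, ?_⟩
    · intro Λ _ _ _ _ c
      have hmc := exists_moduleChart 𝔰 (S := S) hA c
      have hK : ∀ x (r : ℍ[ℝ]ᵐᵒᵖ) (φ : ClHom 𝔰 S c.μ x) (p : 𝔰.P x) s,
          (r • φ).1 (spinorEquiv 𝔰 S p s) = φ.1 (spinorEquiv 𝔰 S p (C.ρ r s)) := by
        intro x r φ p s
        rw [hA.quaternionCommutant_apply, ← quaternion_smul_spinorEquiv]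
        rfl
      obtain ⟨κ, _, t, hspan, ht, ht'⟩ := exists_clQuaternionInvariant_family (n := 4 * m) S
      letI := homTopology (𝔰 := 𝔰) C c.μ
      obtain ⟨h, hh⟩ := exists_homEuclidean C hmc hspan ht
      obtain ⟨j, hj, hj_iso, hj_lin⟩ := exists_evaluation_iso C hK hmc
        (hTensorMk (ClHom 𝔰 S c.μ) (Spinor 𝔰 S)) (hTwistedAction 𝔰 S _)
        (isTwistedProduct_hTensorBundle C hA.quaternionCommutant_apply)
        (fun x => hTensorLift (clHomEval 𝔰 S c.μ x) fun l v w => rfl) fun x φ ξ => rfl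
      refine ⟨homTopology C c.μ, isVectorBundle_clHom C hK hmc, h, j, fun x φ ψ l => ?_,
        fun x φ ξ => hj x _, hj_iso, hj_lin⟩
      -- The chart serves only to provide a point of P_x.
      obtain ⟨mc, hx⟩ := hmc x
      rw [hh x (mc.p ⟨x, hx⟩)]
      exact homForm_quaternion_smul _ ht' _ φ ψ l
    · intro E _ _ _ _ _ _ E' _ _ _ _ _ _ φ hφ hlin
      exact exists_iso_of_twisted (isTwistedProduct_hTensorBundle C hA.quaternionCommutant_apply)
        (isTwistedProduct_hTensorBundle C hA.quaternionCommutant_apply) φ hφ hlin
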